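/- **Theorem 4.1.** Let $(\Omega,\mathcal A,\mathbb P)$ be a complete probability space, let $T>0$ and $p\ge 2$, and let $G_t(dx)$ be, for $t>0$, the fundamental solution either of the heat equation $\partial_t u=\frac12\Delta u$ on $\mathbb R^d$, $d\ge 1$, i.e. $G_t(dx)=(2\pi t)^{-d/2}e^{-|x|^2/(2t)}\,dx$, or of the wave equation $\partial_t^2u=\Delta u$ on $\mathbb R^d$, $d\in\{1,2,3\}$, i.e. $G_t(dx)=\frac12\mathbf 1_{\{|x|<t\}}dx$ for $d=1$, $G_t(dx)=\frac1{2\pi}(t^2-|x|^2)^{-1/2}\mathbf 1_{\{|x|<t\}}dx$ for $d=2$, and $G_t=\frac1{4\pi t}\sigma_t$ for $d=3$, where $\sigma_t$ is the surface measure on the sphere of radius $t$. For a function $f$, $(f*G_t)(x)=\int f(x-y)\,G_t(dy)$. Let $\mu_n$ be a non-negative measure on $\mathcal B(\mathbb R^d)$ satisfying Dalang's condition $$\int_{\mathbb R^d}\frac{\mu_n(d\xi)}{1+|\xi|^2}<\infty ,$$ and let $W^n=\{W^n(\varphi):\varphi\in C_0^\infty([0,\infty)\times\mathbb R^d)\}$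 be a centred Gaussian process on $(\Omega,\mathcal A,\mathbb P)$ with $$\mathbb E[W^n(\varphi)W^n(\psi)]=\int_0^\infty\!\int_{\mathbb R^d}\mathcal F\varphi(t,\cdot)(\xi)\,\overline{\mathcal F\psi(t,\cdot)(\xi)}\,\mu_n(d\xi)\,dt,\qquad \mathcal Ff(\xi)=\int_{\mathbb R^d} e^{-i\langle\xi,x\rangle}f(x)\,dx .$$ Wiener integrals $W^n(g)=\int_0^\infty\!\int g(t,x)\,W^n(dt,dx)$ are defined by the isometric extension of $W^n$ to the completion of $C_0^\infty([0,\infty)\times\mathbb R^d)$ for this inner product, elements $g$ of the completion being identified with their Fourier transforms $\mathcal Fg(t)(\xi)$ in $L^2(dt\otimes\mu_n)$. Let $\mathcal F_t$ be the $\sigma$-field generated by the variables $W^n(\mathbf 1_{[0,s]}\varphi)$, $s\in[0,t]$, $\varphi\in C_0^\infty([0,\infty)\times\mathbb R^d)$, and the $\mathbb P$-null sets. Let $b:\mathbb R\to\mathbb R$ be globally Lipschitz, and let the deterministic initial data satisfy: * heat equation: $u_0$ is measurable and bounded; * wave equation, $d=1$: $u_0$ is bounded and continuous, $v_0$ is bounded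 and measurable; * wave equation, $d=2$: $u_0\in C^1(\mathbb R^2)$ and there is $q\in(2,\infty]$ such that $u_0,\nabla u_0,v_0\in L^q(\mathbb R^2)$; * wave equation, $d=3$: $u_0\in C^1(\mathbb R^3)$, $u_0$ and $\nabla u_0$ are bounded, $v_0$ is bounded and continuous. Put $I_0^d(0,x)=u_0(x)$ and, for $t>0$, $I_0^d(t,x)=(u_0*G_t)(x)$ for the heat equation and $I_0^d(t,x)=(v_0*G_t)(x)+\frac{\partial}{\partial t}(u_0*G_t)(x)$ for the wave equation. A mild solution on $[0,T]\times\mathbb R^d$ is an adapted (to $(\mathcal F_t)$), jointly measurable process $u^n$ such that, for all $(t,x)\in[0,T]\times\mathbb R^d$, $\mathbb P$-almost surely, $$u^n(t,x)=I_0^d(t,x)+\int_0^t\!\int_{\mathbb R^d}G_{t-s}(x-y)\,W^n(ds,dy)+\int_0^t\big(b(u^n(s,\cdot))*G_{t-s}\big)(x)\,ds ,$$ the last integral converging absolutely. Then there is a mild solution $u^n$ that satisfies $$\sup_{(t,x)\in[0,T]\times\mathbb R^d}\mathbb E\big[|u^n(t,x)|^p\big]<\infty$$ and is $L^2(\Omega)$-continuous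 on $[0,T]\times\mathbb R^d$, except possibly at points $(0,x)$ at which $u_0$ is discontinuous (such points can occur only for the heat equation). It is unique among the mild solutions with these two properties: if $v^n$ is another one, then $u^n(t,x)=v^n(t,x)$ $\mathbb P$-a.s. for every $(t,x)\in[0,T]\times\mathbb R^d$. -/

import Mathlib

open MeasureTheory ProbabilityTheory Filter Topology Set
open scoped ENNReal NNReal

noncomputable section

namespace QuasiLinearSPDE

/-- The space `ℝ^d` with its Euclidean norm. -/
abbrev Space (d : ℕ) : Type := EuclideanSpace ℝ (Fin d)

/-- Real test functions. An element of `C_0^∞([0,∞) × ℝ^d)` (smooth up to time `0`, compact support)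
is the restriction to `[0,∞) × ℝ^d` of a function of this type. Below, only the values at
nonnegative times enter the covariance of the noise, so a noise indexed by `C_0^∞([0,∞) × ℝ^d)`
is the same thing, up to null sets, as a noise indexed by this type. -/
abbrev TestFn (d : ℕ) : Type :=
  TestFunction (⊤ : TopologicalSpace.Opens (ℝ × Space d)) ℝ ⊤

/-- The Fourier transform of a function, `ℱ f (ξ) = ∫ e^{-i⟨ξ,x⟩} f(x) dx`. -/
def fourierFn {d : ℕ} (f : Space d → ℝ) (ξ : Space d) : ℂ :=
  ∫ x, Complex.exp (-(Complex.I * (inner ℝ ξ x : ℝ))) * (f x : ℂ)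

/-- The Fourier transform of a finite measure, `ℱ m (ξ) = ∫ e^{-i⟨ξ,x⟩} m(dx)`. -/
def fourierMeas {d : ℕ} (m : Measure (Space d)) (ξ : Space d) : ℂ :=
  ∫ x, Complex.exp (-(Complex.I * (inner ℝ ξ x : ℝ))) ∂m

/-- The Fourier transform in space of a test function, `(t, ξ) ↦ ℱ φ(t,·)(ξ)`. -/
def fourierTest {d : ℕ} (φ : TestFn d) (t : ℝ) (ξ : Space d) : ℂ :=
  fourierFn (fun x => φ (t, x)) ξ

/-- `W` is a spatially homogeneous Gaussian noise with spectral measure `μ`: a centred Gaussian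
process indexed by the test functions with covariance
`E[W(φ) W(ψ)] = ∫_0^∞ ∫ ℱφ(t,·)(ξ) conj(ℱψ(t,·)(ξ)) μ(dξ) dt`. -/
structure IsNoise {Ω : Type*} [MeasurableSpace Ω] {d : ℕ} (P : Measure Ω)
    (μ : Measure (Space d)) (W : TestFn d → Ω → ℝ) : Prop where
  gaussian : IsGaussianProcess W P
  centred : ∀ φ, ∫ ω, W φ ω ∂P = 0
  covariance : ∀ φ ψ, ((∫ ω, W φ ω * W ψ ω ∂P : ℝ) : ℂ) =
    ∫ t in Ioi (0 : ℝ), ∫ ξ, fourierTest φ t ξ * (starRingEnd ℂ) (fourierTest ψ t ξ) ∂μ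

/-- `X` is (a version of) the Wiener integral `∫_0^∞ ∫ g(t,x) W(dt,dx)`, where `h(t,ξ)` is the
Fourier transform of `g(t)` at `ξ`. The completion of the test functions for the covariance inner
product is realised as the closure of their Fourier transforms in `L²(dt ⊗ μ)`: `g` belongs to it
when `h` is the limit there of the transforms of some test functions `φ k`, and then `X` is the
`L²(Ω)`-limit of `W (φ k)`. By the isometry, `X` is almost surely determined by `h`. -/
def IsWienerIntegral {Ω : Type*} [MeasurableSpace Ω] {d : ℕ} (P : Measure Ω)
    (μ : Measure (Space d)) (W : TestFn d → Ω → ℝ) (h : ℝ → Space d → ℂ) (X : Ω → ℝ) : Prop :=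
  Measurable X ∧ ∃ φ : ℕ → TestFn d,
    Tendsto (fun k => ∫⁻ t in Ioi (0 : ℝ), ∫⁻ ξ, ‖fourierTest (φ k) t ξ - h t ξ‖ₑ ^ 2 ∂μ)
      atTop (𝓝 0) ∧
    Tendsto (fun k => ∫⁻ ω, ‖W (φ k) ω - X ω‖ₑ ^ 2 ∂P) atTop (𝓝 0)

/-- The filtration generated by the noise,
`ℱ_t = σ(W(1_{[0,s]} φ), s ∈ [0,t], φ a test function) ∨ {null sets}`. -/
@[reducible] def noiseFiltration {Ω : Type*} [MeasurableSpace Ω] {d : ℕ} (P : Measure Ω)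
    (μ : Measure (Space d)) (W : TestFn d → Ω → ℝ) (t : ℝ) : MeasurableSpace Ω :=
  MeasurableSpace.generateFrom
    ({A | ∃ s ∈ Icc (0 : ℝ) t, ∃ (φ : TestFn d) (X : Ω → ℝ),
        IsWienerIntegral P μ W (fun r => (Icc (0 : ℝ) s).indicator (fourierTest φ) r) X ∧
        ∃ B : Set ℝ, MeasurableSet B ∧ A = X ⁻¹' B} ∪
      {N | P N = 0})

/-- The two equations: the stochastic heat equation `∂_t u - ½ Δu = b(u) + Ẇ` and the stochastic
wave equation `∂_t² u - Δu = b(u) + Ẇ`. -/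
inductive Eqn
  | heat
  | wave

/-- The surface measure on the sphere of radius `t > 0` centred at the origin of `ℝ^3`
(total mass `4πt²`); `volume.toSphere` is the surface measure on the unit sphere. -/
def sphereMeasure (t : ℝ) : Measure (Space 3) :=
  ENNReal.ofReal (t ^ 2) •
    (volume : Measure (Space 3)).toSphere.map
      (fun y : Metric.sphere (0 : Space 3) 1 => t • (y : Space 3))

/-- The fundamental solution `G_t(dx)`, `t > 0`, of the heat equation (all dimensions) or of the
wave equation (dimensions `1`, `2`, `3`), as a measure on `ℝ^d`. -/
def fundSol : Eqn → (d : ℕ) → ℝ → Measure (Space d)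
  | .heat, d, t => volume.withDensity fun x =>
      ENNReal.ofReal (1 / (2 * Real.pi * t) ^ ((d : ℝ) / 2) * Real.exp (-(‖x‖ ^ 2 / (2 * t))))
  | .wave, 1, t => volume.withDensity
      ((Metric.ball 0 t).indicator fun _ => ENNReal.ofReal (1 / 2))
  | .wave, 2, t => volume.withDensity
      ((Metric.ball 0 t).indicator fun x =>
        ENNReal.ofReal (1 / (2 * Real.pi) * (1 / Real.sqrt (t ^ 2 - ‖x‖ ^ 2))))
  | .wave, 3, t => ENNReal.ofReal (1 / (4 * Real.pi * t)) • sphereMeasure t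
  | .wave, _, _ => 0

/-- The convolution `(f * G_t)(x) = ∫ f(x - y) G_t(dy)`. -/
def convG (eq : Eqn) {d : ℕ} (f : Space d → ℝ) (t : ℝ) (x : Space d) : ℝ :=
  ∫ y, f (x - y) ∂(fundSol eq d t)

/-- The solution `I_0^d` of the deterministic linear equation with initial data `u₀` (and `v₀` for
the wave equation); its value at time `0` is `u₀`. -/
def initialTerm (eq : Eqn) {d : ℕ} (u₀ v₀ : Space d → ℝ) (t : ℝ) (x : Space d) : ℝ :=
  if t ≤ 0 then u₀ x else
    match eq with
    | .heat => convG .heat u₀ t x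
    | .wave => convG .wave v₀ t x + deriv (fun τ => convG .wave u₀ τ x) t

/-- The hypothesis on the initial data. For the heat equation `v₀` plays no role. -/
def InitialDataHyp : Eqn → (d : ℕ) → (u₀ v₀ : Space d → ℝ) → Prop
  | .heat, _, u₀, _ => Measurable u₀ ∧ ∃ C : ℝ, ∀ x, |u₀ x| ≤ C
  | .wave, 1, u₀, v₀ => Continuous u₀ ∧ (∃ C : ℝ, ∀ x, |u₀ x| ≤ C) ∧
      Measurable v₀ ∧ ∃ C : ℝ, ∀ x, |v₀ x| ≤ C
  | .wave, 2, u₀, v₀ => ContDiff ℝ 1 u₀ ∧ ∃ q : ℝ≥0∞, 2 < q ∧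
      MemLp u₀ q volume ∧ MemLp (gradient u₀) q volume ∧ MemLp v₀ q volume
  | .wave, 3, u₀, v₀ => ContDiff ℝ 1 u₀ ∧ (∃ C : ℝ, ∀ x, |u₀ x| ≤ C) ∧
      (∃ C : ℝ, ∀ x, ‖gradient u₀ x‖ ≤ C) ∧ Continuous v₀ ∧ ∃ C : ℝ, ∀ x, |v₀ x| ≤ C
  | .wave, _, _, _ => False

/-- The Fourier transform of the integrand `s ↦ 1_{(0,t)}(s) G_{t-s}(x - ·)` of the stochastic
convolution; `G_{t-s}(x - ·)` is the image of the measure `G_{t-s}` under `y ↦ x - y`. -/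
def convolutionIntegrand (eq : Eqn) {d : ℕ} (t : ℝ) (x : Space d) : ℝ → Space d → ℂ :=
  (Ioo (0 : ℝ) t).indicator fun s => fourierMeas ((fundSol eq d (t - s)).map fun y => x - y)

/-- `u` is a mild solution on `[0,T] × ℝ^d`: an adapted, jointly measurable process such that, for
all `(t,x)`, almost surely
`u(t,x) = I_0^d(t,x) + ∫_0^t ∫ G_{t-s}(x-y) W(ds,dy) + ∫_0^t (b(u(s)) * G_{t-s})(x) ds`,
where the last integral converges absolutely. -/
structure IsMildSolution {Ω : Type*} [MeasurableSpace Ω] {d : ℕ} (P : Measure Ω)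
    (μ : Measure (Space d)) (W : TestFn d → Ω → ℝ) (eq : Eqn) (b : ℝ → ℝ)
    (u₀ v₀ : Space d → ℝ) (T : ℝ) (u : ℝ → Space d → Ω → ℝ) : Prop where
  adapted : ∀ t ∈ Icc (0 : ℝ) T, ∀ x, Measurable[noiseFiltration P μ W t] (u t x)
  jointlyMeasurable : Measurable fun z : Icc (0 : ℝ) T × Space d × Ω => u z.1 z.2.1 z.2.2
  driftFinite : ∀ t ∈ Icc (0 : ℝ) T, ∀ x, ∀ᵐ ω ∂P,
    (∫⁻ s in Ioo (0 : ℝ) t, ∫⁻ y, ‖b (u s (x - y) ω)‖ₑ ∂(fundSol eq d (t - s))) < ∞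
  mild : ∀ t ∈ Icc (0 : ℝ) T, ∀ x, ∃ Z : Ω → ℝ,
    IsWienerIntegral P μ W (convolutionIntegrand eq t x) Z ∧
    ∀ᵐ ω ∂P, u t x ω = initialTerm eq u₀ v₀ t x + Z ω +
      ∫ s in Ioo (0 : ℝ) t, ∫ y, b (u s (x - y) ω) ∂(fundSol eq d (t - s))

/-- The random field `u` on `[0,T] × ℝ^d` is continuous in `L²(Ω)` at the point `(t,x)`. -/
def L2ContinuousAt {Ω : Type*} [MeasurableSpace Ω] {d : ℕ} (P : Measure Ω) (T : ℝ)
    (u : ℝ → Space d → Ω → ℝ) (t : ℝ) (x : Space d) : Prop :=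
  Tendsto (fun z : ℝ × Space d => ∫⁻ ω, ‖u z.1 z.2 ω - u t x ω‖ₑ ^ 2 ∂P)
    (𝓝[Icc (0 : ℝ) T ×ˢ univ] (t, x)) (𝓝 0)

/-- The space in which the solution is sought: `L^p(Ω)`-bounded and `L²(Ω)`-continuous fields.
Since a solution equals `u₀` at time `0`, continuity at `(0,x)` is required exactly at the points
`x` where `u₀` is continuous (so everywhere, if `u₀` is continuous). -/
structure IsBoundedL2Continuous {Ω : Type*} [MeasurableSpace Ω] {d : ℕ} (P : Measure Ω)
    (u₀ : Space d → ℝ) (T p : ℝ) (u : ℝ → Space d → Ω → ℝ) : Prop where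
  continuous : ∀ t ∈ Icc (0 : ℝ) T, ∀ x, (0 < t ∨ ContinuousAt u₀ x) → L2ContinuousAt P T u t x
  moment : (⨆ t ∈ Icc (0 : ℝ) T, ⨆ x, ∫⁻ ω, ‖u t x ω‖ₑ ^ p ∂P) < ∞

end QuasiLinearSPDE

end

/-! The noise is additive, so once the stochastic convolution Z(t,x) = ∫∫ G_{t-s}(x-y) W(ds,dy) is
known, the equation is a deterministic fixed-point problem in the Banach space E = L^p(Ω). With u =
I_0 + V it reads V = Z + G * b(I_0 + V), where b acts on E as a Lipschitz superposition operator and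
G * is a Volterra operator. Subtracting I_0 leaves an unknown V that is continuous even at time 0,
where I_0 may be discontinuous.

Both equations enter through `IsScalingKernel`: G_τ is a(τ) times the dilation by r(τ) of the finite
measure G_1 (a = 1, r = √τ for heat; a = r = τ for wave), and its Fourier transform is e^{-τ|ξ|²/2},
respectively sin(τ|ξ|)/|ξ|, whose square integrated over (0,T) is at most C/(1+|ξ|²). Dalang's
condition then makes the integrand of Z a bounded continuous function of (t,x) with values in L²(dt
⊗ μ) (`continuous_convL2`). An orthogonality argument places it in the closure of the test functions
that vanish after t (`convL2_mem_closure`). Since the noise is Gaussian, W is an isometry into every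
L^q(Ω), q < ∞, up to a constant (`IsNoise.eLpNorm_sub`), so Z is a bounded, continuous, adapted
L^p(Ω)-valued field (`exists_stochasticConvolution`).

After the dilation the drift is an integral against the fixed measure ds ⊗ G_1. In a sup norm with
weight e^{-lt}, l large, the equation for V is a contraction; the Picard iterates stay in the closed
subspaces of ℱ_t-measurable elements, hence so does their limit (`exists_volterra_fixedPoint`). A
jointly measurable version of V (`exists_measurable_modification`) and the equality of Bochner and
pathwise integrals (`integral_modification`) turn V into a mild solution (`exists_mildSolution`).

For uniqueness, the stochastic integrals of two solutions cancel almost surely. What remains says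
that E|u - v|, a bounded function, is dominated by a multiple of its own space-time convolution with
G, so that its weighted supremum is at most half of itself (`eq_zero_of_le_volterra`).

The remaining work is to show that I_0 is bounded, and continuous where required
(`IsRegularInitial`): by Hölder averaging for heat and for the v₀ term of the wave equation in
dimensions one and two, by d'Alembert's formula in dimension one, and by differentiating means under
the integral in dimensions two and three. -/

noncomputable section

namespace QuasiLinearSPDE

/-! ### Test functions and the decay of their Fourier transforms -/

section TestFunctions

variable {d : ℕ}

/-- The character `x ↦ e^{-i⟨ξ,x⟩}`. -/
def phase (ξ x : Space d) : ℂ := Complex.exp (-(Complex.I * (inner ℝ ξ x : ℝ)))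

lemma norm_phase (ξ x : Space d) : ‖phase ξ x‖ = 1 := by
  rw [phase, show -(Complex.I * (inner ℝ ξ x : ℝ)) = ((-(inner ℝ ξ x) : ℝ) : ℂ) * Complex.I by
    push_cast; ring, Complex.norm_exp_ofReal_mul_I]

lemma phase_add (ξ x y : Space d) : phase ξ (x + y) = phase ξ x * phase ξ y := by
  rw [phase, phase, phase, ← Complex.exp_add, inner_add_right]
  push_cast; ring_nf

lemma phase_sub (ξ x y : Space d) : phase ξ (x - y) = phase ξ x * phase ξ (-y) := by
  rw [sub_eq_add_neg, phase_add]

lemma phase_zero_right (ξ : Space d) : phase ξ 0 = 1 := by simp [phase]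

lemma continuous_phase : Continuous fun z : Space d × Space d => phase z.1 z.2 := by
  unfold phase; fun_prop

lemma exists_support_bound (φ : TestFn d) :
    ∃ R : ℝ, 0 ≤ R ∧ ∀ (t : ℝ) (x : Space d), φ (t, x) ≠ 0 → |t| ≤ R ∧ ‖x‖ ≤ R := by
  obtain ⟨R, hR⟩ := φ.hasCompactSupport.isCompact.isBounded.exists_norm_le
  refine ⟨max R 0, le_max_right _ _, fun t x h => ?_⟩
  have := hR (t, x) (subset_tsupport _ h)
  rw [Prod.norm_def] at this
  exact ⟨(le_max_left _ _).trans (this.trans (le_max_left _ _)),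
    (le_max_right _ _).trans (this.trans (le_max_left _ _))⟩

lemma exists_sup_bound (φ : TestFn d) : ∃ M : ℝ, 0 ≤ M ∧ ∀ z, |φ z| ≤ M := by
  obtain ⟨M, hM⟩ := φ.continuous.bounded_above_of_compact_support φ.hasCompactSupport
  exact ⟨max M 0, le_max_right _ _, fun z => (hM z).trans (le_max_left _ _)⟩

lemma fourierTest_eq (φ : TestFn d) (t : ℝ) (ξ : Space d) :
    fourierTest φ t ξ = ∫ x, phase ξ x * (φ (t, x) : ℂ) := rfl

lemma integrable_slice (φ : TestFn d) (t : ℝ) : Integrable fun x => φ (t, x) := by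
  obtain ⟨R, hR0, hR⟩ := exists_support_bound φ
  refine Continuous.integrable_of_hasCompactSupport (φ.continuous.comp (by fun_prop)) ?_
  refine HasCompactSupport.intro (isCompact_closedBall (0 : Space d) R) fun x hx => ?_
  by_contra h
  exact hx (by simpa using (hR t x h).2)

lemma integrable_phase_mul {f : Space d → ℂ} {m : Measure (Space d)} (hf : Integrable f m)
    (ξ : Space d) : Integrable (fun x => phase ξ x * f x) m := by
  refine hf.bdd_mul (c := 1) ?_ (Eventually.of_forall fun x => (norm_phase ξ x).le)
  exact (continuous_phase.comp (by fun_prop : Continuous fun x => (ξ, x))).aestronglyMeasurable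

/-- The Fourier transforms of the slices of a test function decay like `1/|ξ|`, uniformly in time. -/
lemma fourierTest_bound (φ : TestFn d) :
    ∃ C R : ℝ, 0 ≤ C ∧ ∀ t ξ, ‖fourierTest φ t ξ‖ ^ 2 ≤
      (Icc (-R) R).indicator (fun _ => C) t * (1 / (1 + ‖ξ‖ ^ 2)) := by
  obtain ⟨R, hR0, hR⟩ := exists_support_bound φ
  obtain ⟨M, hM0, hM⟩ := exists_sup_bound φ
  obtain ⟨L, hL⟩ := ContDiff.lipschitzWith_of_hasCompactSupport (𝕂 := ℝ) φ.hasCompactSupport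
    φ.contDiff (by simp)
  set V : ℝ := (volume : Measure (Space d)).real (Metric.closedBall 0 (R + Real.pi)) with hV
  have hV0 : 0 ≤ V := measureReal_nonneg
  have hfin : ∀ r, (volume : Measure (Space d)) (Metric.closedBall 0 r) < ∞ := fun r =>
    measure_closedBall_lt_top
  set A : ℝ := M * V with hA
  set B : ℝ := L * Real.pi * V with hB
  have hA0 : 0 ≤ A := by positivity
  have hB0 : 0 ≤ B := by have := Real.pi_pos; positivity
  -- With |ℱφ| ≤ A always and |ξ||ℱφ| ≤ B for |ξ| ≥ 1, the quantity |ℱφ|²(1+|ξ|²) is at most A² + B²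
  -- when |ξ| ≥ 1 and at most 2A² otherwise.
  refine ⟨2 * (A ^ 2 + B ^ 2), R, by positivity, fun t ξ => ?_⟩
  by_cases ht : t ∈ Icc (-R) R
  swap
  · have : fourierTest φ t ξ = 0 := by
      rw [fourierTest_eq]
      have : ∀ x : Space d, φ (t, x) = 0 := fun x => by
        by_contra h
        exact ht (abs_le.1 (hR t x h).1)
      simp [this]
    simp [this, ht]
  rw [indicator_of_mem ht]
  have h1 : ‖fourierTest φ t ξ‖ ≤ A := by
    rw [fourierTest_eq, ← setIntegral_eq_integral_of_forall_compl_eq_zero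
      (s := Metric.closedBall (0 : Space d) (R + Real.pi))]
    · refine norm_setIntegral_le_of_norm_le_const (hfin _) fun x _ => ?_
      rw [norm_mul, norm_phase, one_mul, Complex.norm_real]
      exact hM _
    · intro x hx
      have : φ (t, x) = 0 := by
        by_contra h
        exact hx (by simpa using (hR t x h).2.trans (by linarith [Real.pi_pos]))
      simp [this]
  have h2 : 1 ≤ ‖ξ‖ → ‖fourierTest φ t ξ‖ ≤ B / ‖ξ‖ := by
    intro hξ
    have hξ0 : 0 < ‖ξ‖ := by linarith
    -- Translation by this half period flips the sign of the character, so twice the transform is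
    -- the transform of φ - φ(· - v), which is at most L|v| = Lπ/|ξ|. The condition |ξ| ≥ 1 gives
    -- |v| ≤ π, so both terms live in the ball of radius R + π.
    set v : Space d := (Real.pi / ‖ξ‖ ^ 2) • ξ with hv
    have hvn : ‖v‖ = Real.pi / ‖ξ‖ := by
      rw [hv, norm_smul, Real.norm_of_nonneg (by have := Real.pi_pos; positivity)]
      field_simp
    have hvπ : ‖v‖ ≤ Real.pi := by
      rw [hvn]; exact div_le_self Real.pi_pos.le hξ
    have hph : phase ξ (-v) = -1 := by
      rw [phase, inner_neg_right, hv, inner_smul_right, real_inner_self_eq_norm_sq,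
        div_mul_cancel₀ _ (by positivity)]
      push_cast
      rw [mul_neg, neg_neg, mul_comm, Complex.exp_pi_mul_I]
    have hi : ∀ w : Space d, Integrable fun x => phase ξ x * (φ (t, x - w) : ℂ) := fun w =>
      integrable_phase_mul (((integrable_slice φ t).comp_sub_right w).ofReal) ξ
    have key : fourierTest φ t ξ = - ∫ x, phase ξ x * (φ (t, x - v) : ℂ) := by
      rw [fourierTest_eq, ← integral_sub_right_eq_self _ v, ← integral_neg]
      congr 1; ext x
      rw [phase_sub, hph]; ring
    have key2 : (2 : ℂ) * fourierTest φ t ξ =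
        ∫ x, phase ξ x * ((φ (t, x) - φ (t, x - v) : ℝ) : ℂ) := by
      have h0 : fourierTest φ t ξ = ∫ x, phase ξ x * (φ (t, x - 0) : ℂ) := by
        simp [fourierTest_eq]
      rw [two_mul]
      nth_rw 2 [key]
      rw [h0, ← sub_eq_add_neg, ← integral_sub (hi 0) (hi v)]
      congr 1; ext x
      push_cast; simp; ring
    have h3 : ‖(2 : ℂ) * fourierTest φ t ξ‖ ≤ (L * ‖v‖) * V := by
      rw [key2, ← setIntegral_eq_integral_of_forall_compl_eq_zero
        (s := Metric.closedBall (0 : Space d) (R + Real.pi))]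
      · refine norm_setIntegral_le_of_norm_le_const (hfin _) fun x _ => ?_
        rw [norm_mul, norm_phase, one_mul, Complex.norm_real]
        have := hL.dist_le_mul (t, x) (t, x - v)
        rw [Real.dist_eq] at this
        refine this.trans (le_of_eq ?_)
        rw [dist_eq_norm]
        simp [Prod.norm_def]
      · intro x hx
        have hx' : R + Real.pi < ‖x‖ := by simpa using hx
        have e1 : φ (t, x) = 0 := by
          by_contra h
          linarith [(hR t x h).2, Real.pi_pos]
        have e2 : φ (t, x - v) = 0 := by
          by_contra h
          have := (hR t _ h).2
          have := norm_sub_norm_le x v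
          linarith
        simp [e1, e2]
    rw [norm_mul, Complex.norm_two, hvn] at h3
    have : (L : ℝ) * (Real.pi / ‖ξ‖) * V = B / ‖ξ‖ := by rw [hB]; ring
    rw [this] at h3
    linarith [norm_nonneg (fourierTest φ t ξ)]
  rw [mul_one_div, le_div_iff₀ (by positivity)]
  have hn := norm_nonneg (fourierTest φ t ξ)
  rcases le_or_gt 1 ‖ξ‖ with hξ | hξ
  · have h3 : ‖fourierTest φ t ξ‖ * ‖ξ‖ ≤ B := by
      have := h2 hξ
      rwa [le_div_iff₀ (by linarith)] at this
    have h4 : (‖fourierTest φ t ξ‖ * ‖ξ‖) ^ 2 ≤ B ^ 2 := pow_le_pow_left₀ (by positivity) h3 2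
    have h5 : ‖fourierTest φ t ξ‖ ^ 2 ≤ A ^ 2 := pow_le_pow_left₀ hn h1 2
    nlinarith
  · have h5 : ‖fourierTest φ t ξ‖ ^ 2 ≤ A ^ 2 := pow_le_pow_left₀ hn h1 2
    have h6 : ‖ξ‖ ^ 2 ≤ 1 := by nlinarith [norm_nonneg ξ]
    nlinarith [sq_nonneg ‖fourierTest φ t ξ‖, sq_nonneg B]

lemma continuous_fourierTest (φ : TestFn d) :
    Continuous fun z : ℝ × Space d => fourierTest φ z.1 z.2 := by
  obtain ⟨R, hR0, hR⟩ := exists_support_bound φ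
  obtain ⟨M, hM0, hM⟩ := exists_sup_bound φ
  refine continuous_of_dominated (F := fun (z : ℝ × Space d) (x : Space d) =>
      phase z.2 x * (φ (z.1, x) : ℂ))
    (bound := (Metric.closedBall (0 : Space d) R).indicator fun _ => M)
    (fun z => (integrable_phase_mul (integrable_slice φ z.1).ofReal z.2).aestronglyMeasurable)
    (fun z => Eventually.of_forall fun x => ?_) ?_ (Eventually.of_forall fun x => ?_)
  · rw [norm_mul, norm_phase, one_mul, Complex.norm_real]
    by_cases h : φ (z.1, x) = 0
    · rw [h, norm_zero]; exact indicator_nonneg (fun _ _ => hM0) _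
    · rw [indicator_of_mem (by simpa using (hR _ x h).2)]; exact hM _
  · exact (integrable_indicator_iff measurableSet_closedBall).2
      (integrableOn_const measure_closedBall_lt_top.ne)
  · have hg : Continuous fun z : ℝ × Space d => (z.1, x) := by fun_prop
    have hφ : Continuous fun z : ℝ × Space d => φ (z.1, x) := Continuous.comp φ.continuous hg
    have hp : Continuous fun z : ℝ × Space d => phase z.2 x :=
      continuous_phase.comp (continuous_snd.prodMk continuous_const)
    exact hp.mul (Complex.continuous_ofReal.comp hφ)

lemma fourierTest_add (φ ψ : TestFn d) (t : ℝ) (ξ : Space d) :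
    fourierTest (φ + ψ) t ξ = fourierTest φ t ξ + fourierTest ψ t ξ := by
  simp only [fourierTest_eq]
  have hi : ∀ χ : TestFn d, Integrable fun x => phase ξ x * (χ (t, x) : ℂ) := fun χ =>
    integrable_phase_mul (integrable_slice χ t).ofReal ξ
  rw [← integral_add (hi φ) (hi ψ)]
  congr 1; ext x
  simp [mul_add]

lemma fourierTest_smul (c : ℝ) (φ : TestFn d) (t : ℝ) (ξ : Space d) :
    fourierTest (c • φ) t ξ = (c : ℂ) * fourierTest φ t ξ := by
  simp only [fourierTest_eq]
  rw [← integral_const_mul]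
  congr 1; ext x
  simp; ring

end TestFunctions

/-! ### The spectral measure and the space L²(dt ⊗ μ) -/

section SpectralMeasure

variable {d : ℕ} {μ : Measure (Space d)}

/-- Dalang's condition. -/
def Dalang (μ : Measure (Space d)) : Prop := ∫⁻ ξ, ENNReal.ofReal (1 / (1 + ‖ξ‖ ^ 2)) ∂μ < ∞

lemma measurable_dalang : Measurable fun ξ : Space d => ENNReal.ofReal (1 / (1 + ‖ξ‖ ^ 2)) := by
  fun_prop

/-- Dalang's condition says that (1+|ξ|²)⁻¹ μ is a finite measure, and μ has a finite density with
respect to it. This is what allows Fubini for dt ⊗ μ; the covariance of the noise is only given as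
an iterated integral. -/
lemma Dalang.sigmaFinite (h : Dalang μ) : SigmaFinite μ := by
  have hf : IsFiniteMeasure
      (μ.withDensity fun ξ : Space d => ENNReal.ofReal (1 / (1 + ‖ξ‖ ^ 2))) :=
    isFiniteMeasure_withDensity h.ne
  have h1 : μ = (μ.withDensity fun ξ : Space d => ENNReal.ofReal (1 / (1 + ‖ξ‖ ^ 2))).withDensity
      fun ξ => ENNReal.ofReal (1 + ‖ξ‖ ^ 2) := by
    rw [← withDensity_mul _ measurable_dalang (by fun_prop)]
    conv_lhs => rw [← withDensity_one (μ := μ)]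
    congr 1; ext ξ
    have : (0 : ℝ) < 1 + ‖ξ‖ ^ 2 := by positivity
    simp only [Pi.one_apply, Pi.mul_apply]
    rw [← ENNReal.ofReal_mul (by positivity), one_div, inv_mul_cancel₀ this.ne',
      ENNReal.ofReal_one]
  rw [h1]
  exact SigmaFinite.withDensity_of_ne_top (by simp)

/-- The measure `dt ⊗ μ` on `(0,∞) × ℝ^d`. -/
abbrev specMeas (μ : Measure (Space d)) : Measure (ℝ × Space d) :=
  (volume.restrict (Ioi (0 : ℝ))).prod μ

lemma memLp_fourierTest (h : Dalang μ) (φ : TestFn d) :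
    MemLp (fun z : ℝ × Space d => fourierTest φ z.1 z.2) 2 (specMeas μ) := by
  have := h.sigmaFinite
  refine ⟨(continuous_fourierTest φ).aestronglyMeasurable, ?_⟩
  obtain ⟨C, R, hC, hb⟩ := fourierTest_bound φ
  rw [eLpNorm_lt_top_iff_lintegral_rpow_enorm_lt_top (by simp) (by simp)]
  calc ∫⁻ z, ‖fourierTest φ z.1 z.2‖ₑ ^ (2 : ℝ≥0∞).toReal ∂(specMeas μ)
      ≤ ∫⁻ z, ENNReal.ofReal ((Icc (-R) R).indicator (fun _ => C) z.1) *
          ENNReal.ofReal (1 / (1 + ‖z.2‖ ^ 2)) ∂(specMeas μ) := by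
        refine lintegral_mono fun z => ?_
        rw [← ENNReal.ofReal_mul (indicator_nonneg (fun _ _ => hC) _)]
        refine le_trans (le_of_eq ?_) (ENNReal.ofReal_le_ofReal (hb z.1 z.2))
        rw [ENNReal.ofReal_pow (norm_nonneg _), ofReal_norm]
        norm_cast
    _ = (∫⁻ t in Ioi (0 : ℝ), ENNReal.ofReal ((Icc (-R) R).indicator (fun _ => C) t)) *
          ∫⁻ ξ, ENNReal.ofReal (1 / (1 + ‖ξ‖ ^ 2)) ∂μ := by
        refine lintegral_prod_mul (f := fun t => ENNReal.ofReal
          ((Icc (-R) R).indicator (fun _ => C) t)) ?_ measurable_dalang.aemeasurable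
        exact (ENNReal.measurable_ofReal.comp
          (measurable_const.indicator measurableSet_Icc)).aemeasurable
    _ < ∞ := by
        refine ENNReal.mul_lt_top ?_ h
        calc ∫⁻ t in Ioi (0 : ℝ), ENNReal.ofReal ((Icc (-R) R).indicator (fun _ => C) t)
            ≤ ∫⁻ t, ENNReal.ofReal ((Icc (-R) R).indicator (fun _ => C) t) :=
              setLIntegral_le_lintegral _ _
          _ = ∫⁻ t, (Icc (-R) R).indicator (fun _ => ENNReal.ofReal C) t := by
              congr 1; ext t; by_cases ht : t ∈ Icc (-R) R <;> simp [ht]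
          _ < ∞ := by
              rw [lintegral_indicator_const measurableSet_Icc]
              exact ENNReal.mul_lt_top ENNReal.ofReal_lt_top (by simp)

/-- The Fourier transform as a linear map from the test functions to `L²(dt ⊗ μ)`. -/
def fourierL2 (h : Dalang μ) : TestFn d →ₗ[ℝ] Lp ℂ 2 (specMeas μ) where
  toFun φ := (memLp_fourierTest h φ).toLp _
  map_add' φ ψ := by
    rw [← MemLp.toLp_add]
    congr 1; ext z; exact fourierTest_add φ ψ _ _
  map_smul' c φ := by
    rw [RingHom.id_apply, ← MemLp.toLp_const_smul]
    congr 1; ext z; simp [fourierTest_smul]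

lemma coeFn_fourierL2 (h : Dalang μ) (φ : TestFn d) :
    fourierL2 h φ =ᵐ[specMeas μ] fun z => fourierTest φ z.1 z.2 :=
  (memLp_fourierTest h φ).coeFn_toLp

end SpectralMeasure

/-! ### The noise as a Gaussian isometry -/

section Noise

lemma lintegral_enorm_sq {α E : Type*} [MeasurableSpace α] [NormedAddCommGroup E] (m : Measure α)
    (f : α → E) : ∫⁻ a, ‖f a‖ₑ ^ 2 ∂m = eLpNorm f 2 m ^ 2 := by
  have := eLpNorm_nnreal_pow_eq_lintegral (f := f) (μ := m) (p := 2) (by simp)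
  simpa using this.symm

lemma tendsto_zero_of_sq {f : ℕ → ℝ≥0∞} (hf : Tendsto (fun k => f k ^ 2) atTop (𝓝 0)) :
    Tendsto f atTop (𝓝 0) := by
  have h3 := ((ENNReal.continuous_rpow_const (y := 1 / 2)).tendsto 0).comp hf
  have h4 : ∀ x : ℝ≥0∞, (x ^ 2) ^ (2⁻¹ : ℝ) = x := fun x => by
    rw [← ENNReal.rpow_natCast, ← ENNReal.rpow_mul]; norm_num
  simpa [Function.comp_def, h4] using h3

lemma tendsto_sq_zero {f : ℕ → ℝ≥0∞} (hf : Tendsto f atTop (𝓝 0)) :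
    Tendsto (fun k => f k ^ 2) atTop (𝓝 0) := by
  simpa using ENNReal.Tendsto.pow (n := 2) hf

lemma lintegral_lintegral_enorm_sq {d : ℕ} {μ : Measure (Space d)} [SFinite μ]
    {f : ℝ × Space d → ℂ} (hf : AEStronglyMeasurable f (specMeas μ)) :
    ∫⁻ t in Ioi (0 : ℝ), ∫⁻ ξ, ‖f (t, ξ)‖ₑ ^ 2 ∂μ = eLpNorm f 2 (specMeas μ) ^ 2 := by
  rw [← lintegral_enorm_sq, lintegral_prod]
  exact hf.enorm.pow_const 2

lemma tendsto_fourierL2_iff {d : ℕ} {μ : Measure (Space d)} (h : Dalang μ) {φ : ℕ → TestFn d}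
    {g : ℝ → Space d → ℂ} (hg : MemLp (fun z : ℝ × Space d => g z.1 z.2) 2 (specMeas μ)) :
    Tendsto (fun k => fourierL2 h (φ k)) atTop (𝓝 (hg.toLp _)) ↔
      Tendsto (fun k => ∫⁻ t in Ioi (0 : ℝ), ∫⁻ ξ, ‖fourierTest (φ k) t ξ - g t ξ‖ₑ ^ 2 ∂μ)
        atTop (𝓝 0) := by
  have := h.sigmaFinite
  have h0 := Lp.tendsto_Lp_iff_tendsto_eLpNorm'' (fi := atTop)
    (fun k (z : ℝ × Space d) => fourierTest (φ k) z.1 z.2)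
    (fun k => memLp_fourierTest h (φ k)) _ hg
  have h1 : ∀ k, (∫⁻ t in Ioi (0 : ℝ), ∫⁻ ξ, ‖fourierTest (φ k) t ξ - g t ξ‖ₑ ^ 2 ∂μ) =
      eLpNorm ((fun z : ℝ × Space d => fourierTest (φ k) z.1 z.2) - fun z => g z.1 z.2) 2
        (specMeas μ) ^ 2 := fun k =>
    lintegral_lintegral_enorm_sq ((memLp_fourierTest h (φ k)).sub hg).1
  have h2 : ∀ k, fourierL2 h (φ k) = (memLp_fourierTest h (φ k)).toLp _ := fun k => rfl
  simp only [h1, h2]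
  rw [h0]
  exact ⟨tendsto_sq_zero, tendsto_zero_of_sq⟩

variable {Ω : Type*} [MeasurableSpace Ω] {P : Measure Ω} {d : ℕ}
  {μ : Measure (Space d)} {W : TestFn d → Ω → ℝ}

lemma IsNoise.memLp (hW : IsNoise P μ W) (φ : TestFn d) {q : ℝ≥0∞} (hq : q ≠ ∞) :
    MemLp (W φ) q P := (hW.gaussian.hasGaussianLaw_eval φ).memLp hq

/-- The isometry between test functions and the noise. -/
lemma IsNoise.integral_mul (hW : IsNoise P μ W) (h : Dalang μ) (φ ψ : TestFn d) :
    ∫ ω, W φ ω * W ψ ω ∂P = inner ℝ (fourierL2 h φ) (fourierL2 h ψ) := by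
  have := h.sigmaFinite
  have hint : Integrable (fun z : ℝ × Space d => fourierTest φ z.1 z.2 *
      (starRingEnd ℂ) (fourierTest ψ z.1 z.2)) (specMeas μ) :=
    MemLp.integrable_mul (memLp_fourierTest h φ) (memLp_fourierTest h ψ).star
  have h1 := hW.covariance φ ψ
  rw [← integral_prod (fun z : ℝ × Space d => fourierTest φ z.1 z.2 *
      (starRingEnd ℂ) (fourierTest ψ z.1 z.2)) hint] at h1
  -- The covariance is real, and the real part of its integrand is the real inner product on ℂ.
  have h2 := congrArg Complex.re h1
  rw [Complex.ofReal_re, ← RCLike.re_eq_complex_re, ← integral_re hint] at h2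
  rw [h2, L2.inner_def]
  refine integral_congr_ae ?_
  filter_upwards [coeFn_fourierL2 h φ, coeFn_fourierL2 h ψ] with z h3 h4
  rw [h3, h4, Complex.inner, RCLike.re_eq_complex_re]
  simp only [Complex.mul_re, Complex.conj_re, Complex.conj_im]
  ring

lemma IsNoise.integral_sub_sq (hW : IsNoise P μ W) (h : Dalang μ) (φ ψ : TestFn d) :
    ∫ ω, (W φ ω - W ψ ω) ^ 2 ∂P = ‖fourierL2 h φ - fourierL2 h ψ‖ ^ 2 := by
  have hi : ∀ φ ψ, Integrable (fun ω => W φ ω * W ψ ω) P := fun φ ψ =>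
    MemLp.integrable_mul (p := 2) (q := 2) (hW.memLp φ (by simp)) (hW.memLp ψ (by simp))
  have e : (fun ω => (W φ ω - W ψ ω) ^ 2) =
      fun ω => W φ ω * W φ ω - 2 * (W φ ω * W ψ ω) + W ψ ω * W ψ ω := by
    ext ω; ring
  have hd : Integrable (fun ω => W φ ω * W φ ω - 2 * (W φ ω * W ψ ω)) P :=
    (hi φ φ).sub ((hi φ ψ).const_mul 2)
  rw [e, integral_add hd (hi ψ ψ), integral_sub (hi φ φ) ((hi φ ψ).const_mul 2),
    integral_const_mul, hW.integral_mul h,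
    hW.integral_mul h, hW.integral_mul h, norm_sub_sq_real, real_inner_self_eq_norm_sq,
    real_inner_self_eq_norm_sq]

/-- The `L^q` norm of a standard Gaussian variable. -/
def gaussConst (q : ℝ≥0∞) : ℝ := (eLpNorm (id : ℝ → ℝ) q (gaussianReal 0 1)).toReal

lemma gaussConst_nonneg (q : ℝ≥0∞) : 0 ≤ gaussConst q := ENNReal.toReal_nonneg

/-- W φ - W ψ is a centred Gaussian, so it has the law of σ times a standard Gaussian, where by the
isometry σ is the L² distance of the transforms. All L^q norms with q < ∞ are therefore proportional
to σ, which is how p-th moments come for free. -/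
lemma IsNoise.eLpNorm_sub (hW : IsNoise P μ W) (h : Dalang μ) (φ ψ : TestFn d) {q : ℝ≥0∞}
    (hq : q ≠ ∞) : eLpNorm (W φ - W ψ) q P =
      ENNReal.ofReal (gaussConst q * ‖fourierL2 h φ - fourierL2 h ψ‖) := by
  set σ : ℝ := ‖fourierL2 h φ - fourierL2 h ψ‖ with hσ
  have hg : HasGaussianLaw (W φ - W ψ) P := hW.gaussian.hasGaussianLaw_sub
  have hi : ∀ φ, Integrable (W φ) P := fun φ => memLp_one_iff_integrable.1 (hW.memLp φ (by simp))
  have hmean : ∫ ω, (W φ - W ψ) ω ∂P = 0 := by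
    simp only [Pi.sub_apply]
    rw [integral_sub (hi φ) (hi ψ), hW.centred, hW.centred, sub_zero]
  have hvar : Var[W φ - W ψ; P] = σ ^ 2 := by
    rw [variance_eq_integral hg.aemeasurable, hmean, hσ, ← hW.integral_sub_sq h]
    simp
  have hmap := hg.map_eq_gaussianReal
  rw [hmean, hvar] at hmap
  have hmap2 : P.map (W φ - W ψ) = (gaussianReal 0 1).map fun x => σ * x := by
    rw [hmap, gaussianReal_map_const_mul]
    congr 1
    · simp
    · ext; simp [Real.coe_toNNReal _ (sq_nonneg σ)]
  calc eLpNorm (W φ - W ψ) q P = eLpNorm id q (P.map (W φ - W ψ)) := by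
        rw [eLpNorm_map_measure aestronglyMeasurable_id hg.aemeasurable]; rfl
    _ = eLpNorm (σ • (id : ℝ → ℝ)) q (gaussianReal 0 1) := by
        rw [hmap2, eLpNorm_map_measure aestronglyMeasurable_id (by fun_prop)]; rfl
    _ = _ := by
        rw [eLpNorm_const_smul, mul_comm (gaussConst q), ENNReal.ofReal_mul (norm_nonneg _),
          gaussConst, ENNReal.ofReal_toReal (memLp_id_gaussianReal' q hq).2.ne,
          Real.enorm_of_nonneg (norm_nonneg _)]

variable {q : ℝ≥0∞}

/-- The noise as a map into `L^q(Ω)`. -/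
def IsNoise.toLp (hW : IsNoise P μ W) (hq : q ≠ ∞) (φ : TestFn d) : Lp ℝ q P :=
  (hW.memLp φ hq).toLp

lemma IsNoise.norm_toLp_sub (hW : IsNoise P μ W) (h : Dalang μ) (hq : q ≠ ∞) (φ ψ : TestFn d) :
    ‖hW.toLp hq φ - hW.toLp hq ψ‖ = gaussConst q * ‖fourierL2 h φ - fourierL2 h ψ‖ := by
  rw [IsNoise.toLp, IsNoise.toLp, ← MemLp.toLp_sub, Lp.norm_toLp, hW.eLpNorm_sub h φ ψ hq,
    ENNReal.toReal_ofReal (mul_nonneg (gaussConst_nonneg q) (norm_nonneg _))]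

lemma IsNoise.exists_tendsto [Fact (1 ≤ q)] (hW : IsNoise P μ W) (h : Dalang μ) (hq : q ≠ ∞)
    {φ : ℕ → TestFn d} {g : Lp ℂ 2 (specMeas μ)}
    (hg : Tendsto (fun k => fourierL2 h (φ k)) atTop (𝓝 g)) :
    ∃ X : Lp ℝ q P, Tendsto (fun k => hW.toLp hq (φ k)) atTop (𝓝 X) := by
  refine cauchySeq_tendsto_of_complete ?_
  have hc := hg.cauchySeq
  rw [Metric.cauchySeq_iff] at hc ⊢
  intro ε hε
  -- The added 1 makes the divisor positive without knowing that the Gaussian constant is nonzero.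
  have hC : 0 < gaussConst q + 1 := by linarith [gaussConst_nonneg q]
  obtain ⟨N, hN⟩ := hc (ε / (gaussConst q + 1)) (by positivity)
  refine ⟨N, fun m hm n hn => ?_⟩
  have := hN m hm n hn
  rw [dist_eq_norm, lt_div_iff₀ hC] at this
  rw [dist_eq_norm, hW.norm_toLp_sub h]
  nlinarith [norm_nonneg (fourierL2 h (φ m) - fourierL2 h (φ n))]

/-- The isometry passes to limits. For a common integrand it shows independence of the approximating
sequence; for different ones it carries continuity and bounds from L²(dt ⊗ μ) over to L^q(Ω). -/
lemma IsNoise.norm_sub_of_tendsto [Fact (1 ≤ q)] (hW : IsNoise P μ W) (h : Dalang μ) (hq : q ≠ ∞)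
    {φ ψ : ℕ → TestFn d} {g g' : Lp ℂ 2 (specMeas μ)} {X X' : Lp ℝ q P}
    (hg : Tendsto (fun k => fourierL2 h (φ k)) atTop (𝓝 g))
    (hX : Tendsto (fun k => hW.toLp hq (φ k)) atTop (𝓝 X))
    (hg' : Tendsto (fun k => fourierL2 h (ψ k)) atTop (𝓝 g'))
    (hX' : Tendsto (fun k => hW.toLp hq (ψ k)) atTop (𝓝 X')) :
    ‖X - X'‖ = gaussConst q * ‖g - g'‖ := by
  refine tendsto_nhds_unique (hX.sub hX').norm ?_
  simp only [hW.norm_toLp_sub h]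
  exact ((hg.sub hg').norm).const_mul _

/-- Limits are taken in L^q(Ω) for the sake of the moments, while Wiener integrals are L²(Ω) limits;
on a probability space q ≥ 2 makes the former convergence the stronger one. -/
lemma isWienerIntegral_of_tendsto [Fact (1 ≤ q)] (hW : IsNoise P μ W) (h : Dalang μ)
    (hq : q ≠ ∞) (hq2 : 2 ≤ q) {φ : ℕ → TestFn d} {g : ℝ → Space d → ℂ}
    (hg : MemLp (fun z : ℝ × Space d => g z.1 z.2) 2 (specMeas μ)) {X : Lp ℝ q P} {Y : Ω → ℝ}
    (hφ : Tendsto (fun k => fourierL2 h (φ k)) atTop (𝓝 (hg.toLp _)))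
    (hX : Tendsto (fun k => hW.toLp hq (φ k)) atTop (𝓝 X)) (hY : Measurable Y)
    (hYX : Y =ᵐ[P] X) : IsWienerIntegral P μ W g Y := by
  have := h.sigmaFinite
  have := hW.gaussian.isProbabilityMeasure
  refine ⟨hY, φ, (tendsto_fourierL2_iff h hg).1 hφ, ?_⟩
  · have hYm : MemLp Y q P := (memLp_congr_ae hYX).2 (Lp.memLp X)
    have hXY : X = hYm.toLp Y := by
      ext1; exact hYX.symm.trans hYm.coeFn_toLp.symm
    rw [hXY] at hX
    have h1 := (Lp.tendsto_Lp_iff_tendsto_eLpNorm'' (fun k => W (φ k))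
      (fun k => hW.memLp (φ k) hq) _ hYm).1 hX
    refine tendsto_of_tendsto_of_tendsto_of_le_of_le tendsto_const_nhds (tendsto_sq_zero h1) (fun _ => zero_le)
      fun k => ?_
    change ∫⁻ ω, ‖(W (φ k) - Y) ω‖ₑ ^ 2 ∂P ≤ _
    rw [lintegral_enorm_sq]
    gcongr
    exact eLpNorm_le_eLpNorm_of_exponent_le hq2 ((hW.memLp (φ k) hq).1.sub hYm.1)

/-- Square integrability of X is not part of the definition, but X differs from some W (φ k) by a
function of finite L² norm. -/
lemma IsWienerIntegral.exists_tendsto (hW : IsNoise P μ W) (h : Dalang μ)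
    {g : ℝ → Space d → ℂ} (hg : MemLp (fun z : ℝ × Space d => g z.1 z.2) 2 (specMeas μ))
    {X : Ω → ℝ} (hX : IsWienerIntegral P μ W g X) : ∃ (φ : ℕ → TestFn d) (hXm : MemLp X 2 P),
      Tendsto (fun k => fourierL2 h (φ k)) atTop (𝓝 (hg.toLp _)) ∧
      Tendsto (fun k => hW.toLp (q := 2) (by simp) (φ k)) atTop (𝓝 (hXm.toLp X)) := by
  have := h.sigmaFinite
  obtain ⟨hXm, φ, h1, h2⟩ := hX
  have h3 : Tendsto (fun k => eLpNorm (W (φ k) - X) 2 P) atTop (𝓝 0) := by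
    refine tendsto_zero_of_sq (h2.congr fun k => ?_)
    rw [← lintegral_enorm_sq]; rfl
  have hXL : MemLp X 2 P := by
    obtain ⟨k, hk⟩ := (h3.eventually (gt_mem_nhds (ENNReal.zero_lt_top))).exists
    have h4 : MemLp (W (φ k) - X) 2 P :=
      ⟨(hW.memLp (φ k) (q := 2) (by simp)).1.sub hXm.aestronglyMeasurable, hk⟩
    have := (hW.memLp (φ k) (q := 2) (by simp)).sub h4
    simpa using this
  refine ⟨φ, hXL, (tendsto_fourierL2_iff h hg).2 h1, ?_⟩
  · exact (Lp.tendsto_Lp_iff_tendsto_eLpNorm'' (fun k => W (φ k))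
      (fun k => hW.memLp (φ k) (by simp)) _ hXL).2 h3

/-- The Wiener integral is almost surely determined by its integrand. -/
lemma IsWienerIntegral.ae_eq (hW : IsNoise P μ W) (h : Dalang μ)
    {g : ℝ → Space d → ℂ} (hg : MemLp (fun z : ℝ × Space d => g z.1 z.2) 2 (specMeas μ))
    {X Y : Ω → ℝ} (hX : IsWienerIntegral P μ W g X) (hY : IsWienerIntegral P μ W g Y) :
    X =ᵐ[P] Y := by
  obtain ⟨φ, hXm, h1, h2⟩ := hX.exists_tendsto hW h hg
  obtain ⟨ψ, hYm, h3, h4⟩ := hY.exists_tendsto hW h hg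
  have := hW.norm_sub_of_tendsto h (by simp) h1 h2 h3 h4
  rw [sub_self, norm_zero, mul_zero, norm_sub_eq_zero_iff] at this
  exact (MemLp.toLp_eq_toLp_iff hXm hYm).1 this

/-! ### The filtration generated by the noise -/

section Filtration

lemma measurableSet_noiseFiltration_of_null {N : Set Ω} (hN : P N = 0) (t : ℝ) :
    MeasurableSet[noiseFiltration P μ W t] N :=
  MeasurableSpace.measurableSet_generateFrom (Or.inr hN)

/-- Completeness of P is what makes the adjoined null sets measurable. -/
lemma noiseFiltration_le [hP : P.IsComplete] (t : ℝ) :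
    noiseFiltration P μ W t ≤ ‹MeasurableSpace Ω› := by
  refine MeasurableSpace.generateFrom_le ?_
  rintro A (⟨s, _, φ, X, hX, B, hB, rfl⟩ | hN)
  · exact hX.1 hB
  · exact hP.out' A hN

/-- Since the filtration contains the null sets, measurability is insensitive to modification. -/
lemma measurable_noiseFiltration_of_ae_eq {t : ℝ} {X Y : Ω → ℝ}
    (hY : Measurable[noiseFiltration P μ W t] Y) (hXY : X =ᵐ[P] Y) :
    Measurable[noiseFiltration P μ W t] X := by
  intro B hB
  have h0 : P {ω | X ω ≠ Y ω} = 0 := hXY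
  have e : X ⁻¹' B = (Y ⁻¹' B ∩ {ω | X ω ≠ Y ω}ᶜ) ∪ (X ⁻¹' B ∩ {ω | X ω ≠ Y ω}) := by
    ext ω
    by_cases h : X ω = Y ω <;> simp [h]
  rw [e]
  refine MeasurableSet.union (m := noiseFiltration P μ W t) ?_
    (measurableSet_noiseFiltration_of_null (measure_mono_null inter_subset_right h0) t)
  exact MeasurableSet.inter (m := noiseFiltration P μ W t) (hY hB)
    (MeasurableSet.compl (m := noiseFiltration P μ W t)
      (measurableSet_noiseFiltration_of_null h0 t))

lemma measurable_noiseFiltration_of_aestronglyMeasurable {t : ℝ} {X : Ω → ℝ}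
    (hX : AEStronglyMeasurable[noiseFiltration P μ W t] X P) :
    Measurable[noiseFiltration P μ W t] X := by
  obtain ⟨Y, hY, hXY⟩ := hX
  exact measurable_noiseFiltration_of_ae_eq hY.measurable hXY

/-- A test function that vanishes after t equals its truncation to [0,t] at positive times, so W φ
is one of the variables that generate ℱ_t. -/
lemma IsNoise.aestronglyMeasurable_toLp (hW : IsNoise P μ W) (hq : q ≠ ∞) {φ : TestFn d} {t : ℝ}
    (ht : 0 ≤ t) (hφ : ∀ r, t < r → ∀ x, φ (r, x) = 0) :
    AEStronglyMeasurable[noiseFiltration P μ W t] (hW.toLp hq φ) P := by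
  have hm : Measurable (hW.toLp hq φ) := (Lp.stronglyMeasurable _).measurable
  have hi : IsWienerIntegral P μ W (fun r => (Icc (0 : ℝ) t).indicator (fourierTest φ) r)
      (hW.toLp hq φ) := by
    refine ⟨hm, fun _ => φ, ?_, ?_⟩
    · refine tendsto_const_nhds.congr' (Eventually.of_forall fun k => ?_)
      change 0 = ∫⁻ r in Ioi (0 : ℝ), ∫⁻ ξ,
        ‖fourierTest φ r ξ - (Icc (0 : ℝ) t).indicator (fourierTest φ) r ξ‖ₑ ^ 2 ∂μ
      symm
      rw [setLIntegral_congr_fun (g := fun _ => 0) measurableSet_Ioi, lintegral_zero]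
      intro r hr
      by_cases hrt : r ≤ t
      · have : r ∈ Icc 0 t := ⟨hr.le, hrt⟩
        simp [this]
      · have : r ∉ Icc 0 t := fun h => hrt h.2
        have h0 : ∀ ξ, fourierTest φ r ξ = 0 := fun ξ => by
          simp [fourierTest_eq, hφ r (not_le.1 hrt)]
        simp [this, h0]
    · refine tendsto_const_nhds.congr' (Eventually.of_forall fun k => ?_)
      change 0 = ∫⁻ ω, ‖W φ ω - hW.toLp hq φ ω‖ₑ ^ 2 ∂P
      symm
      rw [lintegral_congr_ae (g := fun _ => 0), lintegral_zero]
      filter_upwards [(hW.memLp φ hq).coeFn_toLp] with ω hω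
      rw [IsNoise.toLp, hω]; simp
  have hmt : Measurable[noiseFiltration P μ W t] (hW.toLp hq φ) := fun B hB =>
    MeasurableSpace.measurableSet_generateFrom (Or.inl ⟨t, ⟨ht, le_rfl⟩, φ, _, hi, B, hB, rfl⟩)
  exact (hmt.stronglyMeasurable).aestronglyMeasurable

end Filtration

end Noise

/-! ### Fourier transforms of radial measures -/

section Radial

lemma norm_sq_eq_add {n : ℕ} (x : Space (n + 1)) :
    ‖x‖ ^ 2 = x 0 ^ 2 + ‖(WithLp.toLp 2 fun i : Fin n => x i.succ : Space n)‖ ^ 2 := by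
  rw [EuclideanSpace.real_norm_sq_eq, EuclideanSpace.real_norm_sq_eq, Fin.sum_univ_succ]

/-- Integration of a function of `x₀` and `|x|` by slices. -/
lemma lintegral_slice {n : ℕ} {F : ℝ → ℝ → ℝ≥0∞} (hF : Measurable (Function.uncurry F)) :
    ∫⁻ x : Space (n + 1), F (x 0) ‖x‖ = ∫⁻ z : ℝ, ∫⁻ w : Space n, F z √(z ^ 2 + ‖w‖ ^ 2) := by
  have h1 : MeasurePreserving (fun x : Space (n + 1) => (x 0,
      (WithLp.toLp 2 fun i : Fin n => x i.succ : Space n))) volume (volume.prod volume) := by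
    have a1 := PiLp.volume_preserving_ofLp (Fin (n + 1))
    have a2 := volume_preserving_piFinSuccAbove (fun _ : Fin (n + 1) => ℝ) 0
    have a3 : MeasurePreserving (Prod.map id (WithLp.toLp 2) : ℝ × (Fin n → ℝ) → ℝ × Space n)
        (volume.prod volume) (volume.prod volume) :=
      (MeasurePreserving.id volume).prod (PiLp.volume_preserving_toLp (Fin n))
    exact a3.comp (a2.comp a1)
  have h2 : ∀ x : Space (n + 1), F (x 0) ‖x‖ = (fun p : ℝ × Space n =>
      F p.1 √(p.1 ^ 2 + ‖p.2‖ ^ 2)) (x 0, WithLp.toLp 2 fun i : Fin n => x i.succ) := fun x => by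
    simp only
    rw [← norm_sq_eq_add, Real.sqrt_sq (norm_nonneg _)]
  have hm : Measurable fun p : ℝ × Space n => F p.1 √(p.1 ^ 2 + ‖p.2‖ ^ 2) :=
    hF.comp (measurable_fst.prodMk (by fun_prop))
  simp_rw [h2]
  rw [h1.lintegral_comp hm, lintegral_prod _ hm.aemeasurable]

/-- The measure on `ℝ^d` with radial density `k(|x|)`. -/
def radialMeas (d : ℕ) (k : ℝ → ℝ≥0∞) : Measure (Space d) := volume.withDensity fun x => k ‖x‖

lemma radialMeas_map {d : ℕ} {k : ℝ → ℝ≥0∞} (hk : Measurable k) (R : Space d ≃ₗᵢ[ℝ] Space d) :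
    (radialMeas d k).map R = radialMeas d k := by
  refine Measure.ext_of_lintegral _ fun f hf => ?_
  have hR : Measurable R := R.continuous.measurable
  have hkn : Measurable fun x : Space d => k ‖x‖ := hk.comp measurable_norm
  have e1 : ∫⁻ a, f (R a) ∂(radialMeas d k) = ∫⁻ a, k ‖a‖ * f (R a) :=
    lintegral_withDensity_eq_lintegral_mul _ hkn (hf.comp hR)
  rw [lintegral_map hf hR, e1, radialMeas, lintegral_withDensity_eq_lintegral_mul _ hkn hf,
    ← R.measurePreserving.lintegral_comp (hkn.mul hf)]
  refine lintegral_congr fun x => ?_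
  simp [R.norm_map]

lemma radialMeas_map_coord {n : ℕ} {k : ℝ → ℝ≥0∞} (hk : Measurable k) :
    (radialMeas (n + 1) k).map (fun x => x 0) =
      volume.withDensity fun z => ∫⁻ w : Space n, k √(z ^ 2 + ‖w‖ ^ 2) := by
  refine Measure.ext_of_lintegral _ fun f hf => ?_
  have hkn : Measurable fun x : Space (n + 1) => k ‖x‖ := hk.comp measurable_norm
  have h0 : Measurable fun x : Space (n + 1) => x 0 := by fun_prop
  have hkm : Measurable fun p : ℝ × Space n => k √(p.1 ^ 2 + ‖p.2‖ ^ 2) :=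
    hk.comp (by fun_prop)
  have e1 : ∫⁻ a, f (a 0) ∂(radialMeas (n + 1) k) = ∫⁻ a : Space (n + 1), k ‖a‖ * f (a 0) :=
    lintegral_withDensity_eq_lintegral_mul _ hkn (hf.comp h0)
  rw [lintegral_map hf h0, e1,
    lintegral_withDensity_eq_lintegral_mul _ hkm.lintegral_prod_right' hf]
  have := lintegral_slice (n := n) (F := fun z r => k r * f z)
    ((hk.comp measurable_snd).mul (hf.comp measurable_fst))
  simp only [Pi.mul_apply]
  refine this.trans ?_
  refine lintegral_congr fun z => ?_
  rw [lintegral_mul_const]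
  exact hkm.comp measurable_prodMk_left

/-- The reflection in the hyperplane orthogonal to |ξ|e₀ - ξ exchanges these two vectors, which have
the same norm. -/
lemma exists_isometry {n : ℕ} (ξ : Space (n + 1)) :
    ∃ R : Space (n + 1) ≃ₗᵢ[ℝ] Space (n + 1), ∀ x, inner ℝ ξ (R x) = ‖ξ‖ * x 0 := by
  set v : Space (n + 1) := ‖ξ‖ • EuclideanSpace.single 0 1 with hv
  have hvn : ‖v‖ = ‖ξ‖ := by simp [hv, norm_smul]
  refine ⟨(Submodule.span ℝ {v - ξ})ᗮ.reflection, fun x => ?_⟩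
  have h := Submodule.reflection_sub hvn
  have h2 : inner ℝ ξ ((Submodule.span ℝ {v - ξ})ᗮ.reflection x) = inner ℝ v x := by
    conv_lhs => arg 2; rw [← h]
    exact LinearIsometryEquiv.inner_map_map _ _ _
  rw [h2, hv, inner_smul_left]
  simp [EuclideanSpace.inner_single_left]

/-- By rotation invariance ξ may be turned onto the first axis. The character then depends on one
coordinate, and only the marginal of the measure along it matters. -/
lemma fourierMeas_radial {n : ℕ} {k : ℝ → ℝ≥0∞} (hk : Measurable k) (ξ : Space (n + 1)) :
    fourierMeas (radialMeas (n + 1) k) ξ =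
      ∫ z : ℝ, Complex.exp (-(Complex.I * ((‖ξ‖ * z : ℝ) : ℂ)))
        ∂(volume.withDensity fun z => ∫⁻ w : Space n, k √(z ^ 2 + ‖w‖ ^ 2)) := by
  obtain ⟨R, hR⟩ := exists_isometry ξ
  have h0 : Measurable fun x : Space (n + 1) => x 0 := by fun_prop
  rw [← radialMeas_map_coord hk, integral_map h0.aemeasurable
    (by apply Continuous.aestronglyMeasurable; fun_prop), fourierMeas]
  conv_lhs => rw [← radialMeas_map hk R]
  rw [integral_map R.continuous.measurable.aemeasurable
    (by apply Continuous.aestronglyMeasurable; fun_prop)]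
  simp_rw [hR]

/-- `∫_{-R}^R e^{-iρz} dz = 2 R sinc(ρR)`. -/
lemma integral_exp_symm (ρ R : ℝ) :
    ∫ z in -R..R, Complex.exp (-(Complex.I * ((ρ * z : ℝ) : ℂ))) = 2 * R * Real.sinc (ρ * R) := by
  by_cases hρ : ρ = 0
  · simp [hρ]; ring
  have h := integral_exp_mul_I_eq_sinc (ρ * R)
  have h1 := intervalIntegral.integral_comp_mul_left (a := -R) (b := R)
    (fun t : ℝ => Complex.exp (-(Complex.I * (t : ℂ)))) hρ
  have h2 := intervalIntegral.integral_comp_neg (a := -(ρ * R)) (b := ρ * R)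
    (fun t : ℝ => Complex.exp ((t : ℂ) * Complex.I))
  rw [neg_neg, h] at h2
  rw [h1, mul_neg]
  have h3 : (fun t : ℝ => Complex.exp (-(Complex.I * (t : ℂ)))) =
      fun t : ℝ => Complex.exp (((-t : ℝ) : ℂ) * Complex.I) := by
    ext t; congr 1; push_cast; ring
  have hρ' : (ρ : ℂ) ≠ 0 := by exact_mod_cast hρ
  rw [h3, h2, Complex.real_smul]
  push_cast
  field_simp

lemma integral_exp_withDensity_half (ρ : ℝ) :
    ∫ z : ℝ, Complex.exp (-(Complex.I * ((ρ * z : ℝ) : ℂ)))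
      ∂(volume.withDensity ((Ioo (-1 : ℝ) 1).indicator fun _ => ENNReal.ofReal (1 / 2))) =
      Real.sinc ρ := by
  rw [withDensity_indicator measurableSet_Ioo, withDensity_const, integral_smul_measure,
    ← integral_Ioc_eq_integral_Ioo, ← intervalIntegral.integral_of_le (by norm_num),
    integral_exp_symm]
  rw [ENNReal.toReal_ofReal (by norm_num), Complex.real_smul]
  push_cast; simp

end Radial

/-! ### The wave kernels in dimensions one and two at time 1 -/

section WaveOneTwo

lemma lintegral_space_zero (f : Space 0 → ℝ≥0∞) : ∫⁻ w, f w = f 0 := by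
  have : (volume : Measure (Space 0)) = Measure.dirac 0 := by
    rw [← (PiLp.volume_preserving_toLp (Fin 0)).map_eq, Measure.volume_pi_eq_dirac 0,
      Measure.map_dirac]
    rfl
  rw [this, lintegral_dirac]

lemma fundSol_wave_one :
    fundSol .wave 1 1 = radialMeas 1 ((Iio (1 : ℝ)).indicator fun _ => ENNReal.ofReal (1 / 2)) := by
  simp only [fundSol, radialMeas]
  congr 1; ext x
  by_cases h : ‖x‖ < 1 <;> simp [h]

lemma fundSol_wave_two :
    fundSol .wave 2 1 = radialMeas 2 ((Iio (1 : ℝ)).indicator fun r =>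
      ENNReal.ofReal (1 / (2 * Real.pi) * (1 / √(1 ^ 2 - r ^ 2)))) := by
  simp only [fundSol, radialMeas]
  congr 1; ext x
  by_cases h : ‖x‖ < 1 <;> simp [h]

lemma slice_wave_one (z : ℝ) : ∫⁻ w : Space 0, (Iio (1 : ℝ)).indicator
    (fun _ => ENNReal.ofReal (1 / 2)) √(z ^ 2 + ‖w‖ ^ 2) =
      (Ioo (-1 : ℝ) 1).indicator (fun _ => ENNReal.ofReal (1 / 2)) z := by
  rw [lintegral_space_zero]
  have : √(z ^ 2 + ‖(0 : Space 0)‖ ^ 2) = |z| := by simp [Real.sqrt_sq_eq_abs]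
  rw [this]
  by_cases h : |z| < 1
  · rw [indicator_of_mem (show |z| ∈ Iio 1 from h), indicator_of_mem (show z ∈ Ioo (-1) 1 from abs_lt.1 h)]
  · rw [indicator_of_notMem (show |z| ∉ Iio 1 from h), indicator_of_notMem (show z ∉ Ioo (-1) 1 from fun h' => h (abs_lt.2 h'))]

/-- The primitive arcsin(z/a) is continuous up to the endpoints, where the integrand blows up;
integrability follows from its nonnegativity. -/
lemma lintegral_arcsine {a : ℝ} (ha : 0 < a) :
    ∫⁻ z in Ioo (-a) a, ENNReal.ofReal (1 / √(a ^ 2 - z ^ 2)) = ENNReal.ofReal Real.pi := by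
  have hc : ContinuousOn (fun z => Real.arcsin (z / a)) (Icc (-a) a) :=
    (Real.continuous_arcsin.comp (by fun_prop)).continuousOn
  have hd : ∀ z ∈ Ioo (-a) a, HasDerivAt (fun z => Real.arcsin (z / a)) (1 / √(a ^ 2 - z ^ 2)) z := by
    intro z hz
    have h1 : z / a ≠ -1 := by
      rw [Ne, div_eq_iff ha.ne']; intro h; linarith [hz.1]
    have h2 : z / a ≠ 1 := by
      rw [Ne, div_eq_iff ha.ne']; intro h; linarith [hz.2]
    have := (Real.hasDerivAt_arcsin h1 h2).comp z ((hasDerivAt_id z).div_const a)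
    refine this.congr_deriv ?_
    have h3 : 1 - (z / a) ^ 2 = (a ^ 2 - z ^ 2) / a ^ 2 := by field_simp
    rw [h3, Real.sqrt_div' _ (by positivity), Real.sqrt_sq ha.le]
    field_simp
  have hpos : ∀ z ∈ Ioo (-a) a, 0 ≤ 1 / √(a ^ 2 - z ^ 2) := fun z _ => by positivity
  have hint := intervalIntegral.integrableOn_deriv_of_nonneg hc hd hpos
  have hI := intervalIntegral.integral_eq_sub_of_hasDerivAt_of_le (by linarith) hc hd
    ((intervalIntegrable_iff_integrableOn_Ioc_of_le (by linarith)).2 hint)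
  rw [Measure.restrict_congr_set Ioo_ae_eq_Ioc, ← ofReal_integral_eq_lintegral_ofReal hint
    (Eventually.of_forall fun z => by positivity),
    ← intervalIntegral.integral_of_le (by linarith), hI]
  congr 1
  rw [neg_div, div_self ha.ne']
  simp

/-- The slice at height z is an interval of half-length a = √(1-z²), on which the density is
1/(2π√(a²-y²)). The arcsine integral is π for every a, so the planar kernel has the same marginal as
the one-dimensional one: the density 1/2 on (-1,1), with transform sinc. -/
lemma slice_wave_two (z : ℝ) : ∫⁻ w : Space 1, (Iio (1 : ℝ)).indicator (fun r =>
      ENNReal.ofReal (1 / (2 * Real.pi) * (1 / √(1 ^ 2 - r ^ 2)))) √(z ^ 2 + ‖w‖ ^ 2) =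
      (Ioo (-1 : ℝ) 1).indicator (fun _ => ENNReal.ofReal (1 / 2)) z := by
  have hm : Measurable fun r : ℝ => (Iio (1 : ℝ)).indicator (fun r =>
      ENNReal.ofReal (1 / (2 * Real.pi) * (1 / √(1 ^ 2 - r ^ 2)))) √(z ^ 2 + r ^ 2) :=
    (Measurable.indicator (by fun_prop) measurableSet_Iio).comp (by fun_prop)
  have h1 := lintegral_slice (n := 0) (F := fun _ r => (Iio (1 : ℝ)).indicator (fun r =>
      ENNReal.ofReal (1 / (2 * Real.pi) * (1 / √(1 ^ 2 - r ^ 2)))) √(z ^ 2 + r ^ 2))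
      (hm.comp measurable_snd)
  rw [h1]
  simp_rw [lintegral_space_zero]
  have h2 : ∀ y : ℝ, √(z ^ 2 + √(y ^ 2 + ‖(0 : Space 0)‖ ^ 2) ^ 2) = √(z ^ 2 + y ^ 2) := fun y => by
    congr 2; rw [Real.sq_sqrt (by positivity)]; simp
  simp_rw [h2]
  by_cases hz : z ∈ Ioo (-1 : ℝ) 1
  · rw [indicator_of_mem hz]
    have hz2 : 0 < 1 - z ^ 2 := by nlinarith [hz.1, hz.2]
    have ha : 0 < √(1 - z ^ 2) := Real.sqrt_pos.2 hz2
    have h3 : ∀ y : ℝ, (Iio (1 : ℝ)).indicator (fun r =>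
        ENNReal.ofReal (1 / (2 * Real.pi) * (1 / √(1 ^ 2 - r ^ 2)))) √(z ^ 2 + y ^ 2) =
        (Ioo (-√(1 - z ^ 2)) √(1 - z ^ 2)).indicator (fun y => ENNReal.ofReal (1 / (2 * Real.pi)) *
          ENNReal.ofReal (1 / √(√(1 - z ^ 2) ^ 2 - y ^ 2))) y := by
      intro y
      have hiff : √(z ^ 2 + y ^ 2) < 1 ↔ y ∈ Ioo (-√(1 - z ^ 2)) √(1 - z ^ 2) := by
        rw [Real.sqrt_lt' one_pos, mem_Ioo, ← abs_lt, Real.lt_sqrt (abs_nonneg _), sq_abs]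
        constructor <;> intro h <;> linarith
      by_cases hy : √(z ^ 2 + y ^ 2) < 1
      · rw [indicator_of_mem (show √(z ^ 2 + y ^ 2) ∈ Iio 1 from hy), indicator_of_mem (hiff.1 hy),
          ENNReal.ofReal_mul (by have := Real.pi_pos; positivity), Real.sq_sqrt hz2.le,
          Real.sq_sqrt (by positivity)]
        congr 4; ring
      · rw [indicator_of_notMem (show √(z ^ 2 + y ^ 2) ∉ Iio 1 from hy), indicator_of_notMem (fun h => hy (hiff.2 h))]
    simp_rw [h3]
    rw [lintegral_indicator measurableSet_Ioo, lintegral_const_mul _ (by fun_prop),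
      lintegral_arcsine ha, ← ENNReal.ofReal_mul (by have := Real.pi_pos; positivity)]
    congr 1
    field_simp
  · rw [indicator_of_notMem hz]
    have h3 : ∀ y : ℝ, (Iio (1 : ℝ)).indicator (fun r =>
        ENNReal.ofReal (1 / (2 * Real.pi) * (1 / √(1 ^ 2 - r ^ 2)))) √(z ^ 2 + y ^ 2) = 0 := by
      intro y
      refine indicator_of_notMem (fun h => hz ?_) _
      rw [mem_Iio, Real.sqrt_lt' one_pos] at h
      rw [mem_Ioo, ← abs_lt, ← sq_lt_one_iff_abs_lt_one]
      nlinarith [sq_nonneg y]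
    simp_rw [h3, lintegral_zero]

lemma measurable_wave_two_density : Measurable ((Iio (1 : ℝ)).indicator fun r =>
      ENNReal.ofReal (1 / (2 * Real.pi) * (1 / √(1 ^ 2 - r ^ 2)))) :=
  Measurable.indicator (by fun_prop) measurableSet_Iio

lemma isFiniteMeasure_of_map_coord {n : ℕ} {m : Measure (Space (n + 1))}
    (h : m.map (fun x => x 0) =
      volume.withDensity ((Ioo (-1 : ℝ) 1).indicator fun _ => ENNReal.ofReal (1 / 2))) :
    IsFiniteMeasure m := by
  constructor
  have h0 : Measurable fun x : Space (n + 1) => x 0 := by fun_prop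
  have h1 : m univ = m.map (fun x => x 0) univ := by
    rw [Measure.map_apply h0 .univ, preimage_univ]
  rw [h1, h, withDensity_apply _ .univ, setLIntegral_univ,
    lintegral_indicator_const measurableSet_Ioo]
  exact ENNReal.mul_lt_top ENNReal.ofReal_lt_top (by simp)

lemma isFiniteMeasure_wave_one : IsFiniteMeasure (fundSol .wave 1 1) := by
  refine isFiniteMeasure_of_map_coord ?_
  rw [fundSol_wave_one, radialMeas_map_coord (measurable_const.indicator measurableSet_Iio)]
  simp_rw [slice_wave_one]

lemma isFiniteMeasure_wave_two : IsFiniteMeasure (fundSol .wave 2 1) := by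
  refine isFiniteMeasure_of_map_coord ?_
  rw [fundSol_wave_two, radialMeas_map_coord measurable_wave_two_density]
  simp_rw [slice_wave_two]

lemma fourierMeas_wave_one (ξ : Space 1) : fourierMeas (fundSol .wave 1 1) ξ = Real.sinc ‖ξ‖ := by
  rw [fundSol_wave_one, fourierMeas_radial (measurable_const.indicator measurableSet_Iio)]
  simp_rw [slice_wave_one]
  exact integral_exp_withDensity_half _

lemma fourierMeas_wave_two (ξ : Space 2) : fourierMeas (fundSol .wave 2 1) ξ = Real.sinc ‖ξ‖ := by
  rw [fundSol_wave_two, fourierMeas_radial measurable_wave_two_density]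
  simp_rw [slice_wave_two]
  exact integral_exp_withDensity_half _

end WaveOneTwo

/-! ### The wave kernel in dimension three: the sphere -/

section WaveThree

/-- The surface measure on the unit sphere of `ℝ³`, as a measure on `ℝ³`. -/
def unitSphereMeas : Measure (Space 3) :=
  (volume : Measure (Space 3)).toSphere.map fun y : Metric.sphere (0 : Space 3) 1 => (y : Space 3)

instance : IsFiniteMeasure unitSphereMeas := by
  unfold unitSphereMeas; infer_instance

lemma fourierMeas_unitSphere (ξ : Space 3) : fourierMeas unitSphereMeas ξ =
    ∫ y : Metric.sphere (0 : Space 3) 1, phase ξ y ∂(volume : Measure (Space 3)).toSphere := by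
  rw [fourierMeas, unitSphereMeas, integral_map measurable_subtype_coe.aemeasurable
    (by apply Continuous.aestronglyMeasurable; fun_prop)]
  rfl

lemma continuous_fourierMeas {d : ℕ} (m : Measure (Space d)) [IsFiniteMeasure m] :
    Continuous (fourierMeas m) := by
  refine continuous_of_dominated (F := fun ξ x => phase ξ x) (bound := fun _ => 1)
    (fun ξ => (continuous_phase.comp (by fun_prop : Continuous fun x => (ξ, x))).aestronglyMeasurable)
    (fun ξ => Eventually.of_forall fun x => (norm_phase ξ x).le) (integrable_const 1)
    (Eventually.of_forall fun x => continuous_phase.comp (by fun_prop : Continuous fun ξ => (ξ, x)))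

/-- The Fourier transform of the ball of radius `R` in polar coordinates. -/
lemma integral_ball_polar (ξ : Space 3) {R : ℝ} (hR : 0 < R) :
    ∫ x in Metric.ball (0 : Space 3) R, phase ξ x =
      ∫ r in (0 : ℝ)..R, ((r ^ 2 : ℝ) : ℂ) * fourierMeas unitSphereMeas (r • ξ) := by
  set f : Space 3 → ℂ := (Metric.ball (0 : Space 3) R).indicator (phase ξ) with hf
  have hcf : Continuous (phase ξ) := continuous_phase.comp (by fun_prop : Continuous fun x => (ξ, x))
  have hfi : Integrable f := by
    rw [hf, integrable_indicator_iff Metric.isOpen_ball.measurableSet]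
    exact Measure.integrableOn_of_bounded measure_ball_lt_top.ne hcf.aestronglyMeasurable
      (Eventually.of_forall fun x => (norm_phase ξ x).le)
  set σ := (volume : Measure (Space 3)).toSphere
  set mp := (volume : Measure (Space 3)).measurePreserving_homeomorphUnitSphereProd
  have hdim : Module.finrank ℝ (Space 3) - 1 = 2 := by simp
  have hemb := (homeomorphUnitSphereProd (Space 3)).measurableEmbedding
  set F : Metric.sphere (0 : Space 3) 1 × Ioi (0 : ℝ) → ℂ := fun p => f ((p.2 : ℝ) • (p.1 : Space 3))
    with hF
  have hFc : ∀ x : ({0}ᶜ : Set (Space 3)), F (homeomorphUnitSphereProd (Space 3) x) = f x := by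
    intro x
    have hx : ‖(x : Space 3)‖ ≠ 0 := norm_ne_zero_iff.2 x.2
    simp only [hF, homeomorphUnitSphereProd_apply_snd_coe, homeomorphUnitSphereProd_apply_fst_coe]
    rw [smul_smul, mul_inv_cancel₀ hx, one_smul]
  have h1 : ∫ x, f x = ∫ p, F p ∂(σ.prod (Measure.volumeIoiPow 2)) := by
    have h2 := mp.integral_comp hemb F
    rw [hdim] at h2
    rw [← h2]
    simp_rw [hFc]
    rw [integral_subtype_comap (measurableSet_singleton _).compl f, restrict_compl_singleton]
  have hFi : Integrable F (σ.prod (Measure.volumeIoiPow 2)) := by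
    have h2 := mp.integrable_comp_emb hemb (g := F)
    rw [hdim] at h2
    rw [← h2]
    have : F ∘ homeomorphUnitSphereProd (Space 3) = f ∘ Subtype.val := funext hFc
    rw [this, ← integrableOn_iff_comap_subtypeVal (measurableSet_singleton _).compl]
    exact hfi.integrableOn
  rw [← integral_indicator Metric.isOpen_ball.measurableSet, ← hf, h1, integral_prod_symm _ hFi]
  have h3 : ∀ r : Ioi (0 : ℝ), ∫ y, F (y, r) ∂σ =
      (Iio R).indicator (fun r => fourierMeas unitSphereMeas (r • ξ)) (r : ℝ) := by
    intro r
    have hr : (0 : ℝ) < r := r.2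
    have hn : ∀ y : Metric.sphere (0 : Space 3) 1, ‖(r : ℝ) • (y : Space 3)‖ = r := fun y => by
      rw [norm_smul, Real.norm_of_nonneg hr.le]; simp
    by_cases h : (r : ℝ) < R
    · rw [indicator_of_mem (show (r : ℝ) ∈ Iio R from h), fourierMeas_unitSphere]
      congr 1; ext y
      simp only [hF, hf]
      rw [indicator_of_mem (by simpa [hn] using h)]
      simp only [phase, inner_smul_left, inner_smul_right]
      simp
    · rw [indicator_of_notMem (show (r : ℝ) ∉ Iio R from h)]
      rw [integral_eq_zero_of_ae]
      refine Eventually.of_forall fun y => ?_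
      simp only [hF, hf]
      exact indicator_of_notMem (by simpa [hn] using h) _
  simp_rw [h3]
  set G : ℝ → ℂ := (Iio R).indicator (fun r => fourierMeas unitSphereMeas (r • ξ)) with hG
  have h4 : ∫ r : Ioi (0 : ℝ), G r ∂(Measure.volumeIoiPow 2) =
      ∫ r in Ioi (0 : ℝ), (r ^ 2 : ℝ) • G r := by
    rw [Measure.volumeIoiPow, integral_withDensity_eq_integral_toReal_smul (by fun_prop) (by simp),
      ← integral_subtype_comap measurableSet_Ioi fun r : ℝ => (r ^ 2 : ℝ) • G r]
    congr 1; ext r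
    rw [ENNReal.toReal_ofReal (by positivity)]
  rw [h4]
  have h5 : ∀ r, (r ^ 2 : ℝ) • G r = (Iio R).indicator
      (fun r => ((r ^ 2 : ℝ) : ℂ) * fourierMeas unitSphereMeas (r • ξ)) r := by
    intro r
    rw [hG]
    by_cases h : r < R
    · rw [indicator_of_mem (show r ∈ Iio R from h), indicator_of_mem (show r ∈ Iio R from h),
        Complex.real_smul]
    · rw [indicator_of_notMem (show r ∉ Iio R from h), indicator_of_notMem (show r ∉ Iio R from h),
        smul_zero]
  simp_rw [h5]
  rw [setIntegral_indicator measurableSet_Iio, Ioi_inter_Iio, ← integral_Ioc_eq_integral_Ioo,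
    ← intervalIntegral.integral_of_le hR.le]

/-- The Fourier transform of the ball of radius `R` by slices. -/
lemma integral_ball_slice (ξ : Space 3) {R : ℝ} (hR : 0 < R) :
    ∫ x in Metric.ball (0 : Space 3) R, phase ξ x =
      ∫ z in -R..R, ((Real.pi * (R ^ 2 - z ^ 2) : ℝ) : ℂ) *
        Complex.exp (-(Complex.I * ((‖ξ‖ * z : ℝ) : ℂ))) := by
  have hm : Measurable ((Iio R).indicator (1 : ℝ → ℝ≥0∞)) :=
    measurable_one.indicator measurableSet_Iio
  have h1 : (volume : Measure (Space 3)).restrict (Metric.ball 0 R) =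
      radialMeas 3 ((Iio R).indicator 1) := by
    rw [← withDensity_indicator_one Metric.isOpen_ball.measurableSet, radialMeas]
    congr 1; ext x
    by_cases h : ‖x‖ < R <;> simp [h]
  have h2 : ∀ z : ℝ, ∫⁻ w : Space 2, (Iio R).indicator (1 : ℝ → ℝ≥0∞) √(z ^ 2 + ‖w‖ ^ 2) =
      (Ioo (-R) R).indicator (fun z => ENNReal.ofReal (Real.pi * (R ^ 2 - z ^ 2))) z := by
    intro z
    have h3 : ∀ w : Space 2, (Iio R).indicator (1 : ℝ → ℝ≥0∞) √(z ^ 2 + ‖w‖ ^ 2) =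
        {w : Space 2 | z ^ 2 + ‖w‖ ^ 2 < R ^ 2}.indicator 1 w := by
      intro w
      by_cases h : z ^ 2 + ‖w‖ ^ 2 < R ^ 2
      · rw [indicator_of_mem (show w ∈ {w : Space 2 | z ^ 2 + ‖w‖ ^ 2 < R ^ 2} from h),
          indicator_of_mem (show _ ∈ Iio R from (Real.sqrt_lt' hR).2 h)]; rfl
      · rw [indicator_of_notMem (show w ∉ {w : Space 2 | z ^ 2 + ‖w‖ ^ 2 < R ^ 2} from h),
          indicator_of_notMem (show _ ∉ Iio R from fun h' => h ((Real.sqrt_lt' hR).1 h'))]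
    simp_rw [h3]
    rw [lintegral_indicator_one (measurableSet_lt (by fun_prop) measurable_const)]
    by_cases hz : z ∈ Ioo (-R) R
    · have hz2 : 0 < R ^ 2 - z ^ 2 := by nlinarith [hz.1, hz.2]
      have : {w : Space 2 | z ^ 2 + ‖w‖ ^ 2 < R ^ 2} = Metric.ball 0 √(R ^ 2 - z ^ 2) := by
        ext w
        simp only [mem_ofPred_eq, mem_ball_zero_iff, Real.lt_sqrt (norm_nonneg _)]
        constructor <;> intro h <;> linarith
      rw [this, indicator_of_mem hz, EuclideanSpace.volume_ball_fin_two,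
        ← ENNReal.ofReal_pow (Real.sqrt_nonneg _), Real.sq_sqrt hz2.le,
        ← ENNReal.ofReal_mul hz2.le, mul_comm]
    · have : {w : Space 2 | z ^ 2 + ‖w‖ ^ 2 < R ^ 2} = ∅ := by
        ext w
        simp only [mem_ofPred_eq, mem_empty_iff_false, iff_false, not_lt]
        have : R ≤ |z| := by
          by_contra h
          exact hz (abs_lt.1 (not_le.1 h))
        have : R ^ 2 ≤ |z| ^ 2 := pow_le_pow_left₀ hR.le this 2
        rw [sq_abs] at this
        nlinarith [sq_nonneg ‖w‖]
      rw [this, indicator_of_notMem hz, measure_empty]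
  have h3 := fourierMeas_radial hm ξ
  rw [fourierMeas, ← h1] at h3
  change ∫ x in Metric.ball (0 : Space 3) R, phase ξ x = _ at h3
  rw [h3]
  simp_rw [h2]
  rw [withDensity_indicator measurableSet_Ioo,
    integral_withDensity_eq_integral_toReal_smul (by fun_prop) (by simp),
    intervalIntegral.integral_of_le (by linarith), integral_Ioc_eq_integral_Ioo]
  refine setIntegral_congr_fun measurableSet_Ioo fun z hz => ?_
  have hz2 : 0 < R ^ 2 - z ^ 2 := by nlinarith [hz.1, hz.2]
  rw [ENNReal.toReal_ofReal (by have := Real.pi_pos; positivity), Complex.real_smul]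

lemma hasDerivAt_integral_symm {E : Type*} [NormedAddCommGroup E] [NormedSpace ℝ E]
    [CompleteSpace E] {f : ℝ → E} (hf : Continuous f) (R : ℝ) :
    HasDerivAt (fun R => ∫ z in -R..R, f z) (f R + f (-R)) R := by
  have h1 : (fun R => ∫ z in -R..R, f z) = fun R => (∫ z in (0 : ℝ)..R, f z) -
      ∫ z in (0 : ℝ)..-R, f z := by
    ext R
    rw [intervalIntegral.integral_interval_sub_left (hf.intervalIntegrable _ _)
      (hf.intervalIntegrable _ _)]
  rw [h1]
  have h2 := fun x => (hf.integral_hasStrictDerivAt 0 x).hasDerivAt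
  have h3 := (h2 (-R)).scomp R (hasDerivAt_neg R)
  refine ((h2 R).sub h3).congr_deriv ?_
  simp

/-- The sphere has no density, so its transform is read off from balls: polar coordinates and
slicing by discs give ∫_0^R r² σ̂(rξ) dr = ∫_{-R}^R π(R²-z²) e^{-i|ξ|z} dz. In the derivative at R =
1 the boundary terms on the right cancel, and 2π ∫_{-1}^1 e^{-i|ξ|z} dz = 4π sinc|ξ| remains. -/
lemma fourierMeas_unitSphere_eq (ξ : Space 3) :
    fourierMeas unitSphereMeas ξ = 4 * Real.pi * Real.sinc ‖ξ‖ := by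
  set ρ := ‖ξ‖ with hρ
  set e : ℝ → ℂ := fun z => Complex.exp (-(Complex.I * ((ρ * z : ℝ) : ℂ))) with he
  have hec : Continuous e := by rw [he]; fun_prop
  have hAc : Continuous fun r : ℝ => ((r ^ 2 : ℝ) : ℂ) * fourierMeas unitSphereMeas (r • ξ) := by
    have := (continuous_fourierMeas unitSphereMeas).comp (by fun_prop : Continuous fun r : ℝ => r • ξ)
    exact (by fun_prop : Continuous fun r : ℝ => ((r ^ 2 : ℝ) : ℂ)).mul this
  have hL := (hAc.integral_hasStrictDerivAt 0 1).hasDerivAt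
  have h0 := hasDerivAt_integral_symm hec 1
  have h2 := hasDerivAt_integral_symm
    ((by fun_prop : Continuous fun z : ℝ => ((z ^ 2 : ℝ) : ℂ)).mul hec) 1
  have hsq : HasDerivAt (fun R : ℝ => ((Real.pi * R ^ 2 : ℝ) : ℂ)) ((Real.pi * 2 : ℝ) : ℂ) 1 := by
    have : HasDerivAt (fun R : ℝ => Real.pi * R ^ 2) (Real.pi * 2) 1 := by
      simpa using (hasDerivAt_pow 2 (1 : ℝ)).const_mul Real.pi
    exact this.ofReal_comp
  have hR := (hsq.mul h0).sub (h2.const_mul (Real.pi : ℂ))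
  -- Separating the R² and z² parts leaves R only in a coefficient and in the limits of integration,
  -- so that product rule and fundamental theorem apply.
  have heq : ∀ᶠ R in 𝓝 (1 : ℝ), (∫ r in (0 : ℝ)..R, ((r ^ 2 : ℝ) : ℂ) *
      fourierMeas unitSphereMeas (r • ξ)) = ((fun R : ℝ => ((Real.pi * R ^ 2 : ℝ) : ℂ)) *
        (fun R => ∫ z in -R..R, e z) - fun R => (Real.pi : ℂ) * ∫ z in -R..R, ((z ^ 2 : ℝ) : ℂ) * e z) R := by
    filter_upwards [lt_mem_nhds (zero_lt_one' ℝ)] with R hR0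
    rw [← integral_ball_polar ξ hR0, integral_ball_slice ξ hR0]
    simp only [Pi.sub_apply, Pi.mul_apply]
    rw [← intervalIntegral.integral_const_mul, ← intervalIntegral.integral_const_mul,
      ← intervalIntegral.integral_sub]
    · congr 1; ext z
      simp only [he, hρ]
      push_cast; ring
    · exact (hec.const_mul _).intervalIntegrable _ _
    · exact (Continuous.intervalIntegrable (by fun_prop) _ _)
  have h := (hL.congr_of_eventuallyEq (heq.mono fun _ h => h.symm)).unique hR
  have hs := integral_exp_symm ρ 1
  simp only [one_pow, Complex.ofReal_one, one_mul, one_smul, mul_one] at h hs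
  rw [h, hs]
  simp only [Pi.mul_apply]
  push_cast
  ring

end WaveThree

/-! ### Scaling kernels: the common structure of the heat and wave kernels -/

/-- The features of the fundamental solution used below: `G_τ` is a dilation of the finite measure
`G_1` by `r τ`, multiplied by `a τ`; its Fourier transform `g τ |ξ|` is dominated on `[s, T]` by
`gb s |ξ|`, whose square integral in time is compatible with Dalang's condition. -/
structure IsScalingKernel (eq : Eqn) (d : ℕ) (T : ℝ) (a r : ℝ → ℝ) (g gb : ℝ → ℝ → ℝ) : Prop where
  finite : IsFiniteMeasure (fundSol eq d 1)
  a_cont : Continuous a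
  r_cont : Continuous r
  a_pos : ∀ τ, 0 < τ → 0 < a τ
  a_smooth : ∀ τ, 0 < τ → ContDiffAt ℝ (⊤ : ℕ∞) a τ
  r_smooth : ∀ τ, 0 < τ → ContDiffAt ℝ (⊤ : ℕ∞) r τ
  scaling : ∀ τ, 0 < τ →
    fundSol eq d τ = ENNReal.ofReal (a τ) • (fundSol eq d 1).map (fun y => r τ • y)
  fourier : ∀ τ, 0 < τ → ∀ ξ, fourierMeas (fundSol eq d τ) ξ = g τ ‖ξ‖
  g_cont : Continuous (Function.uncurry g)
  gb_meas : Measurable (Function.uncurry gb)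
  majorant : ∀ s τ ρ, 0 < s → s ≤ τ → τ ≤ T → |g τ ρ| ≤ gb s ρ
  gb_int : ∃ C : ℝ, ∀ ρ, ∫⁻ s in Ioo (0 : ℝ) T, ENNReal.ofReal (gb s ρ ^ 2) ≤
    ENNReal.ofReal C * ENNReal.ofReal (1 / (1 + ρ ^ 2))

lemma map_smul_withDensity {d : ℕ} {k : Space d → ℝ≥0∞} (hk : Measurable k) {c : ℝ} (hc : 0 < c) :
    (volume.withDensity k).map (fun y => c • y) =
      ENNReal.ofReal ((c ^ d)⁻¹) • volume.withDensity fun x => k (c⁻¹ • x) := by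
  refine Measure.ext_of_lintegral _ fun f hf => ?_
  have hcm : Measurable fun y : Space d => c • y := measurable_const_smul c
  have e1 : ∫⁻ y, f (c • y) ∂(volume.withDensity k) = ∫⁻ y, k y * f (c • y) :=
    lintegral_withDensity_eq_lintegral_mul _ hk (hf.comp hcm)
  have hk' : Measurable fun x => k (c⁻¹ • x) := hk.comp (measurable_const_smul _)
  have e2 : ∫⁻ y, k y * f (c • y) =
      ∫⁻ x, k (c⁻¹ • x) * f x ∂((volume : Measure (Space d)).map (fun y => c • y)) := by
    have hkf : Measurable fun x => k (c⁻¹ • x) * f x := hk'.mul hf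
    rw [lintegral_map hkf hcm]
    simp_rw [smul_smul, inv_mul_cancel₀ hc.ne', one_smul]
  have e3 : (volume : Measure (Space d)).map (fun y => c • y) =
      ENNReal.ofReal ((c ^ d)⁻¹) • volume := by
    have := Measure.map_addHaar_smul (volume : Measure (Space d)) hc.ne'
    rw [abs_of_pos (by positivity)] at this
    simpa using this
  rw [lintegral_map hf hcm, e1, e2, e3, lintegral_smul_measure, lintegral_smul_measure,
    lintegral_withDensity_eq_lintegral_mul _ hk' hf]
  rfl

lemma fourierMeas_smul_map {d : ℕ} (m : Measure (Space d)) {a r : ℝ} (ha : 0 ≤ a)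
    (ξ : Space d) : fourierMeas (ENNReal.ofReal a • m.map (fun y => r • y)) ξ =
      a * fourierMeas m (r • ξ) := by
  rw [fourierMeas, integral_smul_measure, integral_map (measurable_const_smul r).aemeasurable
    (by apply Continuous.aestronglyMeasurable; fun_prop), ENNReal.toReal_ofReal ha,
    Complex.real_smul, fourierMeas]
  simp_rw [inner_smul_left, inner_smul_right]
  rfl

/-! ### The wave kernel as a scaling kernel -/

section Wave

/-- The Fourier transform of the fundamental solution of the wave equation. -/
def waveFourier (τ ρ : ℝ) : ℝ := τ * Real.sinc (τ * ρ)

/-- (1+ρ²) τ² sinc²(τρ) = τ² sinc²(τρ) + sin²(τρ) ≤ T² + 1. The majorant does not depend on time, so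
its square integral over (0,T) has the order 1/(1+ρ²). -/
lemma waveFourier_sq_le {T : ℝ} {s τ ρ : ℝ} (hs : 0 < s) (hsτ : s ≤ τ) (hτ : τ ≤ T) :
    |waveFourier τ ρ| ≤ √((T ^ 2 + 1) / (1 + ρ ^ 2)) := by
  refine Real.abs_le_sqrt ?_
  rw [le_div_iff₀ (by positivity)]
  have h1 : (τ * ρ) * Real.sinc (τ * ρ) = Real.sin (τ * ρ) := by
    by_cases h : τ * ρ = 0
    · simp [h]
    · rw [Real.sinc_of_ne_zero h, mul_div_cancel₀ _ h]
  have h2 : waveFourier τ ρ ^ 2 * (1 + ρ ^ 2) =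
      τ ^ 2 * Real.sinc (τ * ρ) ^ 2 + ((τ * ρ) * Real.sinc (τ * ρ)) ^ 2 := by
    rw [waveFourier]; ring
  rw [h2, h1]
  have h3 : Real.sinc (τ * ρ) ^ 2 ≤ 1 := (sq_le_one_iff_abs_le_one _).2 (Real.abs_sinc_le_one _)
  have h4 : Real.sin (τ * ρ) ^ 2 ≤ 1 := Real.sin_sq_le_one _
  have h5 : τ ^ 2 ≤ T ^ 2 := pow_le_pow_left₀ (by linarith) hτ 2
  nlinarith [sq_nonneg τ]

lemma wave_scaling_one {τ : ℝ} (hτ : 0 < τ) : fundSol .wave 1 τ =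
    ENNReal.ofReal τ • (fundSol .wave 1 1).map (fun y => τ • y) := by
  have hk : Measurable ((Metric.ball (0 : Space 1) 1).indicator fun _ => ENNReal.ofReal (1 / 2)) :=
    measurable_const.indicator Metric.isOpen_ball.measurableSet
  simp only [fundSol]
  rw [map_smul_withDensity hk hτ, smul_smul, ← ENNReal.ofReal_mul hτ.le, pow_one,
    mul_inv_cancel₀ hτ.ne', ENNReal.ofReal_one, one_smul]
  congr 1; ext x
  have : ‖τ⁻¹ • x‖ < 1 ↔ ‖x‖ < τ := by
    rw [norm_smul, Real.norm_of_nonneg (by positivity), inv_mul_lt_iff₀ hτ, mul_one]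
  by_cases h : ‖x‖ < τ
  · rw [indicator_of_mem (by simpa using h), indicator_of_mem (by simpa using this.2 h)]
  · rw [indicator_of_notMem (by simpa using h),
      indicator_of_notMem (by simpa using fun h' => h (this.1 h'))]

lemma wave_scaling_two {τ : ℝ} (hτ : 0 < τ) : fundSol .wave 2 τ =
    ENNReal.ofReal τ • (fundSol .wave 2 1).map (fun y => τ • y) := by
  have hk : Measurable ((Metric.ball (0 : Space 2) 1).indicator fun x =>
        ENNReal.ofReal (1 / (2 * Real.pi) * (1 / √(1 ^ 2 - ‖x‖ ^ 2)))) :=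
    Measurable.indicator (by fun_prop) Metric.isOpen_ball.measurableSet
  simp only [fundSol]
  have hm : Measurable fun y : Space 2 => (Metric.ball (0 : Space 2) 1).indicator (fun x =>
      ENNReal.ofReal (1 / (2 * Real.pi) * (1 / √(1 ^ 2 - ‖x‖ ^ 2)))) (τ⁻¹ • y) :=
    hk.comp (measurable_const_smul τ⁻¹)
  rw [map_smul_withDensity hk hτ, smul_smul, ← ENNReal.ofReal_mul hτ.le,
    ← withDensity_smul _ hm]
  congr 1; ext x
  have hx : ‖τ⁻¹ • x‖ = τ⁻¹ * ‖x‖ := by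
    rw [norm_smul, Real.norm_of_nonneg (by positivity)]
  have : ‖τ⁻¹ • x‖ < 1 ↔ ‖x‖ < τ := by
    rw [hx, inv_mul_lt_iff₀ hτ, mul_one]
  rw [Pi.smul_apply, smul_eq_mul]
  by_cases h : ‖x‖ < τ
  · rw [indicator_of_mem (by simpa using h),
      indicator_of_mem (by simpa using this.2 h), ← ENNReal.ofReal_mul (by positivity)]
    congr 1
    have h3 : (1 : ℝ) ^ 2 - (τ⁻¹ * ‖x‖) ^ 2 = (τ ^ 2 - ‖x‖ ^ 2) / τ ^ 2 := by field_simp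
    rw [hx, h3, Real.sqrt_div' _ (by positivity), Real.sqrt_sq hτ.le]
    field_simp
  · rw [indicator_of_notMem (by simpa using h),
      indicator_of_notMem (by simpa using fun h' => h (this.1 h')), mul_zero]

lemma fundSol_wave_three {τ : ℝ} (hτ : 0 < τ) : fundSol .wave 3 τ =
    ENNReal.ofReal (τ / (4 * Real.pi)) • unitSphereMeas.map (fun y => τ • y) := by
  simp only [fundSol, sphereMeasure, unitSphereMeas]
  rw [smul_smul, ← ENNReal.ofReal_mul (by have := Real.pi_pos; positivity),
    Measure.map_map (measurable_const_smul τ) measurable_subtype_coe]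
  congr 2
  field_simp

lemma wave_scaling_three {τ : ℝ} (hτ : 0 < τ) : fundSol .wave 3 τ =
    ENNReal.ofReal τ • (fundSol .wave 3 1).map (fun y => τ • y) := by
  rw [fundSol_wave_three hτ, fundSol_wave_three one_pos, Measure.map_smul, smul_smul,
    ← ENNReal.ofReal_mul hτ.le]
  simp only [one_smul, Measure.map_id']
  congr 2; ring

lemma isFiniteMeasure_wave_three : IsFiniteMeasure (fundSol .wave 3 1) := by
  rw [fundSol_wave_three one_pos]
  simp only [one_smul, Measure.map_id']
  exact Measure.smul_finite _ ENNReal.ofReal_ne_top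

lemma fourierMeas_wave_three (ξ : Space 3) :
    fourierMeas (fundSol .wave 3 1) ξ = Real.sinc ‖ξ‖ := by
  have h := fundSol_wave_three one_pos
  rw [h, fourierMeas_smul_map _ (by have := Real.pi_pos; positivity), one_smul,
    fourierMeas_unitSphere_eq]
  have := Real.pi_ne_zero
  push_cast
  field_simp

lemma isScalingKernel_wave {d : ℕ} (hd : 1 ≤ d) (hd3 : d ≤ 3) {T : ℝ} (hT : 0 < T) :
    IsScalingKernel .wave d T id id waveFourier
      fun _ ρ => √((T ^ 2 + 1) / (1 + ρ ^ 2)) := by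
  have hfin : IsFiniteMeasure (fundSol .wave d 1) := by
    interval_cases d
    exacts [isFiniteMeasure_wave_one, isFiniteMeasure_wave_two, isFiniteMeasure_wave_three]
  have hsc : ∀ τ : ℝ, 0 < τ → fundSol .wave d τ =
      ENNReal.ofReal τ • (fundSol .wave d 1).map (fun y => τ • y) := by
    interval_cases d
    exacts [fun _ h => wave_scaling_one h, fun _ h => wave_scaling_two h,
      fun _ h => wave_scaling_three h]
  have hF : ∀ ξ, fourierMeas (fundSol .wave d 1) ξ = Real.sinc ‖ξ‖ := by
    interval_cases d
    exacts [fourierMeas_wave_one, fourierMeas_wave_two, fourierMeas_wave_three]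
  refine ⟨hfin, continuous_id, continuous_id, fun _ h => h,
    fun _ _ => contDiffAt_id, fun _ _ => contDiffAt_id, hsc, fun τ hτ ξ => ?_, ?_, by fun_prop,
    fun s τ ρ hs hsτ hτ => waveFourier_sq_le hs hsτ hτ, T * (T ^ 2 + 1), fun ρ => ?_⟩
  · rw [hsc τ hτ, fourierMeas_smul_map _ hτ.le, hF, norm_smul, Real.norm_of_nonneg hτ.le,
      waveFourier]
    push_cast; rfl
  · exact continuous_fst.mul (Real.continuous_sinc.comp (by fun_prop))
  · rw [setLIntegral_const, Real.volume_Ioo, sub_zero, ← ENNReal.ofReal_mul (by positivity),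
      Real.sq_sqrt (by positivity), ← ENNReal.ofReal_mul (by positivity)]
    refine ENNReal.ofReal_le_ofReal (le_of_eq ?_)
    ring

end Wave

/-! ### The heat kernel as a scaling kernel -/

section Heat

variable {d : ℕ}

lemma integrable_gaussian {t : ℝ} (ht : 0 < t) :
    Integrable fun x : Space d => Real.exp (-(‖x‖ ^ 2 / (2 * t))) := by
  have h := GaussianFourier.integrable_cexp_neg_mul_sq_norm_add (V := Space d)
    (b := ((1 / (2 * t) : ℝ) : ℂ)) (by rw [Complex.ofReal_re]; positivity) 0 0
  refine h.norm.congr (Eventually.of_forall fun x => ?_)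
  simp only [Complex.norm_exp]
  congr 1
  simp [← Complex.ofReal_pow, -Complex.ofReal_inv, ← Complex.ofReal_mul]
  ring

lemma isFiniteMeasure_heat {t : ℝ} (ht : 0 < t) : IsFiniteMeasure (fundSol .heat d t) := by
  simp only [fundSol]
  exact isFiniteMeasure_withDensity_ofReal ((integrable_gaussian ht).const_mul _).2

lemma heat_scaling {t : ℝ} (ht : 0 < t) : fundSol .heat d t =
    ENNReal.ofReal 1 • (fundSol .heat d 1).map (fun y => √t • y) := by
  simp only [fundSol]
  have hs : 0 < √t := Real.sqrt_pos.2 ht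
  have hπ := Real.pi_pos
  have hk : Measurable fun x : Space d => ENNReal.ofReal
      (1 / (2 * Real.pi * 1) ^ ((d : ℝ) / 2) * Real.exp (-(‖x‖ ^ 2 / (2 * 1)))) := by fun_prop
  rw [map_smul_withDensity hk hs, ENNReal.ofReal_one, one_smul, ← withDensity_smul _
    (by exact hk.comp (measurable_const_smul (√t)⁻¹))]
  congr 1; ext x
  rw [Pi.smul_apply, smul_eq_mul, ← ENNReal.ofReal_mul (by positivity)]
  congr 1
  have h1 : (√t ^ d : ℝ) = t ^ ((d : ℝ) / 2) := by
    rw [Real.sqrt_eq_rpow, ← Real.rpow_natCast, ← Real.rpow_mul ht.le]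
    congr 1; ring
  have h2 : ‖(√t)⁻¹ • x‖ ^ 2 = ‖x‖ ^ 2 / t := by
    rw [norm_smul, mul_pow, Real.norm_of_nonneg (by positivity), inv_pow, Real.sq_sqrt ht.le]
    field_simp
  rw [h1, h2, Real.mul_rpow (by positivity) ht.le, mul_one, ← mul_assoc]
  congr 1
  · field_simp
  · congr 1; field_simp

lemma fourierMeas_heat {t : ℝ} (ht : 0 < t) (ξ : Space d) :
    fourierMeas (fundSol .heat d t) ξ = Real.exp (-(t * ‖ξ‖ ^ 2 / 2)) := by
  have hπ := Real.pi_pos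
  have h := GaussianFourier.integral_cexp_neg_mul_sq_norm_add (V := Space d)
    (b := ((1 / (2 * t) : ℝ) : ℂ)) (by rw [Complex.ofReal_re]; positivity) (-Complex.I) ξ
  have hc : ((2 * Real.pi * t) ^ ((d : ℝ) / 2) : ℝ) ≠ 0 := by positivity
  have h1 : ((Real.pi : ℂ) / ((1 / (2 * t) : ℝ) : ℂ)) ^ ((Module.finrank ℝ (Space d) : ℂ) / 2) =
      (((2 * Real.pi * t) ^ ((d : ℝ) / 2) : ℝ) : ℂ) := by
    rw [Complex.ofReal_cpow (by positivity), finrank_euclideanSpace_fin]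
    congr 1
    · have : (t : ℂ) ≠ 0 := by exact_mod_cast ht.ne'
      push_cast; field_simp
    · push_cast; rfl
  have h2 : Complex.exp ((-Complex.I) ^ 2 * (‖ξ‖ : ℂ) ^ 2 / (4 * ((1 / (2 * t) : ℝ) : ℂ))) =
      ((Real.exp (-(t * ‖ξ‖ ^ 2 / 2)) : ℝ) : ℂ) := by
    rw [Complex.ofReal_exp]
    congr 1
    have : (t : ℂ) ≠ 0 := by exact_mod_cast ht.ne'
    rw [neg_sq, Complex.I_sq]
    push_cast; field_simp; norm_num
  rw [h1, h2] at h
  rw [fourierMeas]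
  simp only [fundSol]
  rw [integral_withDensity_eq_integral_toReal_smul (by fun_prop) (by simp)]
  have h3 : ∀ x : Space d, (ENNReal.ofReal (1 / (2 * Real.pi * t) ^ ((d : ℝ) / 2) *
      Real.exp (-(‖x‖ ^ 2 / (2 * t))))).toReal •
        Complex.exp (-(Complex.I * (inner ℝ ξ x : ℝ))) =
      ((1 / (2 * Real.pi * t) ^ ((d : ℝ) / 2) : ℝ) : ℂ) *
        Complex.exp (-((1 / (2 * t) : ℝ) : ℂ) * (‖x‖ : ℂ) ^ 2 +
          -Complex.I * (inner ℝ ξ x : ℝ)) := by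
    intro x
    rw [ENNReal.toReal_ofReal (by positivity), Complex.real_smul, Complex.exp_add,
      Complex.ofReal_mul, Complex.ofReal_exp, mul_assoc]
    congr 3
    · push_cast; ring
    · ring
  simp_rw [h3]
  rw [integral_const_mul, h, ← mul_assoc, ← Complex.ofReal_mul, one_div, inv_mul_cancel₀ hc,
    Complex.ofReal_one, one_mul]

/-- The transform decreases in time and is therefore its own majorant. -/
lemma isScalingKernel_heat {T : ℝ} :
    IsScalingKernel .heat d T (fun _ => 1) Real.sqrt (fun τ ρ => Real.exp (-(τ * ρ ^ 2 / 2)))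
      fun τ ρ => Real.exp (-(τ * ρ ^ 2 / 2)) := by
  refine ⟨isFiniteMeasure_heat one_pos, continuous_const, Real.continuous_sqrt,
    fun _ _ => one_pos, fun _ _ => contDiffAt_const,
    fun _ h => Real.contDiffAt_sqrt h.ne', fun _ h => heat_scaling h,
    fun _ h ξ => fourierMeas_heat h ξ, by fun_prop, by fun_prop, fun s τ ρ hs hsτ hτ => ?_,
    Real.exp T, fun ρ => ?_⟩
  · rw [abs_of_pos (Real.exp_pos _), Real.exp_le_exp]
    nlinarith [sq_nonneg ρ]
  · set c : ℝ := 1 + ρ ^ 2 with hc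
    have hc0 : 0 < c := by positivity
    have hint : IntegrableOn (fun s : ℝ => Real.exp (-c * s)) (Ioi 0) := integrableOn_exp_mul_Ioi (by linarith) 0
    -- On (0,T) one has e^{-sρ²} ≤ e^T e^{-(1+ρ²)s}; the extra e^{-s} replaces the bound 1/ρ²,
    -- singular at ρ = 0, by e^T/(1+ρ²).
    calc ∫⁻ s in Ioo (0 : ℝ) T, ENNReal.ofReal (Real.exp (-(s * ρ ^ 2 / 2)) ^ 2)
        ≤ ∫⁻ s in Ioo (0 : ℝ) T, ENNReal.ofReal (Real.exp T * Real.exp (-c * s)) := by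
          refine setLIntegral_mono' measurableSet_Ioo fun s hs => ENNReal.ofReal_le_ofReal ?_
          rw [← Real.exp_nat_mul, ← Real.exp_add, Real.exp_le_exp]
          push_cast
          nlinarith [hs.1, hs.2]
      _ ≤ ∫⁻ s in Ioi (0 : ℝ), ENNReal.ofReal (Real.exp T * Real.exp (-c * s)) :=
          lintegral_mono_set Ioo_subset_Ioi_self
      _ = ENNReal.ofReal (∫ s in Ioi (0 : ℝ), Real.exp T * Real.exp (-c * s)) := by
          rw [ofReal_integral_eq_lintegral_ofReal (hint.const_mul _)
            (Eventually.of_forall fun s => by positivity)]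
      _ ≤ _ := by
          rw [integral_const_mul, integral_exp_mul_Ioi (by linarith) 0,
            ← ENNReal.ofReal_mul (by positivity)]
          refine ENNReal.ofReal_le_ofReal (le_of_eq ?_)
          simp

end Heat

/-! ### The integrand of the stochastic convolution in L²(dt ⊗ μ) -/

section ConvolutionIntegrand

variable {eq : Eqn} {d : ℕ} {T : ℝ} {a r : ℝ → ℝ} {g gb : ℝ → ℝ → ℝ} {μ : Measure (Space d)}

lemma IsScalingKernel.continuous_comp (hK : IsScalingKernel eq d T a r g gb) {X : Type*}
    [TopologicalSpace X] {u v : X → ℝ} (hu : Continuous u) (hv : Continuous v) :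
    Continuous fun x => (g (u x) (v x) : ℂ) :=
  Complex.continuous_ofReal.comp (hK.g_cont.comp (hu.prodMk hv))

lemma continuous_phase_comp {X : Type*} [TopologicalSpace X] {u v : X → Space d}
    (hu : Continuous u) (hv : Continuous v) : Continuous fun x => phase (u x) (v x) :=
  continuous_phase.comp (hu.prodMk hv)

/-- The Fourier transform of `s ↦ 1_{(0,t)}(s) G_{t-s}(x - ·)` in terms of `g`. -/
def convFourier (g : ℝ → ℝ → ℝ) (t : ℝ) (x : Space d) (s : ℝ) (ξ : Space d) : ℂ :=
  (Ioo (0 : ℝ) t).indicator (fun s => phase ξ x * (g (t - s) ‖ξ‖ : ℂ)) s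

lemma phase_neg (ξ x : Space d) : phase ξ (-x) = phase (-ξ) x := by
  simp [phase]

lemma phase_smul (ξ x : Space d) (c : ℝ) : phase ξ (c • x) = phase (c • ξ) x := by
  simp [phase, inner_smul_left, inner_smul_right]

/-- The reflection y ↦ x - y produces the factor e^{-i⟨ξ,x⟩} and replaces ξ by -ξ, which the radial
transform of G does not see. -/
lemma convolutionIntegrand_eq (hK : IsScalingKernel eq d T a r g gb) (t : ℝ) (x : Space d) :
    convolutionIntegrand eq t x = convFourier g t x := by
  ext s ξ
  by_cases hs : s ∈ Ioo (0 : ℝ) t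
  · rw [convolutionIntegrand, convFourier, indicator_of_mem hs, indicator_of_mem hs, fourierMeas,
      integral_map (by fun_prop) (by apply Continuous.aestronglyMeasurable; fun_prop)]
    change ∫ y, phase ξ (x - y) ∂_ = _
    simp_rw [phase_sub, phase_neg]
    rw [integral_const_mul, ← norm_neg ξ, ← hK.fourier _ (sub_pos.2 hs.2)]
    rfl
  · rw [convolutionIntegrand, convFourier, indicator_of_notMem hs, indicator_of_notMem hs]
    rfl

lemma measurable_convFourier (hK : IsScalingKernel eq d T a r g gb) (t : ℝ) (x : Space d) :
    Measurable fun p : ℝ × Space d => convFourier g t x p.1 p.2 := by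
  have h1 : (fun p : ℝ × Space d => convFourier g t x p.1 p.2) =
      (Prod.fst ⁻¹' Ioo (0 : ℝ) t).indicator fun p => phase p.2 x * (g (t - p.1) ‖p.2‖ : ℂ) := by
    ext p
    by_cases hs : p.1 ∈ Ioo (0 : ℝ) t
    · rw [convFourier, indicator_of_mem hs, indicator_of_mem (mem_preimage.2 hs)]
    · rw [convFourier, indicator_of_notMem hs, indicator_of_notMem (fun h => hs (mem_preimage.1 h))]
  rw [h1]
  refine Measurable.indicator ?_ (measurable_fst measurableSet_Ioo)
  exact ((continuous_phase_comp continuous_snd continuous_const).mul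
    (hK.continuous_comp (by fun_prop) (by fun_prop))).measurable

/-- `∫_0^T ∫ gb(s,|ξ|)² μ(dξ) ds` is finite. -/
lemma lintegral_gb_lt_top (hK : IsScalingKernel eq d T a r g gb) (h : Dalang μ) :
    ∫⁻ p, ENNReal.ofReal (gb p.1 ‖p.2‖ ^ 2) ∂((volume.restrict (Ioo (0 : ℝ) T)).prod μ) < ∞ := by
  have := h.sigmaFinite
  have hm : Measurable fun p : ℝ × Space d => ENNReal.ofReal (gb p.1 ‖p.2‖ ^ 2) :=
    ((hK.gb_meas.comp (by fun_prop : Measurable fun p : ℝ × Space d => (p.1, ‖p.2‖))).pow_const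
      2).ennreal_ofReal
  obtain ⟨C, hC⟩ := hK.gb_int
  rw [lintegral_prod_symm _ hm.aemeasurable]
  calc _ ≤ ∫⁻ ξ, ENNReal.ofReal C * ENNReal.ofReal (1 / (1 + ‖ξ‖ ^ 2)) ∂μ :=
        lintegral_mono fun ξ => hC ‖ξ‖
    _ < ∞ := by
        rw [lintegral_const_mul _ measurable_dalang]
        exact ENNReal.mul_lt_top ENNReal.ofReal_lt_top h

/-- The increment of the integrand after the time change `u = t' - s`. -/
def incr (g gb : ℝ → ℝ → ℝ) (T δ : ℝ) (z : Space d) (p : ℝ × Space d) : ℝ≥0∞ :=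
  {p : ℝ × Space d | p.1 ≤ δ}.indicator (fun p => ENNReal.ofReal (gb p.1 ‖p.2‖ ^ 2)) p +
  {p : ℝ × Space d | p.1 + δ < T}.indicator
    (fun p => ‖phase p.2 z * (g (p.1 + δ) ‖p.2‖ : ℂ) - (g p.1 ‖p.2‖ : ℂ)‖ₑ ^ 2) p

lemma continuous_incr_aux (hK : IsScalingKernel eq d T a r g gb) :
    Continuous fun q : (ℝ × Space d) × (ℝ × Space d) =>
      phase q.2.2 q.1.2 * (g (q.2.1 + q.1.1) ‖q.2.2‖ : ℂ) - (g q.2.1 ‖q.2.2‖ : ℂ) := by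
  refine Continuous.sub (Continuous.mul (continuous_phase_comp ?_ ?_) (hK.continuous_comp ?_ ?_))
    (hK.continuous_comp ?_ ?_) <;> fun_prop

lemma measurable_incr_fst (hK : IsScalingKernel eq d T a r g gb) (δ : ℝ) :
    Measurable ({p : ℝ × Space d | p.1 ≤ δ}.indicator
      (fun p => ENNReal.ofReal (gb p.1 ‖p.2‖ ^ 2))) :=
  Measurable.indicator ((hK.gb_meas.comp (by fun_prop :
    Measurable fun p : ℝ × Space d => (p.1, ‖p.2‖))).pow_const 2).ennreal_ofReal
      (measurableSet_le measurable_fst measurable_const)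

lemma measurable_incr_snd (hK : IsScalingKernel eq d T a r g gb) (δ : ℝ) (z : Space d) :
    Measurable ({p : ℝ × Space d | p.1 + δ < T}.indicator
      (fun p => ‖phase p.2 z * (g (p.1 + δ) ‖p.2‖ : ℂ) - (g p.1 ‖p.2‖ : ℂ)‖ₑ ^ 2)) := by
  refine Measurable.indicator ?_ (measurableSet_lt (by fun_prop) measurable_const)
  have := (continuous_incr_aux hK).comp
    (by fun_prop : Continuous fun p : ℝ × Space d => ((δ, z), p))
  exact this.measurable.enorm.pow_const 2

lemma enorm_sq_eq (z : ℂ) : ‖z‖ₑ ^ 2 = ENNReal.ofReal (‖z‖ ^ 2) := by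
  rw [ENNReal.ofReal_pow (norm_nonneg _), ofReal_norm]

/-- Dominated convergence: at a fixed time u > 0 the first indicator vanishes once δ < u, and the
second term tends to 0 by continuity of g and of the character. The restriction δ ≥ 0 is essential,
since gb(u) dominates g only at times from u on. -/
lemma tendsto_incr (hK : IsScalingKernel eq d T a r g gb) (h : Dalang μ) :
    Tendsto (fun q : ℝ × Space d => ∫⁻ p, incr g gb T q.1 q.2 p
      ∂((volume.restrict (Ioo (0 : ℝ) T)).prod μ)) (𝓝[Ici 0 ×ˢ univ] (0, 0)) (𝓝 0) := by
  have := h.sigmaFinite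
  have hmem : ∀ᵐ p ∂((volume.restrict (Ioo (0 : ℝ) T)).prod μ), p.1 ∈ Ioo (0 : ℝ) T := by
    refine Measure.quasiMeasurePreserving_fst.ae (ae_restrict_mem measurableSet_Ioo)
  have hz : (𝓝 (0 : ℝ≥0∞)) = 𝓝 (∫⁻ p : ℝ × Space d, (0 : ℝ≥0∞)
      ∂((volume.restrict (Ioo (0 : ℝ) T)).prod μ)) := by rw [lintegral_zero]
  rw [hz]
  -- 5 = 1 + 4: the first term is at most gb², the second at most (2 gb)².
  refine tendsto_lintegral_filter_of_dominated_convergence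
    (fun p => 5 * ENNReal.ofReal (gb p.1 ‖p.2‖ ^ 2)) ?_ ?_ ?_ ?_
  · exact Eventually.of_forall fun q =>
      (measurable_incr_fst hK q.1).add (measurable_incr_snd hK q.1 q.2)
  · filter_upwards [self_mem_nhdsWithin] with q hq
    have hq0 : 0 ≤ q.1 := hq.1
    filter_upwards [hmem] with p hp
    have h5 : (5 : ℝ≥0∞) * ENNReal.ofReal (gb p.1 ‖p.2‖ ^ 2) =
        ENNReal.ofReal (gb p.1 ‖p.2‖ ^ 2) + ENNReal.ofReal (4 * gb p.1 ‖p.2‖ ^ 2) := by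
      rw [ENNReal.ofReal_mul (by norm_num), ENNReal.ofReal_ofNat]; ring
    rw [h5, incr]
    refine add_le_add ?_ ?_
    · exact indicator_apply_le' (fun _ => le_rfl) (fun _ => by simp)
    refine indicator_apply_le' (fun hT => ?_) (fun _ => by simp)
    rw [enorm_sq_eq]
    refine ENNReal.ofReal_le_ofReal ?_
    have hT' : p.1 + q.1 < T := hT
    have b1 := hK.majorant p.1 (p.1 + q.1) ‖p.2‖ hp.1 (by linarith) hT'.le
    have b2 := hK.majorant p.1 p.1 ‖p.2‖ hp.1 le_rfl hp.2.le
    have b3 : ‖phase p.2 q.2 * (g (p.1 + q.1) ‖p.2‖ : ℂ) - (g p.1 ‖p.2‖ : ℂ)‖ ≤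
        2 * gb p.1 ‖p.2‖ := by
      refine (norm_sub_le _ _).trans ?_
      rw [norm_mul, norm_phase, one_mul, Complex.norm_real, Complex.norm_real, Real.norm_eq_abs,
        Real.norm_eq_abs]
      linarith
    have := pow_le_pow_left₀ (norm_nonneg _) b3 2
    nlinarith
  · rw [lintegral_const_mul' _ _ (by simp)]
    exact ENNReal.mul_ne_top (by simp) (lintegral_gb_lt_top hK h).ne
  · filter_upwards [hmem] with p hp
    have e1 : ∀ᶠ q : ℝ × Space d in 𝓝[Ici 0 ×ˢ univ] (0, 0), q.1 < p.1 :=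
      mem_nhdsWithin_of_mem_nhds (continuous_fst.continuousAt.eventually_lt
        continuousAt_const hp.1)
    have hc : Tendsto (fun q : ℝ × Space d =>
        ‖phase p.2 q.2 * (g (p.1 + q.1) ‖p.2‖ : ℂ) - (g p.1 ‖p.2‖ : ℂ)‖ₑ ^ 2)
        (𝓝[Ici 0 ×ˢ univ] (0, 0)) (𝓝 0) := by
      have h1 := (continuous_incr_aux hK).comp
        (by fun_prop : Continuous fun q : ℝ × Space d => (q, p))
      have h2 := (((ENNReal.continuous_pow 2).comp h1.enorm).tendsto ((0 : ℝ), (0 : Space d))).mono_left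
        (nhdsWithin_le_nhds (s := Ici 0 ×ˢ univ))
      simpa [phase_zero_right, Function.comp_def] using h2
    refine tendsto_of_tendsto_of_tendsto_of_le_of_le' tendsto_const_nhds hc
      (Eventually.of_forall fun _ => zero_le) ?_
    filter_upwards [e1] with q hq
    rw [incr, indicator_of_notMem (show p ∉ {p : ℝ × Space d | p.1 ≤ q.1} from not_le.2 hq),
      zero_add]
    exact indicator_apply_le fun _ => le_rfl

/-- Extension by zero of an integrand on `(0,T)`. -/
lemma lintegral_reflect [SFinite μ] {F : ℝ × Space d → ℝ≥0∞} (hF : Measurable F) (t : ℝ) :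
    ∫⁻ s, ∫⁻ ξ, (Prod.fst ⁻¹' Ioo (0 : ℝ) T).indicator F (t - s, ξ) ∂μ =
      ∫⁻ p, F p ∂((volume.restrict (Ioo (0 : ℝ) T)).prod μ) := by
  have hm : Measurable ((Prod.fst ⁻¹' Ioo (0 : ℝ) T).indicator F) :=
    hF.indicator (measurable_fst measurableSet_Ioo)
  rw [lintegral_sub_left_eq_self (fun u => ∫⁻ ξ, (Prod.fst ⁻¹' Ioo (0 : ℝ) T).indicator F (u, ξ) ∂μ) t,
    lintegral_prod _ hF.aemeasurable, ← lintegral_indicator measurableSet_Ioo]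
  refine lintegral_congr fun u => ?_
  by_cases hu : u ∈ Ioo (0 : ℝ) T
  · rw [indicator_of_mem hu]
    refine lintegral_congr fun ξ => ?_
    rw [indicator_of_mem (show (u, ξ) ∈ Prod.fst ⁻¹' Ioo (0 : ℝ) T from hu)]
  · rw [indicator_of_notMem hu, ← lintegral_zero (μ := μ)]
    refine lintegral_congr fun ξ => ?_
    rw [indicator_of_notMem (show (u, ξ) ∉ Prod.fst ⁻¹' Ioo (0 : ℝ) T from hu)]

lemma eLpNorm_convFourier_sq_le (hK : IsScalingKernel eq d T a r g gb) (h : Dalang μ) {t : ℝ}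
    (ht : t ≤ T) (x : Space d) :
    eLpNorm (fun p : ℝ × Space d => convFourier g t x p.1 p.2) 2 (specMeas μ) ^ 2 ≤
      ∫⁻ p, ENNReal.ofReal (gb p.1 ‖p.2‖ ^ 2) ∂((volume.restrict (Ioo (0 : ℝ) T)).prod μ) := by
  have := h.sigmaFinite
  have hm : Measurable fun p : ℝ × Space d => ENNReal.ofReal (gb p.1 ‖p.2‖ ^ 2) :=
    ((hK.gb_meas.comp (by fun_prop : Measurable fun p : ℝ × Space d => (p.1, ‖p.2‖))).pow_const
      2).ennreal_ofReal
  rw [← lintegral_lintegral_enorm_sq (measurable_convFourier hK t x).aestronglyMeasurable]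
  rw [← lintegral_reflect hm t]
  refine le_trans ?_ (setLIntegral_le_lintegral (Ioi 0) _)
  refine setLIntegral_mono' measurableSet_Ioi fun s hs => lintegral_mono fun ξ => ?_
  have hs0 : 0 < s := hs
  by_cases hst : s < t
  · simp only
    rw [convFourier, indicator_of_mem (show s ∈ Ioo 0 t from ⟨hs, hst⟩),
      indicator_of_mem (show (t - s, ξ) ∈ Prod.fst ⁻¹' Ioo (0 : ℝ) T from
        ⟨by simp; linarith, by simp; linarith⟩), enorm_sq_eq, norm_mul, norm_phase, one_mul,
      Complex.norm_real, Real.norm_eq_abs]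
    refine ENNReal.ofReal_le_ofReal (pow_le_pow_left₀ (abs_nonneg _) ?_ 2)
    exact hK.majorant _ _ _ (by linarith) le_rfl (by linarith)
  · simp only
    rw [convFourier, indicator_of_notMem (fun h' => hst h'.2)]
    simp

lemma memLp_convFourier (hK : IsScalingKernel eq d T a r g gb) (h : Dalang μ) {t : ℝ}
    (ht : t ≤ T) (x : Space d) :
    MemLp (fun p : ℝ × Space d => convFourier g t x p.1 p.2) 2 (specMeas μ) := by
  refine ⟨(measurable_convFourier hK t x).aestronglyMeasurable, ?_⟩
  have h1 := (eLpNorm_convFourier_sq_le hK h ht x).trans_lt (lintegral_gb_lt_top hK h)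
  by_contra hne
  rw [not_lt_top_iff] at hne
  rw [hne] at h1
  simp at h1

/-- For s < t' both integrands are active; with u = t' - s, and after removing a factor of modulus
one, their difference is the second term of `incr`. For t' ≤ s < t only the first is active, at the
age u = t - s ≤ t - t'. Thus the two terms use two different reflections of time. -/
lemma lintegral_convFourier_sub_le (hK : IsScalingKernel eq d T a r g gb) [SFinite μ] {t t' : ℝ}
    (ht' : t' ≤ t) (ht : t ≤ T) (x x' : Space d) :
    ∫⁻ s in Ioi (0 : ℝ), ∫⁻ ξ, ‖convFourier g t x s ξ - convFourier g t' x' s ξ‖ₑ ^ 2 ∂μ ≤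
      ∫⁻ p, incr g gb T (t - t') (x - x') p ∂((volume.restrict (Ioo (0 : ℝ) T)).prod μ) := by
  set δ := t - t' with hδ
  have hm1 := measurable_incr_fst (d := d) hK δ
  have hm2 := measurable_incr_snd hK δ (x - x')
  have hind : ∀ {F : ℝ × Space d → ℝ≥0∞}, Measurable F → ∀ t : ℝ, Measurable fun p : ℝ × Space d =>
      (Prod.fst ⁻¹' Ioo (0 : ℝ) T).indicator F (t - p.1, p.2) := fun hF t =>
    (hF.indicator (measurable_fst measurableSet_Ioo)).comp (by fun_prop)
  simp only [incr]
  rw [lintegral_add_left hm1, ← lintegral_reflect hm1 t, ← lintegral_reflect hm2 t',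
    ← lintegral_add_left (hind hm1 t).lintegral_prod_right']
  refine le_trans ?_ (setLIntegral_le_lintegral (Ioi 0) _)
  refine setLIntegral_mono' measurableSet_Ioi fun s hs => ?_
  have hs0 : 0 < s := hs
  have hms : Measurable fun ξ : Space d => (Prod.fst ⁻¹' Ioo (0 : ℝ) T).indicator
      ({p : ℝ × Space d | p.1 ≤ δ}.indicator fun p => ENNReal.ofReal (gb p.1 ‖p.2‖ ^ 2))
        (t - s, ξ) := (hind hm1 t).comp measurable_prodMk_left
  simp only
  rw [← lintegral_add_left hms]
  refine lintegral_mono fun ξ => ?_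
  by_cases h1 : s < t'
  · have i1 : s ∈ Ioo 0 t := ⟨hs0, by linarith⟩
    have i2 : s ∈ Ioo 0 t' := ⟨hs0, h1⟩
    have i3 : (t' - s, ξ) ∈ (Prod.fst ⁻¹' Ioo (0 : ℝ) T : Set (ℝ × Space d)) :=
      ⟨by simp; linarith, by simp; linarith⟩
    have i4 : (t' - s, ξ) ∈ {p : ℝ × Space d | p.1 + δ < T} := by
      simp only [mem_ofPred_eq]; linarith
    refine le_trans (le_of_eq ?_) le_add_self
    simp only
    rw [indicator_of_mem i3, indicator_of_mem i4, convFourier, convFourier, indicator_of_mem i1,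
      indicator_of_mem i2]
    simp only
    have e1 : t' - s + δ = t - s := by rw [hδ]; ring
    have e2 : phase ξ x * (g (t - s) ‖ξ‖ : ℂ) - phase ξ x' * (g (t' - s) ‖ξ‖ : ℂ) =
        phase ξ x' * (phase ξ (x - x') * (g (t - s) ‖ξ‖ : ℂ) - (g (t' - s) ‖ξ‖ : ℂ)) := by
      have : phase ξ x = phase ξ x' * phase ξ (x - x') := by rw [← phase_add]; congr 1; abel
      rw [this]; ring
    rw [e1, e2, enorm_mul, ← ofReal_norm (phase ξ x'), norm_phase, ENNReal.ofReal_one, one_mul]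
  · have i2 : s ∉ Ioo 0 t' := fun h' => h1 h'.2
    by_cases h2 : s < t
    · have i1 : s ∈ Ioo 0 t := ⟨hs0, h2⟩
      have i3 : (t - s, ξ) ∈ (Prod.fst ⁻¹' Ioo (0 : ℝ) T : Set (ℝ × Space d)) :=
        ⟨by simp; linarith, by simp; linarith⟩
      have i4 : (t - s, ξ) ∈ {p : ℝ × Space d | p.1 ≤ δ} := by
        simp only [mem_ofPred_eq]; linarith
      refine le_trans ?_ le_self_add
      simp only
      rw [indicator_of_mem i3, indicator_of_mem i4, convFourier, convFourier, indicator_of_mem i1,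
        indicator_of_notMem i2, sub_zero, enorm_sq_eq, norm_mul, norm_phase, one_mul,
        Complex.norm_real, Real.norm_eq_abs]
      refine ENNReal.ofReal_le_ofReal (pow_le_pow_left₀ (abs_nonneg _) ?_ 2)
      exact hK.majorant _ _ _ (by linarith) le_rfl (by linarith)
    · rw [convFourier, convFourier, indicator_of_notMem (fun h' => h2 h'.2),
        indicator_of_notMem i2]
      simp

/-- The integrand of the stochastic convolution as an element of `L²(dt ⊗ μ)`. -/
def convL2 (hK : IsScalingKernel eq d T a r g gb) (h : Dalang μ) (z : ℝ × Space d) :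
    Lp ℂ 2 (specMeas μ) :=
  (memLp_convFourier hK h (min_le_right z.1 T) z.2).toLp

lemma exists_norm_convL2_le (hK : IsScalingKernel eq d T a r g gb) (h : Dalang μ) :
    ∃ C : ℝ, ∀ z, ‖convL2 hK h z‖ ≤ C := by
  set B := ∫⁻ p, ENNReal.ofReal (gb p.1 ‖p.2‖ ^ 2) ∂((volume.restrict (Ioo (0 : ℝ) T)).prod μ)
    with hB
  have hBt : B < ∞ := lintegral_gb_lt_top hK h
  -- From e² ≤ B one gets e ≤ max 1 B, which spares a square root.
  refine ⟨(max 1 B).toReal, fun z => ?_⟩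
  rw [convL2, Lp.norm_toLp]
  refine ENNReal.toReal_mono (max_lt ENNReal.one_lt_top hBt).ne ?_
  set e := eLpNorm (fun p : ℝ × Space d => convFourier g (min z.1 T) z.2 p.1 p.2) 2 (specMeas μ)
  have he : e ^ 2 ≤ B := eLpNorm_convFourier_sq_le hK h (min_le_right z.1 T) z.2
  rcases le_total e 1 with h1 | h1
  · exact h1.trans (le_max_left _ _)
  · refine le_trans (le_trans ?_ he) (le_max_right _ _)
    rw [sq]
    exact le_mul_of_one_le_left' h1

lemma continuous_convL2 (hK : IsScalingKernel eq d T a r g gb) (h : Dalang μ) :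
    Continuous (convL2 hK h) := by
  have := h.sigmaFinite
  rw [continuous_iff_continuousAt]
  rintro ⟨t₀, x₀⟩
  set I : ℝ × Space d → ℝ≥0∞ := fun q => ∫⁻ p, incr g gb T q.1 q.2 p
      ∂((volume.restrict (Ioo (0 : ℝ) T)).prod μ) with hI
  -- The increment estimate needs the earlier time as base. Either time may be the earlier one, so
  -- both orders of the spatial increment are summed.
  have hlim : Tendsto (fun z : ℝ × Space d => I (|min z.1 T - min t₀ T|, z.2 - x₀) +
      I (|min z.1 T - min t₀ T|, x₀ - z.2)) (𝓝 (t₀, x₀)) (𝓝 0) := by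
    have hI0 := tendsto_incr hK h
    have c1 : Tendsto (fun z : ℝ × Space d => (|min z.1 T - min t₀ T|, z.2 - x₀)) (𝓝 (t₀, x₀))
        (𝓝[Ici 0 ×ˢ univ] (0, 0)) := by
      refine tendsto_nhdsWithin_of_tendsto_nhds_of_eventually_within _ ?_
        (Eventually.of_forall fun z => ⟨mem_Ici.2 (abs_nonneg _), mem_univ _⟩)
      have : Continuous fun z : ℝ × Space d => (|min z.1 T - min t₀ T|, z.2 - x₀) := by fun_prop
      simpa using this.tendsto (t₀, x₀)
    have c2 : Tendsto (fun z : ℝ × Space d => (|min z.1 T - min t₀ T|, x₀ - z.2)) (𝓝 (t₀, x₀))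
        (𝓝[Ici 0 ×ˢ univ] (0, 0)) := by
      refine tendsto_nhdsWithin_of_tendsto_nhds_of_eventually_within _ ?_
        (Eventually.of_forall fun z => ⟨mem_Ici.2 (abs_nonneg _), mem_univ _⟩)
      have : Continuous fun z : ℝ × Space d => (|min z.1 T - min t₀ T|, x₀ - z.2) := by fun_prop
      simpa using this.tendsto (t₀, x₀)
    simpa using (hI0.comp c1).add (hI0.comp c2)
  refine (Lp.tendsto_Lp_iff_tendsto_eLpNorm''
    (fun (z : ℝ × Space d) (p : ℝ × Space d) => convFourier g (min z.1 T) z.2 p.1 p.2)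
    (fun z => memLp_convFourier hK h (min_le_right z.1 T) z.2) _
    (memLp_convFourier hK h (min_le_right t₀ T) x₀)).2 ?_
  have hsq : Tendsto (fun z : ℝ × Space d =>
      eLpNorm ((fun p : ℝ × Space d => convFourier g (min z.1 T) z.2 p.1 p.2) -
        fun p => convFourier g (min t₀ T) x₀ p.1 p.2) 2 (specMeas μ) ^ 2) (𝓝 (t₀, x₀)) (𝓝 0) := by
    refine tendsto_of_tendsto_of_tendsto_of_le_of_le tendsto_const_nhds hlim
      (fun _ => zero_le) fun z => ?_
    have hmz := (memLp_convFourier hK h (min_le_right z.1 T) z.2).1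
    have hm0 := (memLp_convFourier hK h (min_le_right t₀ T) x₀).1
    rcases le_total (min t₀ T) (min z.1 T) with hle | hle
    · refine le_trans ?_ le_self_add
      rw [← lintegral_lintegral_enorm_sq (hmz.sub hm0), abs_of_nonneg (sub_nonneg.2 hle)]
      exact lintegral_convFourier_sub_le hK hle (min_le_right _ _) _ _
    · refine le_trans ?_ le_add_self
      simp only
      rw [eLpNorm_sub_comm, ← lintegral_lintegral_enorm_sq (hm0.sub hmz), abs_sub_comm,
        abs_of_nonneg (sub_nonneg.2 hle)]
      exact lintegral_convFourier_sub_le hK hle (min_le_right _ _) _ _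
  have hroot := ((ENNReal.continuous_rpow_const (y := 1 / 2)).tendsto 0).comp hsq
  have h4 : ∀ x : ℝ≥0∞, (x ^ 2) ^ (2⁻¹ : ℝ) = x := fun x => by
    rw [← ENNReal.rpow_natCast, ← ENNReal.rpow_mul]; norm_num
  simpa [Function.comp_def, h4] using hroot

end ConvolutionIntegrand

/-! ### Approximation of the integrand by test functions of the past -/

section Closure

variable {eq : Eqn} {d : ℕ} {T : ℝ} {a r : ℝ → ℝ} {g gb : ℝ → ℝ → ℝ} {μ : Measure (Space d)}

/-- A smooth function on `ℝ × ℝ^d` with bounded support, as a test function. -/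
def mkTest (f : ℝ × Space d → ℝ) (hf : ContDiff ℝ (⊤ : ℕ∞) f) (hc : HasCompactSupport f) : TestFn d :=
  ⟨f, hf, hc, fun _ _ => trivial⟩

lemma hasCompactSupport_of_bound {f : ℝ × Space d → ℝ} {R : ℝ}
    (h : ∀ s y, f (s, y) ≠ 0 → |s| ≤ R ∧ ‖y‖ ≤ R) : HasCompactSupport f := by
  refine HasCompactSupport.intro (isCompact_closedBall (0 : ℝ × Space d) R) fun p hp => ?_
  by_contra hne
  refine hp ?_
  rw [mem_closedBall_zero_iff, Prod.norm_def]
  exact max_le (h p.1 p.2 hne).1 (h p.1 p.2 hne).2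

/-- The product test function `(s,y) ↦ θ(s) ρ(y)`. -/
def prodTest {θ : ℝ → ℝ} {ρ : Space d → ℝ} (hθ : ContDiff ℝ (⊤ : ℕ∞) θ)
    (hθc : HasCompactSupport θ) (hρ : ContDiff ℝ (⊤ : ℕ∞) ρ) (hρc : HasCompactSupport ρ) : TestFn d :=
  mkTest (fun p => θ p.1 * ρ p.2) ((hθ.comp contDiff_fst).mul (hρ.comp contDiff_snd)) (by
    obtain ⟨R₁, h₁⟩ := hθc.isCompact.isBounded.exists_norm_le
    obtain ⟨R₂, h₂⟩ := hρc.isCompact.isBounded.exists_norm_le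
    refine hasCompactSupport_of_bound (R := max R₁ R₂) fun s y h => ?_
    exact ⟨(h₁ s (subset_tsupport _ (left_ne_zero_of_mul h))).trans (le_max_left _ _),
      (h₂ y (subset_tsupport _ (right_ne_zero_of_mul h))).trans (le_max_right _ _)⟩)

lemma fourierTest_prodTest {θ : ℝ → ℝ} {ρ : Space d → ℝ} (hθ : ContDiff ℝ (⊤ : ℕ∞) θ)
    (hθc : HasCompactSupport θ) (hρ : ContDiff ℝ (⊤ : ℕ∞) ρ) (hρc : HasCompactSupport ρ)
    (s : ℝ) (ξ : Space d) :
    fourierTest (prodTest hθ hθc hρ hρc) s ξ = θ s * ∫ y, phase ξ y * (ρ y : ℂ) := by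
  rw [fourierTest_eq, ← integral_const_mul]
  congr 1; ext y
  change phase ξ y * ((θ s * ρ y : ℝ) : ℂ) = _
  push_cast; ring

/-- The test function `(s,y) ↦ θ(s) a(t-s) ρ(y - x + r(t-s) z)`. -/
def shiftTest (hK : IsScalingKernel eq d T a r g gb) {t : ℝ} (x z : Space d) {θ : ℝ → ℝ}
    {ρ : Space d → ℝ} (hθ : ContDiff ℝ (⊤ : ℕ∞) θ) (hθc : HasCompactSupport θ)
    (hθt : tsupport θ ⊆ Ioo 0 t) (hρ : ContDiff ℝ (⊤ : ℕ∞) ρ) (hρc : HasCompactSupport ρ) :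
    TestFn d :=
  mkTest (fun p => θ p.1 * a (t - p.1) * ρ (p.2 - x + r (t - p.1) • z)) (by
    rw [contDiff_iff_contDiffAt]
    rintro ⟨s, y⟩
    -- a and r are only known to be smooth at positive times (r = √ for heat). On the support of θ
    -- the argument t - s is positive; off it the function vanishes locally.
    by_cases hs : s ∈ tsupport θ
    · have h0 : 0 < t - s := by linarith [(hθt hs).2]
      have hsub : ContDiffAt ℝ (⊤ : ℕ∞) (fun p : ℝ × Space d => t - p.1) (s, y) := by fun_prop
      have ha : ContDiffAt ℝ (⊤ : ℕ∞) (fun p : ℝ × Space d => a (t - p.1)) (s, y) :=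
        ContDiffAt.comp (s, y) (hK.a_smooth (t - s) h0) hsub
      have hr : ContDiffAt ℝ (⊤ : ℕ∞) (fun p : ℝ × Space d => r (t - p.1)) (s, y) :=
        ContDiffAt.comp (s, y) (hK.r_smooth (t - s) h0) hsub
      have hθ' : ContDiffAt ℝ (⊤ : ℕ∞) (fun p : ℝ × Space d => θ p.1) (s, y) :=
        (hθ.comp contDiff_fst).contDiffAt
      have harg : ContDiffAt ℝ (⊤ : ℕ∞) (fun p : ℝ × Space d => p.2 - x + r (t - p.1) • z) (s, y) :=
        (contDiffAt_snd.sub contDiffAt_const).add (hr.smul contDiffAt_const)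
      exact (hθ'.mul ha).mul (ContDiffAt.comp (s, y) hρ.contDiffAt harg)
    · have h0 : (fun p : ℝ × Space d => θ p.1 * a (t - p.1) * ρ (p.2 - x + r (t - p.1) • z))
          =ᶠ[𝓝 (s, y)] fun _ => 0 := by
        have hopen : IsOpen {p : ℝ × Space d | p.1 ∉ tsupport θ} :=
          (isClosed_tsupport θ).isOpen_compl.preimage continuous_fst
        have : ∀ᶠ p : ℝ × Space d in 𝓝 (s, y), p.1 ∉ tsupport θ := hopen.mem_nhds hs
        filter_upwards [this] with p hp
        rw [image_eq_zero_of_notMem_tsupport hp]; ring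
      exact contDiffAt_const.congr_of_eventuallyEq h0) (by
    obtain ⟨R₁, h₁⟩ := hθc.isCompact.isBounded.exists_norm_le
    obtain ⟨R₂, h₂⟩ := hρc.isCompact.isBounded.exists_norm_le
    obtain ⟨R₃, h₃⟩ := hθc.isCompact.exists_bound_of_continuousOn
      (f := fun s => r (t - s) • z - x) (by have := hK.r_cont; fun_prop)
    refine hasCompactSupport_of_bound (R := max R₁ (R₂ + R₃)) fun s y h => ?_
    have hs := subset_tsupport _ (left_ne_zero_of_mul (left_ne_zero_of_mul h))
    refine ⟨(h₁ s hs).trans (le_max_left _ _), le_trans ?_ (le_max_right _ _)⟩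
    have e1 := h₂ _ (subset_tsupport _ (right_ne_zero_of_mul h))
    have e2 := h₃ s hs
    have e3 : y = (y - x + r (t - s) • z) - (r (t - s) • z - x) := by abel
    rw [e3]
    exact (norm_sub_le _ _).trans (add_le_add e1 e2))

lemma shiftTest_apply (hK : IsScalingKernel eq d T a r g gb) {t : ℝ} (x z : Space d) {θ : ℝ → ℝ}
    {ρ : Space d → ℝ} (hθ : ContDiff ℝ (⊤ : ℕ∞) θ) (hθc : HasCompactSupport θ)
    (hθt : tsupport θ ⊆ Ioo 0 t) (hρ : ContDiff ℝ (⊤ : ℕ∞) ρ) (hρc : HasCompactSupport ρ)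
    (s : ℝ) (y : Space d) : shiftTest hK x z hθ hθc hθt hρ hρc (s, y) =
      θ s * a (t - s) * ρ (y - x + r (t - s) • z) := rfl

/-- At fixed time the test function is a translate of θ(s)ρ, so its transform acquires a phase. All
dependence on z sits in that phase, ready to be averaged over G_1(dz). -/
lemma fourierTest_shiftTest (hK : IsScalingKernel eq d T a r g gb) {t : ℝ} (x z : Space d)
    {θ : ℝ → ℝ} {ρ : Space d → ℝ} (hθ : ContDiff ℝ (⊤ : ℕ∞) θ) (hθc : HasCompactSupport θ)
    (hθt : tsupport θ ⊆ Ioo 0 t) (hρ : ContDiff ℝ (⊤ : ℕ∞) ρ) (hρc : HasCompactSupport ρ)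
    (s : ℝ) (ξ : Space d) :
    fourierTest (shiftTest hK x z hθ hθc hθt hρ hρc) s ξ =
      fourierTest (prodTest hθ hθc hρ hρc) s ξ *
        (phase ξ x * ((a (t - s) : ℂ) * phase (r (t - s) • -ξ) z)) := by
  rw [fourierTest_prodTest, fourierTest_eq]
  simp_rw [shiftTest_apply]
  set c := x - r (t - s) • z with hc
  have h1 : ∀ y : Space d, phase ξ y * ((θ s * a (t - s) * ρ (y - x + r (t - s) • z) : ℝ) : ℂ) =
      (θ s * a (t - s) * phase ξ c : ℂ) * (phase ξ (y - c) * (ρ (y - c) : ℂ)) := by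
    intro y
    have e1 : y - x + r (t - s) • z = y - c := by rw [hc]; abel
    have e2 : phase ξ y = phase ξ c * phase ξ (y - c) := by rw [← phase_add]; congr 1; abel
    rw [e1, e2]; push_cast; ring
  simp_rw [h1]
  rw [integral_const_mul, integral_sub_right_eq_self (fun y => phase ξ y * (ρ y : ℂ)) c]
  have e3 : phase ξ c = phase ξ x * phase (r (t - s) • -ξ) z := by
    rw [hc, phase_sub, phase_neg, phase_smul]
  rw [e3]; ring

/-- Averaging the shifted test functions over `G_1(dz)` gives the mollified integrand. -/
lemma integral_shift (hK : IsScalingKernel eq d T a r g gb) {t : ℝ} (x : Space d) {s : ℝ}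
    (hs : s ∈ Ioo 0 t) (ξ : Space d) :
    ∫ z, phase ξ x * ((a (t - s) : ℂ) * phase (r (t - s) • -ξ) z) ∂(fundSol eq d 1) =
      convFourier g t x s ξ := by
  have h0 : 0 < t - s := sub_pos.2 hs.2
  rw [convFourier, indicator_of_mem hs, integral_const_mul, integral_const_mul,
    ← norm_neg ξ, ← hK.fourier _ h0, hK.scaling _ h0, fourierMeas_smul_map _ (hK.a_pos _ h0).le]
  rfl

/-- The test functions that vanish after time `t`. -/
def pastTests (d : ℕ) (t : ℝ) : Submodule ℝ (TestFn d) where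
  carrier := {φ | ∀ r, t < r → ∀ x, φ (r, x) = 0}
  add_mem' {φ ψ} hφ hψ r hr x := by
    change φ (r, x) + ψ (r, x) = 0
    rw [hφ r hr x, hψ r hr x, add_zero]
  zero_mem' r _ x := rfl
  smul_mem' c φ hφ r hr x := by
    change c • φ (r, x) = 0
    rw [hφ r hr x, smul_zero]

/-- Smooth cutoffs in time, compactly supported in `(0,t)`. -/
lemma exists_time_cutoff {t : ℝ} (ht : 0 < t) : ∃ θ : ℕ → ℝ → ℝ,
    (∀ n, ContDiff ℝ (⊤ : ℕ∞) (θ n)) ∧ (∀ n, HasCompactSupport (θ n)) ∧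
    (∀ n, tsupport (θ n) ⊆ Ioo 0 t) ∧ (∀ n s, |θ n s| ≤ 1) ∧
    ∀ s ∈ Ioo 0 t, Tendsto (fun n => θ n s) atTop (𝓝 1) := by
  have hpos : ∀ n : ℕ, (0 : ℝ) < 1 / (n + 2) := fun n => by positivity
  have hle : ∀ n : ℕ, 1 / ((n : ℝ) + 2) ≤ 1 / 2 := fun n => by
    apply one_div_le_one_div_of_le <;> linarith [(Nat.cast_nonneg n : (0 : ℝ) ≤ n)]
  -- The inner radius increases to t/2 and the outer radius lies halfway between it and t/2, so the
  -- support stays inside (0,t); n + 2 keeps the inner radius positive.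
  let B : ∀ n : ℕ, ContDiffBump (t / 2) := fun n =>
    ⟨t / 2 * (1 - 1 / (n + 2)), t / 2 * (1 - 1 / (n + 2) / 2),
      mul_pos (by linarith) (by linarith [hle n]),
      mul_lt_mul_of_pos_left (by linarith [hpos n]) (by linarith)⟩
  refine ⟨fun n => B n, fun n => (B n).contDiff, fun n => (B n).hasCompactSupport,
    fun n s hs => ?_, fun n s => ?_, fun s hs => ?_⟩
  · rw [(B n).tsupport_eq, Metric.mem_closedBall, Real.dist_eq] at hs
    have h1 : (B n).rOut < t / 2 := by
      change t / 2 * (1 - 1 / ((n : ℝ) + 2) / 2) < t / 2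
      nlinarith [mul_pos ht (hpos n)]
    have := abs_lt.1 (hs.trans_lt h1)
    exact ⟨by linarith [this.1], by linarith [this.2]⟩
  · rw [abs_of_nonneg (B n).nonneg]; exact (B n).le_one
  · refine tendsto_const_nhds.congr' ?_
    have hlim : Tendsto (fun n : ℕ => t / 2 * (1 - 1 / ((n : ℝ) + 2))) atTop (𝓝 (t / 2 * (1 - 0))) := by
      refine Tendsto.const_mul _ (Tendsto.const_sub _ ?_)
      exact tendsto_const_nhds.div_atTop
        (tendsto_atTop_add_const_right _ _ tendsto_natCast_atTop_atTop)
    rw [sub_zero, mul_one] at hlim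
    have hs' : |s - t / 2| < t / 2 := abs_lt.2 ⟨by linarith [hs.1], by linarith [hs.2]⟩
    filter_upwards [hlim.eventually (lt_mem_nhds hs')] with n hn
    symm
    refine (B n).one_of_mem_closedBall ?_
    rw [Metric.mem_closedBall, Real.dist_eq]
    exact hn.le

/-- Spatial mollifiers. -/
lemma exists_mollifier (d : ℕ) : ∃ ρ : ℕ → Space d → ℝ,
    (∀ n, ContDiff ℝ (⊤ : ℕ∞) (ρ n)) ∧ (∀ n, HasCompactSupport (ρ n)) ∧
    (∀ n ξ, ‖∫ y, phase ξ y * (ρ n y : ℂ)‖ ≤ 1) ∧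
    ∀ ξ, Tendsto (fun n => ∫ y, phase ξ y * (ρ n y : ℂ)) atTop (𝓝 1) := by
  let B : ∀ n : ℕ, ContDiffBump (0 : Space d) := fun n =>
    ⟨1 / (n + 2), 1 / (n + 1), by positivity, by
      apply one_div_lt_one_div_of_lt <;> linarith [(Nat.cast_nonneg n : (0 : ℝ) ≤ n)]⟩
  refine ⟨fun n => (B n).normed volume, fun n => (B n).contDiff_normed,
    fun n => (B n).hasCompactSupport_normed, fun n ξ => ?_, fun ξ => ?_⟩
  · refine (norm_integral_le_integral_norm _).trans (le_of_eq ?_)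
    rw [← (B n).integral_normed (μ := volume)]
    congr 1; ext y
    rw [norm_mul, norm_phase, one_mul, Complex.norm_real,
      Real.norm_of_nonneg ((B n).nonneg_normed y)]
  · have hr : Tendsto (fun n => (B n).rOut) atTop (𝓝 0) := tendsto_one_div_add_atTop_nhds_zero_nat
    have hc : Continuous fun y => phase ξ (-y) := continuous_phase_comp continuous_const continuous_neg
    have h := ContDiffBump.convolution_tendsto_right_of_continuous (μ := volume) hr hc 0
    simp only [neg_zero, phase_zero_right] at h
    refine h.congr fun n => ?_
    rw [convolution_def]
    congr 1; ext y
    simp [mul_comm]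

/-- The integrand of the stochastic convolution is a limit of past test functions. -/
lemma convL2_mem_closure (hK : IsScalingKernel eq d T a r g gb) (h : Dalang μ) {t : ℝ}
    (htT : t ≤ T) (x : Space d) :
    (memLp_convFourier hK h htT x).toLp ∈
      closure (((pastTests d t).map (fourierL2 h) : Submodule ℝ (Lp ℂ 2 (specMeas μ))) :
        Set (Lp ℂ 2 (specMeas μ))) := by
  have hσ := h.sigmaFinite
  have hfin := hK.finite
  set M := specMeas μ with hM
  set S : Submodule ℝ (Lp ℂ 2 M) := (pastTests d t).map (fourierL2 h) with hS
  set H := (memLp_convFourier hK h htT x).toLp with hH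
  rcases le_or_gt t 0 with ht | ht
  · have : H = 0 := by
      refine (Lp.eq_zero_iff_ae_eq_zero).2 ((MemLp.coeFn_toLp _).trans
        (Eventually.of_forall fun p => ?_))
      simp only
      rw [convFourier, indicator_of_notMem (fun h' => by linarith [h'.1, h'.2])]; rfl
    rw [this]
    exact subset_closure S.zero_mem
  -- The closure of a subspace of a Hilbert space is its double orthogonal complement: it suffices
  -- that every k orthogonal to the past test functions be orthogonal to the integrand.
  rw [← Submodule.topologicalClosure_coe, ← Submodule.orthogonal_orthogonal_eq_closure]
  refine SetLike.mem_coe.2 ((Submodule.mem_orthogonal _ _).2 fun k hk => ?_)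
  rw [Submodule.mem_orthogonal] at hk
  obtain ⟨θ, hθ, hθc, hθt, hθ1, hθlim⟩ := exists_time_cutoff ht
  obtain ⟨ρ, hρ, hρc, hρ1, hρlim⟩ := exists_mollifier d
  have hkL : MemLp k 2 M := Lp.memLp k
  set h₀ : ℝ × Space d → ℂ := fun p => convFourier g t x p.1 p.2 with hh₀
  have hhL : MemLp h₀ 2 M := memLp_convFourier hK h htT x
  have hpos : ∀ᵐ p ∂M, p.1 ∈ Ioi (0 : ℝ) :=
    Measure.quasiMeasurePreserving_fst.ae (ae_restrict_mem measurableSet_Ioi)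
  -- The mollified integrand is the average over G_1(dz) of the transforms of the shifted test
  -- functions. Each of them is orthogonal to k, and Fubini carries this over to the average.
  have step : ∀ n, ∫ p, inner ℝ (k p)
      (fourierTest (prodTest (hθ n) (hθc n) (hρ n) (hρc n)) p.1 p.2 * h₀ p) ∂M = 0 := by
    intro n
    set Θ : ℝ × Space d → ℂ := fun p =>
      fourierTest (prodTest (hθ n) (hθc n) (hρ n) (hρc n)) p.1 p.2 with hΘ
    have hΘL : MemLp Θ 2 M := memLp_fourierTest h _
    have hΘ0 : ∀ p, p.1 ∉ tsupport (θ n) → Θ p = 0 := fun p hp => by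
      rw [hΘ]; simp only
      rw [fourierTest_prodTest, image_eq_zero_of_notMem_tsupport hp]; simp
    set A : ℝ × Space d → Space d → ℂ := fun p z =>
      phase p.2 x * ((a (t - p.1) : ℂ) * phase (r (t - p.1) • -p.2) z) with hA
    have hAc : Continuous (Function.uncurry A) := by
      have hac := hK.a_cont
      have hrc := hK.r_cont
      refine Continuous.mul (continuous_phase_comp (by fun_prop) (by fun_prop)) (Continuous.mul ?_
        (continuous_phase_comp (by fun_prop) (by fun_prop)))
      exact Complex.continuous_ofReal.comp (hac.comp (by fun_prop))
    obtain ⟨C, hC⟩ := (hθc n).isCompact.exists_bound_of_continuousOn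
      (f := fun s => a (t - s)) (by have := hK.a_cont; fun_prop)
    have hC0 : ∀ p z, ‖Θ p * A p z‖ ≤ |C| * ‖Θ p‖ := by
      intro p z
      by_cases hp : p.1 ∈ tsupport (θ n)
      · rw [norm_mul, hA]
        simp only
        rw [norm_mul, norm_mul, norm_phase, norm_phase, one_mul, mul_one, mul_comm,
          Complex.norm_real]
        exact mul_le_mul_of_nonneg_right ((hC _ hp).trans (le_abs_self _)) (norm_nonneg _)
      · rw [hΘ0 p hp]; simp
    have hz : ∀ z, ∫ p, inner ℝ (k p) (Θ p * A p z) ∂M = 0 := by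
      intro z
      set ψ := shiftTest hK x z (hθ n) (hθc n) (hθt n) (hρ n) (hρc n) with hψ
      have hψp : ψ ∈ pastTests d t := by
        intro s hs y
        have h0 : θ n s = 0 := image_eq_zero_of_notMem_tsupport
          (fun h' => by linarith [(hθt n h').2])
        rw [hψ, shiftTest_apply, h0]
        ring
      have hψS : fourierL2 h ψ ∈ S := Submodule.mem_map.2 ⟨ψ, hψp, rfl⟩
      have h1 := hk _ hψS
      rw [real_inner_comm, L2.inner_def] at h1
      rw [← h1]
      refine integral_congr_ae ?_
      filter_upwards [coeFn_fourierL2 h ψ] with p hp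
      rw [hp, hψ, fourierTest_shiftTest]
    have hint : Integrable (Function.uncurry fun p z => inner ℝ (k p) (Θ p * A p z))
        (M.prod (fundSol eq d 1)) := by
      have hdom : Integrable (fun q : (ℝ × Space d) × Space d => (|C| * ‖Θ q.1‖) * ‖k q.1‖)
          (M.prod (fundSol eq d 1)) := by
        have h1 : Integrable (fun p => (|C| * ‖Θ p‖) * ‖k p‖) M :=
          (MemLp.integrable_mul (hΘL.norm.const_mul |C|) hkL.norm)
        exact h1.comp_fst _
      refine hdom.mono' ?_ (Eventually.of_forall fun q => ?_)
      · have hk1 : AEStronglyMeasurable (fun q : (ℝ × Space d) × Space d => k q.1)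
            (M.prod (fundSol eq d 1)) := hkL.1.comp_fst
        have hΘ1 : Continuous Θ := continuous_fourierTest _
        exact hk1.inner ((hΘ1.comp continuous_fst).mul hAc).aestronglyMeasurable
      · refine (norm_inner_le_norm _ _).trans ?_
        rw [mul_comm]
        exact mul_le_mul_of_nonneg_right (hC0 q.1 q.2) (norm_nonneg _)
    have hswap := integral_integral_swap hint
    simp_rw [hz, integral_zero] at hswap
    rw [← hswap]
    refine integral_congr_ae ?_
    filter_upwards [hpos] with p hp
    rw [integral_inner]
    · rw [integral_const_mul]
      by_cases hpt : p.1 < t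
      · rw [hA, integral_shift hK x ⟨hp, hpt⟩]
      · have h0 : Θ p = 0 := hΘ0 p fun h' => hpt (hθt n h').2
        have h1 : fourierTest (prodTest (hθ n) (hθc n) (hρ n) (hρc n)) p.1 p.2 = 0 := h0
        rw [h0, h1, zero_mul, zero_mul]
    · refine (integrable_const (|C| * ‖Θ p‖)).mono' ?_ (Eventually.of_forall fun z => hC0 p z)
      exact (continuous_const.mul (hAc.comp (by fun_prop :
        Continuous fun z => (p, z)))).aestronglyMeasurable
  -- Removal of cutoff and mollifier: their transforms are bounded by 1 and tend to 1 for times in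
  -- (0,t), outside of which the integrand is zero.
  have hlim : Tendsto (fun n => ∫ p, inner ℝ (k p)
      (fourierTest (prodTest (hθ n) (hθc n) (hρ n) (hρc n)) p.1 p.2 * h₀ p) ∂M) atTop
      (𝓝 (∫ p, inner ℝ (k p) (h₀ p) ∂M)) := by
    refine tendsto_integral_of_dominated_convergence (fun p => ‖k p‖ * ‖h₀ p‖) (fun n => ?_)
      (MemLp.integrable_mul hkL.norm hhL.norm)
      (fun n => Eventually.of_forall fun p => ?_) ?_
    · exact hkL.1.inner ((continuous_fourierTest _).aestronglyMeasurable.mul hhL.1)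
    · refine (norm_inner_le_norm _ _).trans (mul_le_mul_of_nonneg_left ?_ (norm_nonneg _))
      rw [norm_mul, fourierTest_prodTest, norm_mul, Complex.norm_real]
      have h1 : ‖θ n p.1‖ * ‖∫ y, phase p.2 y * (ρ n y : ℂ)‖ ≤ 1 * 1 :=
        mul_le_mul (hθ1 n p.1) (hρ1 n p.2) (norm_nonneg _) zero_le_one
      nlinarith [norm_nonneg (h₀ p)]
    · refine Eventually.of_forall fun p => ?_
      by_cases hp : p.1 ∈ Ioo 0 t
      · refine Tendsto.inner tendsto_const_nhds ?_
        simp_rw [fourierTest_prodTest]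
        have h1 : Tendsto (fun n => (θ n p.1 : ℂ)) atTop (𝓝 ((1 : ℝ) : ℂ)) :=
          (Complex.continuous_ofReal.tendsto _).comp (hθlim p.1 hp)
        simpa using (h1.mul (hρlim p.2)).mul_const (h₀ p)
      · have : h₀ p = 0 := by rw [hh₀]; simp only; rw [convFourier, indicator_of_notMem hp]
        simp [this]
  simp_rw [step] at hlim
  have hfinal := tendsto_nhds_unique hlim tendsto_const_nhds
  rw [L2.inner_def, ← hfinal]
  refine integral_congr_ae ?_
  filter_upwards [hhL.coeFn_toLp] with p hp
  rw [hH, hp]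

/-- The integrand of the stochastic convolution is the limit of a sequence of past test functions. -/
lemma exists_tendsto_convL2 (hK : IsScalingKernel eq d T a r g gb) (h : Dalang μ) {t : ℝ}
    (htT : t ≤ T) (x : Space d) : ∃ φ : ℕ → TestFn d,
      (∀ n r, t < r → ∀ y, φ n (r, y) = 0) ∧
      Tendsto (fun n => fourierL2 h (φ n)) atTop (𝓝 ((memLp_convFourier hK h htT x).toLp)) := by
  obtain ⟨u, hu, hlim⟩ := mem_closure_iff_seq_limit.1 (convL2_mem_closure hK h htT x)
  have hu' : ∀ n, ∃ φ ∈ pastTests d t, fourierL2 h φ = u n := fun n => hu n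
  choose φ hφ hφu using hu'
  refine ⟨φ, fun n => hφ n, ?_⟩
  simp_rw [hφu]
  exact hlim

end Closure

/-! ### The stochastic convolution as a field in L^q(Ω) -/

section StochasticConvolution

variable {Ω : Type*} [MeasurableSpace Ω] {P : Measure Ω} {eq : Eqn} {d : ℕ} {T : ℝ} {a r : ℝ → ℝ}
  {g gb : ℝ → ℝ → ℝ} {μ : Measure (Space d)} {W : TestFn d → Ω → ℝ} {q : ℝ≥0∞}

/-- The stochastic convolution as a bounded continuous adapted field with values in `L^q(Ω)`. -/
lemma exists_stochasticConvolution [P.IsComplete] [Fact (1 ≤ q)] (hW : IsNoise P μ W)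
    (hK : IsScalingKernel eq d T a r g gb) (h : Dalang μ) (hq : q ≠ ∞) (hq2 : 2 ≤ q) :
    ∃ Z : ℝ × Space d → Lp ℝ q P, Continuous Z ∧ (∃ C : ℝ, ∀ z, ‖Z z‖ ≤ C) ∧
      ∀ t ∈ Icc (0 : ℝ) T, ∀ x, AEStronglyMeasurable[noiseFiltration P μ W t] (Z (t, x)) P ∧
        ∀ Y : Ω → ℝ, Measurable Y → Y =ᵐ[P] Z (t, x) →
          IsWienerIntegral P μ W (convolutionIntegrand eq t x) Y := by
  have h1 : ∀ z : ℝ × Space d, ∃ φ : ℕ → TestFn d, (∀ n r, min z.1 T < r → ∀ y, φ n (r, y) = 0) ∧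
      Tendsto (fun n => fourierL2 h (φ n)) atTop (𝓝 (convL2 hK h z)) := fun z =>
    exists_tendsto_convL2 hK h (min_le_right z.1 T) z.2
  choose φ hφ0 hφ using h1
  choose Z hZ using fun z => hW.exists_tendsto h hq (hφ z)
  -- Continuity and boundedness of Z are read off from this identity and the corresponding facts in
  -- L²(dt ⊗ μ).
  have hdist : ∀ z z', ‖Z z - Z z'‖ = gaussConst q * ‖convL2 hK h z - convL2 hK h z'‖ :=
    fun z z' => hW.norm_sub_of_tendsto h hq (hφ z) (hZ z) (hφ z') (hZ z')
  refine ⟨Z, ?_, ?_, fun t ht x => ⟨?_, fun Y hY hYZ => ?_⟩⟩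
  · rw [continuous_iff_continuousAt]
    intro z₀
    rw [ContinuousAt, tendsto_iff_norm_sub_tendsto_zero]
    simp_rw [hdist]
    have := (tendsto_iff_norm_sub_tendsto_zero.1 ((continuous_convL2 hK h).tendsto z₀)).const_mul
      (gaussConst q)
    simpa using this
  · obtain ⟨C, hC⟩ := exists_norm_convL2_le hK h
    refine ⟨gaussConst q * (C + C) + ‖Z 0‖, fun z => ?_⟩
    have h2 : ‖Z z‖ ≤ ‖Z z - Z 0‖ + ‖Z 0‖ := by
      simpa using norm_add_le (Z z - Z 0) (Z 0)
    refine h2.trans (add_le_add_left ?_ _)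
    rw [hdist]
    exact mul_le_mul_of_nonneg_left ((norm_sub_le _ _).trans (add_le_add (hC _) (hC _)))
      (gaussConst_nonneg q)
  -- The elements of L^q(Ω) with an ℱ_t-measurable representative form a closed set, and Z (t, x) is
  -- a limit of noises of test functions vanishing after t.
  · have hcl := isClosed_aestronglyMeasurable (F := ℝ) (p := q) (μ := P)
      (noiseFiltration_le (P := P) (μ := μ) (W := W) t)
    refine hcl.mem_of_tendsto (hZ (t, x)) (Eventually.of_forall fun n => ?_)
    refine hW.aestronglyMeasurable_toLp hq ht.1 fun r hr y => hφ0 (t, x) n r ?_ y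
    rwa [min_eq_left ht.2]
  · rw [convolutionIntegrand_eq hK]
    have hlim := hφ (t, x)
    have he : convL2 hK h (t, x) = (memLp_convFourier hK h ht.2 x).toLp _ := by
      refine MemLp.toLp_congr _ _ (Eventually.of_forall fun p => ?_)
      simp only [min_eq_left ht.2]
    rw [he] at hlim
    exact isWienerIntegral_of_tendsto hW h hq hq2 _ hlim (hZ (t, x)) hY hYZ

end StochasticConvolution

/-! ### Jointly measurable modifications -/

section Modification

variable {Ω X : Type*} [MeasurableSpace Ω] [MeasurableSpace X] {P : Measure Ω}
  [IsProbabilityMeasure P] {q : ℝ≥0∞} [hq1 : Fact (1 ≤ q)]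

lemma lintegral_enorm_le_norm (f : Lp ℝ q P) : ∫⁻ ω, ‖f ω‖ₑ ∂P ≤ ENNReal.ofReal ‖f‖ := by
  rw [← eLpNorm_one_eq_lintegral_enorm, Lp.norm_def, ENNReal.ofReal_toReal (Lp.eLpNorm_ne_top f)]
  exact eLpNorm_le_eLpNorm_of_exponent_le hq1.out (Lp.aestronglyMeasurable f)

/-- A strongly measurable field with values in `L^q(Ω)` has a jointly measurable modification. -/
lemma exists_measurable_modification {V : X → Lp ℝ q P} (hV : StronglyMeasurable V) :
    ∃ v : X × Ω → ℝ, Measurable v ∧ ∀ z, (fun ω => v (z, ω)) =ᵐ[P] V z := by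
  rcases isEmpty_or_nonempty X with hX | ⟨⟨z₀⟩⟩
  · exact ⟨fun _ => 0, measurable_const, fun z => hX.elim z⟩
  obtain ⟨e, he⟩ : ∃ e : ℕ → Lp ℝ q P, range V ⊆ closure (range e) := by
    obtain ⟨c, hc, hVc⟩ := hV.isSeparable_range
    rcases c.eq_empty_or_nonempty with rfl | hne
    · rw [closure_empty] at hVc
      exact absurd (hVc ⟨z₀, rfl⟩) (notMem_empty _)
    · obtain ⟨e, rfl⟩ := hc.exists_eq_range hne
      exact ⟨e, hVc⟩
  have hex : ∀ (n : ℕ) (z : X), ∃ k, dist (V z) (e k) < (1 / 2 : ℝ) ^ n := fun n z => by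
    obtain ⟨_, ⟨k, rfl⟩, hk⟩ := Metric.mem_closure_iff.1 (he ⟨z, rfl⟩) ((1 / 2 : ℝ) ^ n) (by positivity)
    exact ⟨k, hk⟩
  classical
  -- The n-th approximation is the first term of a countable sequence within 2⁻ⁿ of V z. It depends
  -- on z through an integer, hence is jointly measurable, and its L¹ errors are summable, which
  -- forces almost sure convergence for each z.
  let κ : ℕ → X → ℕ := fun n z => Nat.find (hex n z)
  have hκm : ∀ n, Measurable (κ n) := fun n => by
    refine measurable_find (hex n) fun k => ?_
    exact measurableSet_lt (hV.dist stronglyMeasurable_const).measurable measurable_const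
  have hκ : ∀ n z, ‖V z - e (κ n z)‖ < (1 / 2 : ℝ) ^ n := fun n z => by
    rw [← dist_eq_norm]; exact Nat.find_spec (hex n z)
  let w : ℕ → X × Ω → ℝ := fun n p => e (κ n p.1) p.2
  have hw : ∀ n, Measurable (w n) := fun n => by
    have h1 : Measurable fun p : ℕ × Ω => e p.1 p.2 :=
      measurable_from_prod_countable_right fun k => (Lp.stronglyMeasurable (e k)).measurable
    exact h1.comp (((hκm n).comp measurable_fst).prodMk measurable_snd)
  -- The limsup is measurable without any exceptional set and equals the limit wherever the latter
  -- exists.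
  refine ⟨fun p => limsup (fun n => w n p) atTop, Measurable.limsup hw, fun z => ?_⟩
  have hsum : ∫⁻ ω, ∑' n, ‖(V z - e (κ n z) : Lp ℝ q P) ω‖ₑ ∂P ≠ ∞ := by
    rw [lintegral_tsum fun n => (Lp.aestronglyMeasurable _).enorm]
    refine ne_top_of_le_ne_top ?_ (ENNReal.tsum_le_tsum fun n =>
      (lintegral_enorm_le_norm _).trans (ENNReal.ofReal_le_ofReal (hκ n z).le))
    have hs : Summable fun n : ℕ => (1 / 2 : ℝ) ^ n := summable_geometric_two
    rw [← ENNReal.ofReal_tsum_of_nonneg (fun n => by positivity) hs]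
    exact ENNReal.ofReal_ne_top
  have hae : ∀ᵐ ω ∂P, ∑' n, ‖(V z - e (κ n z) : Lp ℝ q P) ω‖ₑ < ∞ :=
    ae_lt_top' (AEMeasurable.tsum fun n => (Lp.aestronglyMeasurable _).enorm) hsum
  have hsub : ∀ᵐ ω ∂P, ∀ n, (V z - e (κ n z) : Lp ℝ q P) ω = V z ω - e (κ n z) ω :=
    ae_all_iff.2 fun n => Lp.coeFn_sub _ _
  filter_upwards [hae, hsub] with ω h1 h2
  have h3 := ENNReal.tendsto_atTop_zero_of_tsum_ne_top h1.ne
  simp_rw [h2] at h3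
  refine Tendsto.limsup_eq ?_
  rw [tendsto_iff_edist_tendsto_0]
  refine h3.congr fun n => ?_
  rw [edist_comm, edist_eq_enorm_sub]

end Modification

/-! ### Bochner integrals in L^q(Ω) as pathwise integrals -/

section PathwiseIntegral

variable {Ω X : Type*} [MeasurableSpace Ω] [MeasurableSpace X] {P : Measure Ω}
  [IsProbabilityMeasure P] {q : ℝ≥0∞} [hq1 : Fact (1 ≤ q)]

/-- Integration over an event, as a continuous linear functional on `L^q(Ω)`. -/
lemma exists_setIntegral_clm (A : Set Ω) :
    ∃ L : Lp ℝ q P →L[ℝ] ℝ, ∀ f : Lp ℝ q P, L f = ∫ ω in A, f ω ∂P := by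
  have hi : ∀ f : Lp ℝ q P, Integrable f P := fun f => (Lp.memLp f).integrable hq1.out
  refine ⟨LinearMap.mkContinuous
    { toFun := fun f => ∫ ω in A, f ω ∂P
      map_add' := fun f g => ?_
      map_smul' := fun c f => ?_ } 1 fun f => ?_, fun f => rfl⟩
  · rw [← integral_add (hi f).integrableOn (hi g).integrableOn]
    exact integral_congr_ae (ae_restrict_of_ae (Lp.coeFn_add f g))
  · rw [RingHom.id_apply, ← integral_smul]
    exact integral_congr_ae (ae_restrict_of_ae (Lp.coeFn_smul c f))
  · rw [one_mul]
    change ‖∫ ω in A, f ω ∂P‖ ≤ _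
    refine (norm_integral_le_lintegral_norm _).trans ?_
    refine ENNReal.toReal_le_of_le_ofReal (norm_nonneg _) ?_
    refine le_trans ?_ (lintegral_enorm_le_norm f)
    refine (setLIntegral_le_lintegral _ _).trans (le_of_eq ?_)
    simp_rw [ofReal_norm]

/-- The Bochner integral in `L^q(Ω)` is the pathwise integral of a jointly measurable version. -/
lemma integral_modification {m : Measure X} [SFinite m] {B : X → Lp ℝ q P} (hB : Integrable B m)
    {β : X × Ω → ℝ} (hβ : Measurable β) (hβB : ∀ᵐ z ∂m, (fun ω => β (z, ω)) =ᵐ[P] B z) :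
    Integrable β (m.prod P) ∧
      (fun ω => ∫ z, β (z, ω) ∂m) =ᵐ[P] (∫ z, B z ∂m : Lp ℝ q P) := by
  have hint : Integrable β (m.prod P) := by
    refine ⟨hβ.aestronglyMeasurable, ?_⟩
    rw [hasFiniteIntegral_iff_enorm, lintegral_prod _ hβ.enorm.aemeasurable]
    refine lt_of_le_of_lt (lintegral_mono_ae ?_) hB.2
    filter_upwards [hβB] with z hz
    rw [lintegral_congr_ae (hz.mono fun ω hω => congrArg (‖·‖ₑ) hω : _ =ᵐ[P] fun ω => ‖B z ω‖ₑ)]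
    exact (lintegral_enorm_le_norm _).trans_eq (ofReal_norm _)
  refine ⟨hint, ?_⟩
  -- Both sides are compared through their integrals over events: the pathwise one by Fubini, the
  -- Bochner one because integration over an event is a continuous linear functional.
  refine Integrable.ae_eq_of_forall_setIntegral_eq _ _ hint.integral_prod_right
    ((Lp.memLp _).integrable hq1.out) fun A hA _ => ?_
  obtain ⟨L, hL⟩ := exists_setIntegral_clm (P := P) (q := q) A
  rw [← hL, ← L.integral_comp_comm hB]
  have hintA : Integrable β (m.prod (P.restrict A)) := by
    refine hint.mono_measure ?_
    exact Measure.prod_mono le_rfl Measure.restrict_le_self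
  rw [← integral_integral_swap (f := fun z ω => β (z, ω)) hintA]
  refine integral_congr_ae ?_
  filter_upwards [hβB] with z hz
  rw [hL]
  exact integral_congr_ae (ae_restrict_of_ae hz)

end PathwiseIntegral

/-! ### The Volterra equation in a Banach space -/

section Volterra

variable {d : ℕ} {E : Type*} [NormedAddCommGroup E] [NormedSpace ℝ E] {T A C : ℝ} {a r : ℝ → ℝ}
  {ν : Measure (Space d)} {U U' : ℝ × Space d → E}

/-- The integrand of the space-time convolution with the kernel
`G_τ = a(τ) · (law of r(τ) y under ν(dy))`. -/
def volterraIntegrand (a r : ℝ → ℝ) (U : ℝ × Space d → E) (z p : ℝ × Space d) : E :=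
  (Ioo 0 z.1 ×ˢ univ : Set (ℝ × Space d)).indicator
    (fun p => a (z.1 - p.1) • U (p.1, z.2 - r (z.1 - p.1) • p.2)) p

/-- The space-time convolution with the kernel `G_τ = a(τ) · (law of r(τ) y under ν(dy))`. -/
def volterra (a r : ℝ → ℝ) (ν : Measure (Space d)) (U : ℝ × Space d → E) (z : ℝ × Space d) : E :=
  ∫ p, volterraIntegrand a r U z p ∂((volume : Measure ℝ).prod ν)

lemma continuousOn_volterra_aux (ha : Continuous a) (hr : Continuous r)
    (hU : ContinuousOn U (Ioo 0 T ×ˢ univ)) :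
    ContinuousOn (fun w : (ℝ × Space d) × ℝ × Space d =>
      a (w.1.1 - w.2.1) • U (w.2.1, w.1.2 - r (w.1.1 - w.2.1) • w.2.2))
      {w | 0 < w.2.1 ∧ w.2.1 < T} := by
  refine ContinuousOn.smul (by fun_prop) ?_
  exact hU.comp (by fun_prop) fun w hw => ⟨hw, trivial⟩

lemma aestronglyMeasurable_volterraIntegrand (ha : Continuous a) (hr : Continuous r)
    (hU : ContinuousOn U (Ioo 0 T ×ˢ univ)) {m : Measure (ℝ × Space d)} {z : ℝ × Space d}
    (hz : z.1 ≤ T) : AEStronglyMeasurable (volterraIntegrand a r U z) m := by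
  have hms : MeasurableSet (Ioo 0 z.1 ×ˢ univ : Set (ℝ × Space d)) :=
    measurableSet_Ioo.prod MeasurableSet.univ
  refine (aestronglyMeasurable_indicator_iff hms).2 ?_
  refine ContinuousOn.aestronglyMeasurable ?_ hms
  exact (continuousOn_volterra_aux ha hr hU).comp (f := fun p => (z, p)) (by fun_prop)
    fun p hp => ⟨hp.1.1, hp.1.2.trans_le hz⟩

lemma norm_volterraIntegrand_le (hA : ∀ τ ∈ Icc 0 T, |a τ| ≤ A)
    (hC : ∀ t ∈ Ioo 0 T, ∀ x, ‖U (t, x)‖ ≤ C) {z : ℝ × Space d} (hz : z.1 ≤ T)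
    (p : ℝ × Space d) :
    ‖volterraIntegrand a r U z p‖ ≤
      (Ioo 0 T ×ˢ univ : Set (ℝ × Space d)).indicator (fun _ => A * C) p := by
  rw [volterraIntegrand, norm_indicator_eq_indicator_norm]
  by_cases hp : p ∈ (Ioo 0 z.1 ×ˢ univ : Set (ℝ × Space d))
  · have hpT : p.1 ∈ Ioo 0 T := ⟨hp.1.1, hp.1.2.trans_le hz⟩
    rw [indicator_of_mem hp, indicator_of_mem (show p ∈ (Ioo 0 T ×ˢ univ : Set _) from ⟨hpT, trivial⟩),
      norm_smul, Real.norm_eq_abs]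
    have h1 := hA (z.1 - p.1) ⟨by linarith [hp.1.2], by linarith [hp.1.1]⟩
    exact mul_le_mul h1 (hC _ hpT _) (norm_nonneg _) ((abs_nonneg _).trans h1)
  · rw [indicator_of_notMem hp]
    refine indicator_nonneg (fun p hp => ?_) _
    have h1 := hA (T - p.1) ⟨by linarith [hp.1.2], by linarith [hp.1.1]⟩
    exact mul_nonneg ((abs_nonneg _).trans h1) ((norm_nonneg _).trans (hC _ hp.1 0))

variable [IsFiniteMeasure ν]

lemma integrable_slab (c : ℝ) : Integrable
    ((Ioo 0 T ×ˢ univ : Set (ℝ × Space d)).indicator fun _ => c) ((volume : Measure ℝ).prod ν) := by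
  rw [integrable_indicator_iff (measurableSet_Ioo.prod MeasurableSet.univ)]
  refine integrableOn_const ?_
  rw [Measure.prod_prod]
  exact ENNReal.mul_ne_top (by simp) (measure_ne_top _ _)

lemma integrable_volterraIntegrand (ha : Continuous a) (hr : Continuous r)
    (hU : ContinuousOn U (Ioo 0 T ×ˢ univ)) (hA : ∀ τ ∈ Icc 0 T, |a τ| ≤ A)
    (hC : ∀ t ∈ Ioo 0 T, ∀ x, ‖U (t, x)‖ ≤ C) {z : ℝ × Space d} (hz : z.1 ≤ T) :
    Integrable (volterraIntegrand a r U z) ((volume : Measure ℝ).prod ν) :=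
  (integrable_slab (A * C)).mono' (aestronglyMeasurable_volterraIntegrand ha hr hU hz)
    (Eventually.of_forall fun p => norm_volterraIntegrand_le hA hC hz p)

lemma norm_volterra_le (hA : ∀ τ ∈ Icc 0 T, |a τ| ≤ A)
    (hC : ∀ t ∈ Ioo 0 T, ∀ x, ‖U (t, x)‖ ≤ C) {z : ℝ × Space d} (hz : z.1 ≤ T) :
    ‖volterra a r ν U z‖ ≤
      ∫ p, (Ioo 0 T ×ˢ univ : Set (ℝ × Space d)).indicator (fun _ => A * C) p
        ∂((volume : Measure ℝ).prod ν) :=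
  norm_integral_le_of_norm_le (integrable_slab (A * C))
    (Eventually.of_forall fun p => norm_volterraIntegrand_le hA hC hz p)

/-- Continuity of the space-time convolution of a bounded continuous field. -/
lemma continuous_volterra (ha : Continuous a) (hr : Continuous r)
    (hU : ContinuousOn U (Ioo 0 T ×ˢ univ)) (hA : ∀ τ ∈ Icc 0 T, |a τ| ≤ A)
    (hC : ∀ t ∈ Ioo 0 T, ∀ x, ‖U (t, x)‖ ≤ C) {c : ℝ → ℝ} (hc : Continuous c)
    (hcT : ∀ t, c t ≤ T) :
    Continuous fun z : ℝ × Space d => volterra a r ν U (c z.1, z.2) := by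
  rw [continuous_iff_continuousAt]
  intro z₀
  refine tendsto_integral_filter_of_dominated_convergence _
    (Eventually.of_forall fun z => aestronglyMeasurable_volterraIntegrand ha hr hU (hcT z.1))
    (Eventually.of_forall fun z => Eventually.of_forall fun p =>
      norm_volterraIntegrand_le hA hC (hcT z.1) p) (integrable_slab (A * C)) ?_
  -- The indicator of (0, c t) jumps as t varies only at s = c t, a null slice for fixed t.
  have hne : ∀ᵐ p ∂((volume : Measure ℝ).prod ν), p.1 ≠ c z₀.1 := by
    rw [ae_iff]
    have : {p : ℝ × Space d | ¬ p.1 ≠ c z₀.1} = {c z₀.1} ×ˢ univ := by ext p; simp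
    rw [this, Measure.prod_prod]; simp
  have hcz : Tendsto (fun z : ℝ × Space d => c z.1) (𝓝 z₀) (𝓝 (c z₀.1)) :=
    (hc.comp continuous_fst).tendsto z₀
  filter_upwards [hne] with p hp
  unfold volterraIntegrand
  by_cases hp0 : 0 < p.1
  · rcases lt_or_gt_of_ne hp with hlt | hgt
    · have hopen : IsOpen {w : (ℝ × Space d) × ℝ × Space d | 0 < w.2.1 ∧ w.2.1 < T} :=
        isOpen_Ioo.preimage (continuous_fst.comp continuous_snd)
      have hca := (continuousOn_volterra_aux ha hr hU).continuousAt
        (hopen.mem_nhds (show (((c z₀.1, z₀.2), p) : (ℝ × Space d) × ℝ × Space d) ∈ _ from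
          ⟨hp0, hlt.trans_le (hcT _)⟩))
      have hmap : Tendsto (fun z : ℝ × Space d => ((c z.1, z.2), p)) (𝓝 z₀)
          (𝓝 ((c z₀.1, z₀.2), p)) := by
        have : Continuous fun z : ℝ × Space d => ((c z.1, z.2), p) := by fun_prop
        exact this.tendsto z₀
      rw [indicator_of_mem (show p ∈ (Ioo 0 (c z₀.1) ×ˢ univ : Set _) from ⟨⟨hp0, hlt⟩, trivial⟩)]
      refine (hca.tendsto.comp hmap).congr' ?_
      filter_upwards [hcz.eventually (lt_mem_nhds hlt)] with z hz
      rw [indicator_of_mem (show p ∈ (Ioo 0 (c z.1) ×ˢ univ : Set _) from ⟨⟨hp0, hz⟩, trivial⟩)]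
      rfl
    · rw [indicator_of_notMem (fun h => lt_asymm hgt h.1.2)]
      refine tendsto_const_nhds.congr' ?_
      filter_upwards [hcz.eventually (gt_mem_nhds hgt)] with z hz
      rw [indicator_of_notMem (fun h => lt_asymm hz h.1.2)]
  · rw [indicator_of_notMem (fun h => hp0 h.1.1)]
    refine tendsto_const_nhds.congr fun z => ?_
    rw [indicator_of_notMem (fun h => hp0 h.1.1)]

/-- The weighted Lipschitz estimate for the space-time convolution. -/
lemma norm_volterra_sub_le (ha : Continuous a) (hr : Continuous r)
    (hU : ContinuousOn U (Ioo 0 T ×ˢ univ)) (hU' : ContinuousOn U' (Ioo 0 T ×ˢ univ))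
    (hA0 : 0 ≤ A) (hA : ∀ τ ∈ Icc 0 T, |a τ| ≤ A)
    (hC : ∀ t ∈ Ioo 0 T, ∀ x, ‖U (t, x)‖ ≤ C) (hC' : ∀ t ∈ Ioo 0 T, ∀ x, ‖U' (t, x)‖ ≤ C)
    {l D : ℝ} (hl : 0 < l) (hD : 0 ≤ D)
    (hUU : ∀ t ∈ Ioo 0 T, ∀ x, ‖U (t, x) - U' (t, x)‖ ≤ D * Real.exp (l * t))
    {z : ℝ × Space d} (hz0 : 0 ≤ z.1) (hz : z.1 ≤ T) :
    ‖volterra a r ν U z - volterra a r ν U' z‖ ≤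
      A * D * ν.real univ / l * Real.exp (l * z.1) := by
  rw [volterra, volterra, ← integral_sub (integrable_volterraIntegrand ha hr hU hA hC hz)
    (integrable_volterraIntegrand ha hr hU' hA hC' hz)]
  have hi : IntegrableOn (fun t => A * D * Real.exp (l * t)) (Ioo 0 z.1) :=
    ((by fun_prop : Continuous fun t => A * D * Real.exp (l * t)).integrableOn_Icc).mono_set
      Ioo_subset_Icc_self
  have hi' : Integrable ((Ioo 0 z.1).indicator fun t => A * D * Real.exp (l * t)) :=
    (integrable_indicator_iff measurableSet_Ioo).2 hi
  have hbound : ∀ p : ℝ × Space d, ‖volterraIntegrand a r U z p - volterraIntegrand a r U' z p‖ ≤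
      (Ioo 0 z.1).indicator (fun t => A * D * Real.exp (l * t)) p.1 * (fun _ => (1 : ℝ)) p.2 := by
    intro p
    simp only [volterraIntegrand, mul_one]
    by_cases hp : p ∈ (Ioo 0 z.1 ×ˢ univ : Set (ℝ × Space d))
    · have hpT : p.1 ∈ Ioo 0 T := ⟨hp.1.1, hp.1.2.trans_le hz⟩
      rw [indicator_of_mem hp, indicator_of_mem hp, indicator_of_mem hp.1, ← smul_sub, norm_smul,
        Real.norm_eq_abs, mul_assoc]
      exact mul_le_mul (hA (z.1 - p.1) ⟨by linarith [hp.1.2], by linarith [hp.1.1]⟩)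
        (hUU _ hpT _) (norm_nonneg _) hA0
    · rw [indicator_of_notMem hp, indicator_of_notMem hp, sub_zero, norm_zero]
      exact indicator_nonneg (fun t _ => by positivity) _
  refine (norm_integral_le_of_norm_le (hi'.mul_prod (integrable_const (μ := ν) (1 : ℝ)))
    (Eventually.of_forall hbound)).trans ?_
  rw [integral_prod_mul (fun t => (Ioo 0 z.1).indicator (fun t => A * D * Real.exp (l * t)) t)
    (fun _ => (1 : ℝ)), integral_indicator measurableSet_Ioo, integral_const_mul,
    ← integral_Ioc_eq_integral_Ioo, ← intervalIntegral.integral_of_le hz0,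
    intervalIntegral.integral_comp_mul_left _ hl.ne', integral_exp, integral_const]
  simp only [mul_zero, Real.exp_zero, smul_eq_mul, mul_one]
  -- Since ∫_0^t e^{ls} ds = (e^{lt}-1)/l, the weight gains a factor 1/l; the -1 is dropped.
  have h1 : A * D * (l⁻¹ * (Real.exp (l * z.1) - 1)) * ν.real univ =
      A * D * ν.real univ / l * (Real.exp (l * z.1) - 1) := by ring
  rw [h1]
  refine mul_le_mul_of_nonneg_left (by linarith) ?_
  positivity

/-- The quotient map by M commutes with the integral and kills the integrand; closedness makes the
quotient a normed space. -/
lemma integral_mem_of_isClosed {X : Type*} [MeasurableSpace X] {m : Measure X} [CompleteSpace E]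
    {M : Submodule ℝ E} (hM : IsClosed (M : Set E)) {f : X → E} (hf : Integrable f m)
    (hfM : ∀ x, f x ∈ M) : ∫ x, f x ∂m ∈ M := by
  have := hM
  have h1 := M.mkQL.integral_comp_comm hf
  have h2 : ∀ x, M.mkQL (f x) = 0 := fun x => (Submodule.Quotient.mk_eq_zero M).2 (hfM x)
  simp only [h2, integral_zero] at h1
  exact (Submodule.Quotient.mk_eq_zero M).1 h1.symm

/-- Existence of a bounded continuous adapted solution of the semilinear Volterra equation
`V = Z + G * F(J + V)` for a Lipschitz nonlinearity `F`. -/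
theorem exists_volterra_fixedPoint [CompleteSpace E] (hT : 0 < T) (ha : Continuous a)
    (hr : Continuous r) {F : E → E} {K : ℝ≥0} (hF : LipschitzWith K F)
    {J Z : ℝ × Space d → E} (hJ : ContinuousOn J (Ioo 0 T ×ˢ univ))
    (hJb : ∃ C, ∀ t ∈ Ioo 0 T, ∀ x, ‖J (t, x)‖ ≤ C) (hZ : Continuous Z)
    (hZb : ∃ C, ∀ z, ‖Z z‖ ≤ C) (M : ℝ → Submodule ℝ E) (hMc : ∀ t, IsClosed (M t : Set E))
    (hMm : Monotone M) (hFM : ∀ t, ∀ f ∈ M t, F f ∈ M t) (hJM : ∀ z, J z ∈ M z.1)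
    (hZM : ∀ t ∈ Icc 0 T, ∀ x, Z (t, x) ∈ M t) :
    ∃ V : ℝ × Space d → E, Continuous V ∧ (∃ C, ∀ t ∈ Icc 0 T, ∀ x, ‖V (t, x)‖ ≤ C) ∧
      (∀ t ∈ Icc 0 T, ∀ x, V (t, x) ∈ M t) ∧
      ∀ t ∈ Icc 0 T, ∀ x, V (t, x) = Z (t, x) + volterra a r ν (fun z => F (J z + V z)) (t, x) := by
  obtain ⟨CJ, hCJ⟩ := hJb
  obtain ⟨CZ, hCZ⟩ := hZb
  obtain ⟨A, hA⟩ := (isCompact_Icc (a := (0 : ℝ)) (b := T)).exists_bound_of_continuousOn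
    ha.continuousOn
  have hA' : ∀ τ ∈ Icc 0 T, |a τ| ≤ A := hA
  have hA0 : 0 ≤ A := (norm_nonneg _).trans (hA 0 ⟨le_rfl, hT.le⟩)
  -- In the norm weighted by e^{-lt} the map has Lipschitz constant A K ν(univ)/l; this l makes it
  -- at most 1/2, and the 1 keeps l positive.
  set l : ℝ := 2 * (A * K * ν.real univ + 1) with hl_def
  have hKA : 0 ≤ A * K * ν.real univ := by positivity
  have hl : 0 < l := by positivity
  have hl2 : A * K * ν.real univ / l ≤ 1 / 2 := by
    rw [div_le_iff₀ hl]; linarith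
  -- Clamping time to [0,T] makes all fields bounded and continuous on the whole of ℝ × ℝ^d, so that
  -- the contraction acts on a complete space of bounded continuous functions.
  let c : ℝ → ℝ := fun t => max 0 (min t T)
  have hc : Continuous c := by fun_prop
  have hc0 : ∀ t, 0 ≤ c t := fun t => le_max_left _ _
  have hcT : ∀ t, c t ≤ T := fun t => max_le hT.le (min_le_right _ _)
  have hc_eq : ∀ t ∈ Icc 0 T, c t = t := fun t ht => by
    simp only [c, min_eq_left ht.2, max_eq_right ht.1]
  -- From here on V is e^{-lt} times the actual unknown; the weight is undone at the end.
  let N : BoundedContinuousFunction (ℝ × Space d) E → ℝ × Space d → E :=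
    fun V z => F (J z + Real.exp (l * z.1) • V z)
  have hN : ∀ V, ContinuousOn (N V) (Ioo 0 T ×ˢ univ) := fun V =>
    hF.continuous.comp_continuousOn (hJ.add
      (Continuous.continuousOn ((by fun_prop : Continuous fun z : ℝ × Space d =>
        Real.exp (l * z.1)).smul V.continuous)))
  have hNb : ∀ V : BoundedContinuousFunction (ℝ × Space d) E, ∀ t ∈ Ioo 0 T, ∀ x,
      ‖N V (t, x)‖ ≤ K * (CJ + Real.exp (l * T) * ‖V‖) + ‖F 0‖ := by
    intro V t ht x
    have h1 : ‖N V (t, x) - F 0‖ ≤ K * ‖J (t, x) + Real.exp (l * t) • V (t, x) - 0‖ :=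
      hF.norm_sub_le _ _
    have h2 : ‖J (t, x) + Real.exp (l * t) • V (t, x)‖ ≤ CJ + Real.exp (l * T) * ‖V‖ := by
      refine (norm_add_le _ _).trans (add_le_add (hCJ t ht x) ?_)
      rw [norm_smul, Real.norm_eq_abs, abs_of_pos (Real.exp_pos _)]
      exact mul_le_mul (Real.exp_le_exp.2 (mul_le_mul_of_nonneg_left ht.2.le hl.le))
        (V.norm_coe_le_norm _) (norm_nonneg _) (Real.exp_pos _).le
    rw [sub_zero] at h1
    have h3 : ‖N V (t, x)‖ ≤ ‖N V (t, x) - F 0‖ + ‖F 0‖ := by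
      simpa using norm_add_le (N V (t, x) - F 0) (F 0)
    have h4 := mul_le_mul_of_nonneg_left h2 K.coe_nonneg
    linarith
  have hexp1 : ∀ t, Real.exp (-(l * c t)) ≤ 1 := fun t => by
    rw [Real.exp_le_one_iff]; have := mul_nonneg hl.le (hc0 t); linarith
  have hΦ : ∀ V : BoundedContinuousFunction (ℝ × Space d) E,
      ∃ Φ : BoundedContinuousFunction (ℝ × Space d) E, ∀ z, Φ z =
        Real.exp (-(l * c z.1)) • (Z (c z.1, z.2) + volterra a r ν (N V) (c z.1, z.2)) := by
    intro V
    refine ⟨BoundedContinuousFunction.ofNormedAddCommGroup _ ?_ (CZ +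
      ∫ p, (Ioo 0 T ×ˢ univ : Set (ℝ × Space d)).indicator
        (fun _ => A * (K * (CJ + Real.exp (l * T) * ‖V‖) + ‖F 0‖)) p
        ∂((volume : Measure ℝ).prod ν)) ?_, fun z => rfl⟩
    · refine Continuous.smul (by fun_prop) (Continuous.add ?_ ?_)
      · exact hZ.comp (by fun_prop)
      · exact continuous_volterra ha hr (hN V) hA' (hNb V) hc hcT
    · intro z
      change ‖Real.exp (-(l * c z.1)) • (Z (c z.1, z.2) + volterra a r ν (N V) (c z.1, z.2))‖ ≤ _
      rw [norm_smul, Real.norm_eq_abs, abs_of_pos (Real.exp_pos _)]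
      have h1 : ‖Z (c z.1, z.2) + volterra a r ν (N V) (c z.1, z.2)‖ ≤ _ :=
        (norm_add_le _ _).trans (add_le_add (hCZ _) (norm_volterra_le (ν := ν) hA' (hNb V) (hcT z.1)))
      refine le_trans ?_ h1
      exact mul_le_of_le_one_left (norm_nonneg _) (hexp1 _)
  choose Φ hΦ using hΦ
  have hcontr : ContractingWith (1 / 2) Φ := by
    refine ⟨by rw [← NNReal.coe_lt_coe]; norm_num, LipschitzWith.of_dist_le_mul fun V V' => ?_⟩
    rw [BoundedContinuousFunction.dist_le (by positivity)]
    intro z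
    rw [dist_eq_norm, hΦ, hΦ, ← smul_sub, add_sub_add_left_eq_sub, norm_smul, Real.norm_eq_abs,
      abs_of_pos (Real.exp_pos _)]
    have h1 := norm_volterra_sub_le (ν := ν) (z := (c z.1, z.2)) (l := l) (D := K * dist V V')
      (C := max (K * (CJ + Real.exp (l * T) * ‖V‖) + ‖F 0‖)
        (K * (CJ + Real.exp (l * T) * ‖V'‖) + ‖F 0‖)) ha hr (hN V) (hN V') hA0 hA'
      (fun t ht x => (hNb V t ht x).trans (le_max_left _ _))
      (fun t ht x => (hNb V' t ht x).trans (le_max_right _ _)) hl (by positivity) ?_ (hc0 z.1)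
      (hcT z.1)
    · calc Real.exp (-(l * c z.1)) * _ ≤ Real.exp (-(l * c z.1)) *
            (A * (K * dist V V') * ν.real univ / l * Real.exp (l * c z.1)) :=
          mul_le_mul_of_nonneg_left h1 (Real.exp_pos _).le
        _ = (A * K * ν.real univ / l * dist V V') *
            (Real.exp (-(l * c z.1)) * Real.exp (l * c z.1)) := by ring
        _ = A * K * ν.real univ / l * dist V V' := by
          rw [← Real.exp_add, neg_add_cancel, Real.exp_zero, mul_one]
        _ ≤ _ := by
          refine mul_le_mul_of_nonneg_right (hl2.trans_eq ?_) dist_nonneg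
          norm_num
    · intro t ht x
      refine (hF.norm_sub_le _ _).trans ?_
      rw [add_sub_add_left_eq_sub, ← smul_sub, norm_smul, Real.norm_eq_abs,
        abs_of_pos (Real.exp_pos _), mul_assoc (K : ℝ) (dist V V'), mul_comm (dist V V')]
      refine mul_le_mul_of_nonneg_left (mul_le_mul_of_nonneg_left ?_ (Real.exp_pos _).le) K.coe_nonneg
      rw [← dist_eq_norm]
      exact BoundedContinuousFunction.dist_coe_le_dist _
  have hfix : Φ (ContractingWith.fixedPoint Φ hcontr) = ContractingWith.fixedPoint Φ hcontr :=
    hcontr.fixedPoint_isFixedPt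
  set V := ContractingWith.fixedPoint Φ hcontr with hV_def
  have hadapt : ∀ V' : BoundedContinuousFunction (ℝ × Space d) E,
      (∀ t ∈ Icc 0 T, ∀ x, V' (t, x) ∈ M t) → ∀ t ∈ Icc 0 T, ∀ x, Φ V' (t, x) ∈ M t := by
    intro V' hV' t ht x
    rw [hΦ]
    simp only [hc_eq t ht]
    refine (M t).smul_mem _ ((M t).add_mem (hZM t ht x) ?_)
    refine integral_mem_of_isClosed (hMc t)
      (integrable_volterraIntegrand ha hr (hN V') hA' (hNb V') ht.2) fun p => ?_
    unfold volterraIntegrand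
    by_cases hp : p ∈ (Ioo 0 t ×ˢ univ : Set (ℝ × Space d))
    · rw [indicator_of_mem hp]
      refine (M t).smul_mem _ (hMm hp.1.2.le (hFM _ _ ((M p.1).add_mem (hJM (p.1, x - r (t - p.1) • p.2)) ?_)))
      exact (M p.1).smul_mem _ (hV' _ ⟨hp.1.1.le, hp.1.2.le.trans ht.2⟩ _)
    · rw [indicator_of_notMem hp]; exact (M t).zero_mem
  have hVM : ∀ t ∈ Icc 0 T, ∀ x, V (t, x) ∈ M t := by
    intro t ht x
    -- Adaptedness holds for every Picard iterate started at 0 and passes to the limit, the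
    -- subspaces being closed.
    have hiter : ∀ n : ℕ, ∀ t ∈ Icc 0 T, ∀ x, (Φ^[n] 0) (t, x) ∈ M t := by
      intro n
      induction n with
      | zero => intro t _ x; simp
      | succ n ih => rw [Function.iterate_succ_apply']; exact hadapt _ ih
    refine (hMc t).mem_of_tendsto (f := fun n : ℕ => (Φ^[n] 0) (t, x)) (b := atTop) ?_
      (Eventually.of_forall fun n => hiter n t ht x)
    have h1 : Continuous fun V' : BoundedContinuousFunction (ℝ × Space d) E => V' (t, x) :=
      continuous_eval_const _
    exact (h1.tendsto V).comp (hcontr.tendsto_iterate_fixedPoint 0)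
  refine ⟨fun z => Real.exp (l * z.1) • V z, ?_, ⟨Real.exp (l * T) * ‖V‖, fun t ht x => ?_⟩,
    fun t ht x => (M t).smul_mem _ (hVM t ht x), fun t ht x => ?_⟩
  · exact Continuous.smul (by fun_prop) V.continuous
  · rw [norm_smul, Real.norm_eq_abs, abs_of_pos (Real.exp_pos _)]
    exact mul_le_mul (Real.exp_le_exp.2 (mul_le_mul_of_nonneg_left ht.2 hl.le))
      (V.norm_coe_le_norm _) (norm_nonneg _) (Real.exp_pos _).le
  · have h1 := congrArg (fun f : BoundedContinuousFunction (ℝ × Space d) E => f (t, x)) hfix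
    simp only [hΦ, hc_eq t ht] at h1
    change Real.exp (l * t) • V (t, x) = _
    rw [← h1, smul_smul, ← Real.exp_add, add_neg_cancel, Real.exp_zero, one_smul]

end Volterra

/-! ### The drift as an integral against a fixed measure -/

section Kernel

variable {eq : Eqn} {d : ℕ} {T : ℝ} {a r : ℝ → ℝ} {g gb : ℝ → ℝ → ℝ}

lemma IsScalingKernel.lintegral_fundSol (hK : IsScalingKernel eq d T a r g gb) {τ : ℝ} (hτ : 0 < τ)
    {f : Space d → ℝ≥0∞} (hf : Measurable f) :
    ∫⁻ y, f y ∂(fundSol eq d τ) = ENNReal.ofReal (a τ) * ∫⁻ y, f (r τ • y) ∂(fundSol eq d 1) := by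
  rw [hK.scaling τ hτ, lintegral_smul_measure, lintegral_map hf (measurable_const_smul _),
    smul_eq_mul]

lemma IsScalingKernel.integral_fundSol (hK : IsScalingKernel eq d T a r g gb) {τ : ℝ} (hτ : 0 < τ)
    {f : Space d → ℝ} (hf : Measurable f) :
    ∫ y, f y ∂(fundSol eq d τ) = a τ * ∫ y, f (r τ • y) ∂(fundSol eq d 1) := by
  rw [hK.scaling τ hτ, integral_smul_measure,
    integral_map (measurable_const_smul _).aemeasurable hf.aestronglyMeasurable,
    ENNReal.toReal_ofReal (hK.a_pos τ hτ).le, smul_eq_mul]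

/-- The dilation moves the time dependence from the measure G_{t-s} into the integrand and leaves
the product ds ⊗ G_1, to which Fubini and dominated convergence apply. -/
lemma IsScalingKernel.lintegral_drift (hK : IsScalingKernel eq d T a r g gb) {t : ℝ}
    (x : Space d) {f : ℝ → Space d → ℝ≥0∞} (hf : Measurable (Function.uncurry f)) :
    ∫⁻ s in Ioo (0 : ℝ) t, ∫⁻ y, f s (x - y) ∂(fundSol eq d (t - s)) =
      ∫⁻ p, (Ioo 0 t ×ˢ univ : Set (ℝ × Space d)).indicator
        (fun p => ENNReal.ofReal (a (t - p.1)) * f p.1 (x - r (t - p.1) • p.2)) p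
        ∂((volume : Measure ℝ).prod (fundSol eq d 1)) := by
  have := hK.finite
  have hac := hK.a_cont
  have hrc := hK.r_cont
  have hm : Measurable fun p : ℝ × Space d =>
      ENNReal.ofReal (a (t - p.1)) * f p.1 (x - r (t - p.1) • p.2) := by
    have hsh : Continuous fun p : ℝ × Space d => (p.1, x - r (t - p.1) • p.2) := by fun_prop
    have hfs : Measurable fun p : ℝ × Space d => f p.1 (x - r (t - p.1) • p.2) :=
      hf.comp hsh.measurable
    exact Measurable.mul (by fun_prop) hfs
  rw [lintegral_prod _ (hm.indicator (measurableSet_Ioo.prod MeasurableSet.univ)).aemeasurable,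
    ← lintegral_indicator measurableSet_Ioo]
  congr 1; ext s
  by_cases hs : s ∈ Ioo 0 t
  · rw [indicator_of_mem hs, hK.lintegral_fundSol (sub_pos.2 hs.2)
      (f := fun y => f s (x - y)) (by fun_prop), ← lintegral_const_mul]
    · refine lintegral_congr fun y => ?_
      rw [indicator_of_mem (show (s, y) ∈ (Ioo 0 t ×ˢ univ : Set _) from ⟨hs, trivial⟩)]
    · fun_prop
  · rw [indicator_of_notMem hs]
    symm
    rw [lintegral_eq_zero_iff' (by
      exact ((hm.indicator (measurableSet_Ioo.prod MeasurableSet.univ)).comp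
        measurable_prodMk_left).aemeasurable)]
    exact Eventually.of_forall fun y => indicator_of_notMem (fun h => hs h.1) _

lemma IsScalingKernel.integral_drift (hK : IsScalingKernel eq d T a r g gb) {t : ℝ}
    (x : Space d) {f : ℝ → Space d → ℝ} (hf : Measurable (Function.uncurry f))
    (hi : Integrable (volterraIntegrand a r (Function.uncurry f) (t, x))
      ((volume : Measure ℝ).prod (fundSol eq d 1))) :
    ∫ s in Ioo (0 : ℝ) t, ∫ y, f s (x - y) ∂(fundSol eq d (t - s)) =
      volterra a r (fundSol eq d 1) (Function.uncurry f) (t, x) := by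
  have := hK.finite
  rw [volterra, integral_prod _ hi, ← integral_indicator measurableSet_Ioo]
  congr 1; ext s
  by_cases hs : s ∈ Ioo 0 t
  · rw [indicator_of_mem hs, hK.integral_fundSol (sub_pos.2 hs.2)
      (f := fun y => f s (x - y)) (by fun_prop), ← integral_const_mul]
    refine integral_congr_ae (Eventually.of_forall fun y => ?_)
    simp only [volterraIntegrand]
    rw [indicator_of_mem (show (s, y) ∈ (Ioo 0 t ×ˢ univ : Set _) from ⟨hs, trivial⟩)]
    rfl
  · rw [indicator_of_notMem hs]
    symm
    refine integral_eq_zero_of_ae (Eventually.of_forall fun y => ?_)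
    exact indicator_of_notMem (fun h => hs h.1) _

end Kernel

/-! ### Superposition operators on L^q(Ω) -/

section Nemytskii

variable {Ω : Type*} [MeasurableSpace Ω] {P : Measure Ω} [IsProbabilityMeasure P] {q : ℝ≥0∞}
  [Fact (1 ≤ q)]

/-- The superposition operator of a Lipschitz function on `L^q(Ω)`. -/
lemma exists_superposition {b : ℝ → ℝ} {K : ℝ≥0} (hb : LipschitzWith K b) :
    ∃ F : Lp ℝ q P → Lp ℝ q P, LipschitzWith K F ∧ ∀ f, F f =ᵐ[P] fun ω => b (f ω) := by
  -- Composition is Lipschitz on L^q for functions vanishing at 0; the constant b 0 is added back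
  -- and belongs to L^q because P is finite.
  have hb₁ : LipschitzWith K fun x => b x - b 0 := by
    simpa using hb.sub (LipschitzWith.const (b 0))
  have h0 : (fun x => b x - b 0) 0 = 0 := sub_self _
  refine ⟨fun f => hb₁.compLp h0 f + Lp.const q P (b 0), ?_, fun f => ?_⟩
  · refine LipschitzWith.of_dist_le_mul fun f f' => ?_
    rw [dist_add_right, dist_eq_norm, dist_eq_norm]
    exact hb₁.norm_compLp_sub_le h0 f f'
  · filter_upwards [Lp.coeFn_add (hb₁.compLp h0 f) (Lp.const q P (b 0)), hb₁.coeFn_compLp h0 f,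
      Lp.coeFn_const q P (b 0)] with ω h1 h2 h3
    rw [h1, Pi.add_apply, h2, h3]
    simp

end Nemytskii

/-- The properties of the deterministic term that the existence proof uses. -/
structure IsRegularInitial (eq : Eqn) {d : ℕ} (u₀ v₀ : Space d → ℝ) (T : ℝ) : Prop where
  measurable : Measurable u₀
  bounded : ∃ C, ∀ t ∈ Icc 0 T, ∀ x, |initialTerm eq u₀ v₀ t x| ≤ C
  continuous : ∀ t ∈ Icc 0 T, ∀ x, (0 < t ∨ ContinuousAt u₀ x) →
    ContinuousWithinAt (Function.uncurry (initialTerm eq u₀ v₀)) (Icc 0 T ×ˢ univ) (t, x)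

/-- At positive times continuity suffices; the slice t = 0 is split off, since there the term is u₀,
which may be discontinuous. -/
lemma IsRegularInitial.measurable_indicator {eq : Eqn} {d : ℕ} {u₀ v₀ : Space d → ℝ} {T : ℝ}
    (hJ : IsRegularInitial eq u₀ v₀ T) :
    Measurable ((Icc 0 T ×ˢ univ).indicator (Function.uncurry (initialTerm eq u₀ v₀))) := by
  classical
  have h1 : (Icc 0 T ×ˢ univ).indicator (Function.uncurry (initialTerm eq u₀ v₀)) =
      (Ioc 0 T ×ˢ univ).indicator (Function.uncurry (initialTerm eq u₀ v₀)) +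
      ((Icc 0 T ∩ {0}) ×ˢ univ).indicator fun z => u₀ z.2 := by
    ext ⟨t, x⟩
    rw [Pi.add_apply]
    simp only [indicator, mem_prod, mem_univ, and_true, mem_Icc, mem_Ioc, mem_inter_iff,
      mem_singleton_iff, Function.uncurry]
    rcases lt_trichotomy t 0 with h | rfl | h
    · simp [h.not_ge, h.not_gt]
    · by_cases hT : 0 ≤ T <;> simp [hT, initialTerm]
    · simp [h, h.le, h.ne']
  rw [h1]
  refine Measurable.add ?_ ?_
  · have hms : MeasurableSet (Ioc 0 T ×ˢ univ : Set (ℝ × Space d)) :=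
      measurableSet_Ioc.prod MeasurableSet.univ
    have hc : ContinuousOn (Function.uncurry (initialTerm eq u₀ v₀)) (Ioc 0 T ×ˢ univ) :=
      fun z hz => (hJ.continuous z.1 (Ioc_subset_Icc_self hz.1) z.2 (Or.inl hz.1.1)).mono
        (prod_mono_left Ioc_subset_Icc_self)
    rw [← piecewise_eq_indicator]
    exact hc.measurable_piecewise (continuous_zero (M := ℝ)).continuousOn hms
  · exact (hJ.measurable.comp measurable_snd).indicator
      ((measurableSet_Icc.inter (measurableSet_singleton _)).prod MeasurableSet.univ)

/-! ### Existence of a mild solution -/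

section Existence

variable {Ω : Type*} [MeasurableSpace Ω] {P : Measure Ω}
  {eq : Eqn} {d : ℕ} {T : ℝ} {a r : ℝ → ℝ} {g gb : ℝ → ℝ → ℝ} {μ : Measure (Space d)}
  {W : TestFn d → Ω → ℝ}

lemma noiseFiltration_mono : Monotone (noiseFiltration P μ W) := by
  intro s t hst
  refine MeasurableSpace.generateFrom_mono (union_subset_union_left _ ?_)
  rintro A ⟨u, hu, h⟩
  exact ⟨u, ⟨hu.1, hu.2.trans hst⟩, h⟩

/-- The Volterra equation is solved in L^q(Ω) with q = p, and u is the deterministic term plus a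
measurable version of V. Moments and L² continuity are then norm statements about U = I_0 + V, and
the drift of u is almost surely the Bochner integral of F(U). -/
theorem exists_mildSolution [IsProbabilityMeasure P] [P.IsComplete] (hK : IsScalingKernel eq d T a r g gb) (h : Dalang μ)
    (hW : IsNoise P μ W) {b : ℝ → ℝ} {K : ℝ≥0} (hb : LipschitzWith K b) (hT : 0 < T) {p : ℝ}
    (hp : 2 ≤ p) {u₀ v₀ : Space d → ℝ} (hJ : IsRegularInitial eq u₀ v₀ T) :
    ∃ u : ℝ → Space d → Ω → ℝ, IsBoundedL2Continuous P u₀ T p u ∧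
      IsMildSolution P μ W eq b u₀ v₀ T u := by
  have hfin := hK.finite
  set q : ℝ≥0∞ := ENNReal.ofReal p with hq_def
  have hq : q ≠ ∞ := ENNReal.ofReal_ne_top
  have hq2 : 2 ≤ q := by
    rw [hq_def, ← ENNReal.ofReal_ofNat]; exact ENNReal.ofReal_le_ofReal hp
  have hq1 : Fact (1 ≤ q) := ⟨le_trans (by norm_num) hq2⟩
  obtain ⟨Z, hZc, hZb, hZ⟩ := exists_stochasticConvolution hW hK h hq hq2
  obtain ⟨F, hFl, hF⟩ := exists_superposition (P := P) (q := q) hb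
  set Jm : ℝ × Space d → ℝ :=
    (Icc 0 T ×ˢ univ).indicator (Function.uncurry (initialTerm eq u₀ v₀)) with hJm
  have hJm_eq : ∀ t ∈ Icc 0 T, ∀ x, Jm (t, x) = initialTerm eq u₀ v₀ t x := fun t ht x =>
    indicator_of_mem (show (t, x) ∈ (Icc 0 T ×ˢ univ : Set _) from ⟨ht, trivial⟩) _
  have hJmm : Measurable Jm := hJ.measurable_indicator
  obtain ⟨CJ, hCJ⟩ := hJ.bounded
  have hJmc : ∀ t ∈ Icc 0 T, ∀ x, (0 < t ∨ ContinuousAt u₀ x) →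
      ContinuousWithinAt Jm (Icc 0 T ×ˢ univ) (t, x) := fun t ht x h =>
    (hJ.continuous t ht x h).congr (fun z hz => hJm_eq z.1 hz.1 z.2) (hJm_eq t ht x)
  let κ : ℝ →L[ℝ] Lp ℝ q P := Lp.constL q P ℝ
  have hκ : ∀ c : ℝ, (κ c : Ω → ℝ) =ᵐ[P] fun _ => c := fun c => Lp.coeFn_const q P c
  have hκn : ∀ c : ℝ, ‖κ c‖ ≤ |c| := fun c => by
    have : ‖κ c‖ ≤ ‖c‖ * P.real univ ^ (1 / q.toReal) := Lp.norm_const_le (p := q) (μ := P) c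
    simpa using this
  -- The closed subspaces are the elements of L^q with an ℱ_t-measurable representative; they
  -- contain the constants and are stable under the superposition operator.
  obtain ⟨V, hVc, ⟨CV, hCV⟩, hVM, hV⟩ := exists_volterra_fixedPoint (ν := fundSol eq d 1) hT
    hK.a_cont hK.r_cont hFl (J := fun z => κ (Jm z)) (Z := Z)
    (κ.continuous.comp_continuousOn fun z hz => (hJmc z.1 (Ioo_subset_Icc_self hz.1) z.2
      (Or.inl hz.1.1)).mono (prod_mono_left Ioo_subset_Icc_self))
    ⟨CJ, fun t ht x => (hκn _).trans (by
      rw [hJm_eq t (Ioo_subset_Icc_self ht)]; exact hCJ t (Ioo_subset_Icc_self ht) x)⟩ hZc hZb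
    (fun t => lpMeas ℝ ℝ (noiseFiltration P μ W t) q P)
    (fun t => isClosed_aestronglyMeasurable (noiseFiltration_le t))
    (fun s t hst f hf => mem_lpMeas_iff_aestronglyMeasurable.2
      ((mem_lpMeas_iff_aestronglyMeasurable.1 hf).mono (noiseFiltration_mono hst)))
    (fun t f hf => mem_lpMeas_iff_aestronglyMeasurable.2
      ((hb.continuous.comp_aestronglyMeasurable
        (mem_lpMeas_iff_aestronglyMeasurable.1 hf)).congr (hF f).symm))
    (fun z => mem_lpMeas_iff_aestronglyMeasurable.2
      (aestronglyMeasurable_const.congr (hκ (Jm z)).symm))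
    (fun t ht x => mem_lpMeas_iff_aestronglyMeasurable.2 (hZ t ht x).1)
  obtain ⟨v, hvm, hv⟩ := exists_measurable_modification (P := P) hVc.stronglyMeasurable
  set u : ℝ → Space d → Ω → ℝ := fun t x ω => Jm (t, x) + v ((t, x), ω) with hu
  set U : ℝ × Space d → Lp ℝ q P := fun z => κ (Jm z) + V z with hU
  have huU : ∀ t x, u t x =ᵐ[P] U (t, x) := fun t x => by
    filter_upwards [Lp.coeFn_add (κ (Jm (t, x))) (V (t, x)), hκ (Jm (t, x)), hv (t, x)]
      with ω h1 h2 h3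
    rw [hU]
    simp only [h1, Pi.add_apply, h2, hu, h3]
  have hum : Measurable fun w : (ℝ × Space d) × Ω => u w.1.1 w.1.2 w.2 :=
    (hJmm.comp measurable_fst).add hvm
  have hbum : Measurable fun w : (ℝ × Space d) × Ω => b (u w.1.1 w.1.2 w.2) :=
    hb.continuous.measurable.comp hum
  have hUc : ∀ t ∈ Icc 0 T, ∀ x, (0 < t ∨ ContinuousAt u₀ x) →
      ContinuousWithinAt U (Icc 0 T ×ˢ univ) (t, x) := fun t ht x h =>
    (κ.continuous.continuousAt.comp_continuousWithinAt (hJmc t ht x h)).add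
      hVc.continuousWithinAt
  have hUb : ∀ t ∈ Icc 0 T, ∀ x, ‖U (t, x)‖ ≤ CJ + CV := fun t ht x =>
    (norm_add_le _ _).trans (add_le_add ((hκn _).trans (by
      rw [hJm_eq t ht]; exact hCJ t ht x)) (hCV t ht x))
  obtain ⟨A, hA⟩ := (isCompact_Icc (a := (0 : ℝ)) (b := T)).exists_bound_of_continuousOn
    hK.a_cont.continuousOn
  have hFU : ContinuousOn (fun z => F (U z)) (Ioo 0 T ×ˢ univ) :=
    hFl.continuous.comp_continuousOn fun z hz => (hUc z.1 (Ioo_subset_Icc_self hz.1) z.2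
      (Or.inl hz.1.1)).mono (prod_mono_left Ioo_subset_Icc_self)
  have hFUb : ∀ t ∈ Ioo 0 T, ∀ x, ‖F (U (t, x))‖ ≤ K * (CJ + CV) + ‖F 0‖ := fun t ht x => by
    have h1 := hFl.norm_sub_le (U (t, x)) 0
    have h2 := hUb t (Ioo_subset_Icc_self ht) x
    have h3 : ‖F (U (t, x))‖ ≤ ‖F (U (t, x)) - F 0‖ + ‖F 0‖ := by
      simpa using norm_add_le (F (U (t, x)) - F 0) (F 0)
    rw [sub_zero] at h1
    have h4 := mul_le_mul_of_nonneg_left h2 K.coe_nonneg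
    linarith
  have hdrift : ∀ t ∈ Icc 0 T, ∀ x, (∀ᵐ ω ∂P, Integrable
      (volterraIntegrand a r (Function.uncurry fun s y => b (u s y ω)) (t, x))
      ((volume : Measure ℝ).prod (fundSol eq d 1))) ∧
      (fun ω => volterra a r (fundSol eq d 1) (Function.uncurry fun s y => b (u s y ω)) (t, x))
        =ᵐ[P] (volterra a r (fundSol eq d 1) (fun z => F (U z)) (t, x) : Lp ℝ q P) := by
    intro t ht x
    have hac := hK.a_cont
    have hrc := hK.r_cont
    have hB := integrable_volterraIntegrand (ν := fundSol eq d 1) hK.a_cont hK.r_cont hFU hA hFUb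
      (z := (t, x)) ht.2
    have hshift : Measurable fun w : (ℝ × Space d) × Ω =>
        ((w.1.1, x - r (t - w.1.1) • w.1.2), w.2) := by
      have : Continuous fun p : ℝ × Space d => (p.1, x - r (t - p.1) • p.2) := by fun_prop
      exact (this.measurable.comp measurable_fst).prodMk measurable_snd
    have hβ : Measurable fun w : (ℝ × Space d) × Ω =>
        volterraIntegrand a r (Function.uncurry fun s y => b (u s y w.2)) (t, x) w.1 := by
      have h1 : Measurable fun w : (ℝ × Space d) × Ω =>
          a (t - w.1.1) • b (u w.1.1 (x - r (t - w.1.1) • w.1.2) w.2) :=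
        Measurable.smul (f := fun w : (ℝ × Space d) × Ω => a (t - w.1.1)) (by fun_prop)
          (hbum.comp hshift)
      exact h1.indicator ((measurableSet_Ioo.prod MeasurableSet.univ).preimage measurable_fst :
        MeasurableSet (Prod.fst ⁻¹' (Ioo 0 t ×ˢ univ)))
    have hpt : ∀ z, (fun ω => volterraIntegrand a r (Function.uncurry fun s y => b (u s y ω))
        (t, x) z) =ᵐ[P] (volterraIntegrand a r (fun z => F (U z)) (t, x) z : Lp ℝ q P) := by
      intro z
      by_cases hz : z ∈ (Ioo 0 t ×ˢ univ : Set (ℝ × Space d))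
      · simp only [volterraIntegrand, indicator_of_mem hz]
        filter_upwards [Lp.coeFn_smul (a (t - z.1)) (F (U (z.1, x - r (t - z.1) • z.2))),
          hF (U (z.1, x - r (t - z.1) • z.2)), huU z.1 (x - r (t - z.1) • z.2)] with ω h1 h2 h3
        rw [h1, Pi.smul_apply, h2, ← h3]
        rfl
      · simp only [volterraIntegrand, indicator_of_notMem hz]
        exact (Lp.coeFn_zero ℝ q P).symm
    obtain ⟨h1, h2⟩ := integral_modification hB hβ (Eventually.of_forall hpt)
    exact ⟨h1.prod_left_ae, h2⟩
  refine ⟨u, ⟨fun t ht x h0 => ?_, ?_⟩, ?_, ?_, fun t ht x => ?_, fun t ht x => ?_⟩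
  · have h1 : Tendsto (fun z => ENNReal.ofReal ‖U z - U (t, x)‖) (𝓝[Icc (0 : ℝ) T ×ˢ univ] (t, x))
        (𝓝 0) := by
      have := (tendsto_iff_norm_sub_tendsto_zero.1 (hUc t ht x h0))
      simpa using ENNReal.tendsto_ofReal this
    have h2 : Tendsto (fun z => ENNReal.ofReal ‖U z - U (t, x)‖ ^ 2)
        (𝓝[Icc (0 : ℝ) T ×ˢ univ] (t, x)) (𝓝 0) := by
      simpa using ENNReal.Tendsto.pow (n := 2) h1
    refine tendsto_of_tendsto_of_tendsto_of_le_of_le tendsto_const_nhds h2 (fun _ => zero_le)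
      fun z => ?_
    simp only
    rw [lintegral_enorm_sq P fun ω => u z.1 z.2 ω - u t x ω]
    gcongr
    have h3 : (fun ω => u z.1 z.2 ω - u t x ω) =ᵐ[P] (U z - U (t, x) : Lp ℝ q P) := by
      filter_upwards [huU z.1 z.2, huU t x, Lp.coeFn_sub (U z) (U (t, x))] with ω h4 h5 h6
      rw [h6, Pi.sub_apply, h4, h5]
    rw [eLpNorm_congr_ae h3, Lp.norm_def, ENNReal.ofReal_toReal (Lp.eLpNorm_ne_top _)]
    exact eLpNorm_le_eLpNorm_of_exponent_le hq2 (Lp.aestronglyMeasurable _)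
  · refine lt_of_le_of_lt (iSup₂_le fun t ht => iSup_le fun x => ?_)
      (ENNReal.rpow_lt_top_of_nonneg (by linarith : 0 ≤ p)
        (ENNReal.ofReal_ne_top (r := CJ + CV)))
    have hq0 : q ≠ 0 := (lt_of_lt_of_le (by norm_num) hq2).ne'
    have hqp : q.toReal = p := ENNReal.toReal_ofReal (by linarith)
    have h1 : ∫⁻ ω, ‖u t x ω‖ₑ ^ p ∂P = eLpNorm (u t x) q P ^ p := by
      rw [eLpNorm_eq_lintegral_rpow_enorm_toReal hq0 hq, hqp, ← ENNReal.rpow_mul, one_div,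
        inv_mul_cancel₀ (by linarith), ENNReal.rpow_one]
    rw [h1, eLpNorm_congr_ae (huU t x)]
    refine ENNReal.rpow_le_rpow ?_ (by linarith)
    rw [← ENNReal.ofReal_toReal (Lp.eLpNorm_ne_top (U (t, x))), ← Lp.norm_def]
    exact ENNReal.ofReal_le_ofReal (hUb t ht x)
  · intro t ht x
    refine measurable_noiseFiltration_of_aestronglyMeasurable ?_
    refine AEStronglyMeasurable.add aestronglyMeasurable_const ?_
    exact (mem_lpMeas_iff_aestronglyMeasurable.1 (hVM t ht x)).congr (hv (t, x)).symm
  · have h1 : Measurable fun z : Icc (0 : ℝ) T × Space d × Ω => (((z.1 : ℝ), z.2.1), z.2.2) := by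
      fun_prop
    exact hum.comp h1
  · filter_upwards [(hdrift t ht x).1] with ω hω
    have hbω : Measurable (Function.uncurry fun s y => b (u s y ω)) :=
      hbum.comp (measurable_id.prodMk measurable_const)
    rw [hK.lintegral_drift x (f := fun s y => ‖b (u s y ω)‖ₑ) hbω.enorm]
    refine lt_of_le_of_lt (le_of_eq (lintegral_congr fun p => ?_)) hω.2
    rw [volterraIntegrand, enorm_indicator_eq_indicator_enorm]
    by_cases hp : p ∈ (Ioo 0 t ×ˢ univ : Set (ℝ × Space d))
    · rw [indicator_of_mem hp, indicator_of_mem hp, enorm_smul,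
        Real.enorm_of_nonneg (hK.a_pos _ (sub_pos.2 hp.1.2)).le]
      rfl
    · rw [indicator_of_notMem hp, indicator_of_notMem hp]
  · refine ⟨Z (t, x), (hZ t ht x).2 _ (Lp.stronglyMeasurable _).measurable EventuallyEq.rfl, ?_⟩
    have h1 : U (t, x) = κ (Jm (t, x)) + (Z (t, x) +
        volterra a r (fundSol eq d 1) (fun z => F (U z)) (t, x)) := by
      rw [hU]; simp only; rw [← hV t ht x]
    filter_upwards [(hdrift t ht x).1, (hdrift t ht x).2, huU t x,
      Lp.coeFn_add (κ (Jm (t, x))) (Z (t, x) +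
        volterra a r (fundSol eq d 1) (fun z => F (U z)) (t, x)),
      Lp.coeFn_add (Z (t, x)) (volterra a r (fundSol eq d 1) (fun z => F (U z)) (t, x)),
      hκ (Jm (t, x))] with ω h2 h3 h4 h5 h6 h7
    have hbω : Measurable (Function.uncurry fun s y => b (u s y ω)) :=
      hbum.comp (measurable_id.prodMk measurable_const)
    rw [h4, h1, h5, Pi.add_apply, h6, Pi.add_apply, h7, ← h3, hJm_eq t ht,
      hK.integral_drift x hbω h2, add_assoc]

end Existence

/-! ### Uniqueness -/

section Uniqueness

variable {Ω : Type*} [MeasurableSpace Ω] {P : Measure Ω}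
  {eq : Eqn} {d : ℕ} {T : ℝ} {a r : ℝ → ℝ} {g gb : ℝ → ℝ → ℝ} {μ : Measure (Space d)}
  {W : TestFn d → Ω → ℝ}

lemma enorm_volterraIntegrand (hK : IsScalingKernel eq d T a r g gb) (f : ℝ → Space d → ℝ) (t : ℝ)
    (x : Space d) (p : ℝ × Space d) :
    ‖volterraIntegrand a r (Function.uncurry f) (t, x) p‖ₑ =
      (Ioo 0 t ×ˢ univ : Set (ℝ × Space d)).indicator
        (fun p => ENNReal.ofReal (a (t - p.1)) * ‖f p.1 (x - r (t - p.1) • p.2)‖ₑ) p := by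
  rw [volterraIntegrand, enorm_indicator_eq_indicator_enorm]
  by_cases hp : p ∈ (Ioo 0 t ×ˢ univ : Set (ℝ × Space d))
  · rw [indicator_of_mem hp, indicator_of_mem hp, enorm_smul,
      Real.enorm_of_nonneg (hK.a_pos _ (sub_pos.2 hp.1.2)).le]
    rfl
  · rw [indicator_of_notMem hp, indicator_of_notMem hp]

lemma measurable_volterraIntegrand (hK : IsScalingKernel eq d T a r g gb) {f : ℝ → Space d → ℝ}
    (hf : Measurable (Function.uncurry f)) (t : ℝ) (x : Space d) :
    Measurable (volterraIntegrand a r (Function.uncurry f) (t, x)) := by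
  have hac := hK.a_cont
  have hrc := hK.r_cont
  have hsh : Continuous fun p : ℝ × Space d => (p.1, x - r (t - p.1) • p.2) := by fun_prop
  have hfs : Measurable fun p : ℝ × Space d => Function.uncurry f (p.1, x - r (t - p.1) • p.2) :=
    hf.comp hsh.measurable
  exact (Measurable.smul (f := fun p : ℝ × Space d => a (t - p.1)) (by fun_prop) hfs).indicator
    (measurableSet_Ioo.prod MeasurableSet.univ)

lemma enorm_drift_sub_le (hK : IsScalingKernel eq d T a r g gb) {t : ℝ}
    (x : Space d) {f₁ f₂ : ℝ → Space d → ℝ} (hf₁ : Measurable (Function.uncurry f₁))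
    (hf₂ : Measurable (Function.uncurry f₂))
    (h₁ : ∫⁻ s in Ioo (0 : ℝ) t, ∫⁻ y, ‖f₁ s (x - y)‖ₑ ∂(fundSol eq d (t - s)) < ∞)
    (h₂ : ∫⁻ s in Ioo (0 : ℝ) t, ∫⁻ y, ‖f₂ s (x - y)‖ₑ ∂(fundSol eq d (t - s)) < ∞) :
    ‖(∫ s in Ioo (0 : ℝ) t, ∫ y, f₁ s (x - y) ∂(fundSol eq d (t - s))) -
        ∫ s in Ioo (0 : ℝ) t, ∫ y, f₂ s (x - y) ∂(fundSol eq d (t - s))‖ₑ ≤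
      ∫⁻ s in Ioo (0 : ℝ) t, ∫⁻ y, ‖f₁ s (x - y) - f₂ s (x - y)‖ₑ ∂(fundSol eq d (t - s)) := by
  have hi : ∀ f : ℝ → Space d → ℝ, Measurable (Function.uncurry f) →
      ∫⁻ s in Ioo (0 : ℝ) t, ∫⁻ y, ‖f s (x - y)‖ₑ ∂(fundSol eq d (t - s)) < ∞ →
      Integrable (volterraIntegrand a r (Function.uncurry f) (t, x))
        ((volume : Measure ℝ).prod (fundSol eq d 1)) := by
    intro f hf h
    refine ⟨(measurable_volterraIntegrand hK hf t x).aestronglyMeasurable, ?_⟩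
    rw [hK.lintegral_drift x (f := fun s y => ‖f s y‖ₑ) hf.enorm] at h
    rw [hasFiniteIntegral_iff_enorm]
    simp_rw [enorm_volterraIntegrand hK]
    exact h
  rw [hK.integral_drift x hf₁ (hi f₁ hf₁ h₁), hK.integral_drift x hf₂ (hi f₂ hf₂ h₂), volterra,
    volterra, ← integral_sub (hi f₁ hf₁ h₁) (hi f₂ hf₂ h₂),
    hK.lintegral_drift x (f := fun s y => ‖f₁ s y - f₂ s y‖ₑ) (hf₁.sub hf₂).enorm]
  refine (enorm_integral_le_lintegral_enorm _).trans (le_of_eq (lintegral_congr fun p => ?_))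
  rw [← enorm_volterraIntegrand hK (fun s y => f₁ s y - f₂ s y)]
  congr 1
  simp only [volterraIntegrand]
  by_cases hp : p ∈ (Ioo 0 t ×ˢ univ : Set (ℝ × Space d))
  · simp only [indicator_of_mem hp, Function.uncurry, smul_sub]
  · simp only [indicator_of_notMem hp, sub_zero]

lemma le_one_add_rpow {p : ℝ} (hp : 1 ≤ p) (c : ℝ≥0∞) : c ≤ 1 + c ^ p := by
  rcases le_total c 1 with h | h
  · exact h.trans le_self_add
  · calc c = c ^ (1 : ℝ) := (ENNReal.rpow_one c).symm
      _ ≤ c ^ p := ENNReal.rpow_le_rpow_of_exponent_le h hp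
      _ ≤ _ := le_add_self

/-- A bounded field which is dominated by its own space-time convolution vanishes. -/
lemma eq_zero_of_le_volterra (hK : IsScalingKernel eq d T a r g gb) (hT : 0 < T) {K : ℝ≥0}
    {φ : ℝ → Space d → ℝ≥0∞} {C : ℝ≥0∞} (hC : C ≠ ∞) (hφC : ∀ t ∈ Icc 0 T, ∀ x, φ t x ≤ C)
    (hφ : ∀ t ∈ Icc 0 T, ∀ x, φ t x ≤
      K * ∫⁻ p, (Ioo 0 t ×ˢ univ : Set (ℝ × Space d)).indicator
        (fun p => ENNReal.ofReal (a (t - p.1)) * φ p.1 (x - r (t - p.1) • p.2)) p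
        ∂((volume : Measure ℝ).prod (fundSol eq d 1))) :
    ∀ t ∈ Icc 0 T, ∀ x, φ t x = 0 := by
  have := hK.finite
  set ν := fundSol eq d 1
  obtain ⟨A, hA⟩ := (isCompact_Icc (a := (0 : ℝ)) (b := T)).exists_bound_of_continuousOn
    hK.a_cont.continuousOn
  have hA0 : 0 ≤ A := (norm_nonneg _).trans (hA 0 ⟨le_rfl, hT.le⟩)
  set l : ℝ := 2 * (A * K * ν.real univ + 1) with hl_def
  have hKA : 0 ≤ A * K * ν.real univ := by positivity
  have hl : 0 < l := by positivity
  have hl2 : A * K * ν.real univ / l ≤ 1 / 2 := by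
    rw [div_le_iff₀ hl]; linarith
  set S : ℝ≥0∞ := ⨆ t ∈ Icc 0 T, ⨆ x, ENNReal.ofReal (Real.exp (-(l * t))) * φ t x with hS
  have hexp : ∀ t, ENNReal.ofReal (Real.exp (l * t)) * ENNReal.ofReal (Real.exp (-(l * t))) = 1 :=
    fun t => by
      rw [← ENNReal.ofReal_mul (Real.exp_pos _).le, ← Real.exp_add, add_neg_cancel, Real.exp_zero,
        ENNReal.ofReal_one]
  have hSle : ∀ t ∈ Icc 0 T, ∀ x, ENNReal.ofReal (Real.exp (-(l * t))) * φ t x ≤ S :=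
    fun t ht x => le_iSup₂_of_le t ht (le_iSup_of_le x le_rfl)
  have hφS : ∀ t ∈ Icc 0 T, ∀ x, φ t x ≤ ENNReal.ofReal (Real.exp (l * t)) * S := fun t ht x => by
    calc φ t x = ENNReal.ofReal (Real.exp (l * t)) *
          (ENNReal.ofReal (Real.exp (-(l * t))) * φ t x) := by rw [← mul_assoc, hexp, one_mul]
      _ ≤ _ := by gcongr; exact hSle t ht x
  have hSfin : S ≠ ∞ := by
    refine ne_top_of_le_ne_top hC (iSup₂_le fun t ht => iSup_le fun x => ?_)
    refine (mul_le_mul' ?_ (hφC t ht x)).trans_eq (one_mul C)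
    rw [← ENNReal.ofReal_one]
    refine ENNReal.ofReal_le_ofReal (Real.exp_le_one_iff.2 ?_)
    have := mul_nonneg hl.le ht.1
    linarith
  have hhalf : S ≤ S / 2 := by
    refine iSup₂_le fun t ht => iSup_le fun x => ?_
    have h1 : ∫⁻ p, (Ioo 0 t ×ˢ univ : Set (ℝ × Space d)).indicator
        (fun p => ENNReal.ofReal (a (t - p.1)) * φ p.1 (x - r (t - p.1) • p.2)) p
        ∂((volume : Measure ℝ).prod ν) ≤
        ∫⁻ p, (Ioo 0 t).indicator (fun s => ENNReal.ofReal (A * Real.exp (l * s)) * S) p.1 *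
          (fun _ => (1 : ℝ≥0∞)) p.2 ∂((volume : Measure ℝ).prod ν) := by
      refine lintegral_mono fun p => ?_
      by_cases hp : p ∈ (Ioo 0 t ×ˢ univ : Set (ℝ × Space d))
      · rw [indicator_of_mem hp, indicator_of_mem hp.1, mul_one, ENNReal.ofReal_mul hA0, mul_assoc]
        refine mul_le_mul' (ENNReal.ofReal_le_ofReal ((le_abs_self _).trans
          (hA _ ⟨by linarith [hp.1.2], by linarith [hp.1.1, ht.2]⟩))) (hφS _ ⟨hp.1.1.le, ?_⟩ _)
        linarith [hp.1.2, ht.2]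
      · rw [indicator_of_notMem hp]; exact zero_le
    have h2 : ∫⁻ s in Ioo 0 t, ENNReal.ofReal (A * Real.exp (l * s)) ≤
        ENNReal.ofReal (A * (Real.exp (l * t) / l)) := by
      rw [← ofReal_integral_eq_lintegral_ofReal]
      · refine ENNReal.ofReal_le_ofReal ?_
        rw [integral_const_mul, ← integral_Ioc_eq_integral_Ioo,
          ← intervalIntegral.integral_of_le ht.1,
          intervalIntegral.integral_comp_mul_left _ hl.ne', integral_exp, mul_zero, Real.exp_zero,
          smul_eq_mul, div_eq_inv_mul]
        gcongr
        linarith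
      · exact ((by fun_prop : Continuous fun s => A * Real.exp (l * s)).integrableOn_Icc
          (μ := volume)).mono_set Ioo_subset_Icc_self
      · exact Eventually.of_forall fun s => by positivity
    rw [lintegral_prod_mul (((by fun_prop : Measurable fun s =>
        ENNReal.ofReal (A * Real.exp (l * s)) * S).indicator measurableSet_Ioo).aemeasurable)
      aemeasurable_const, lintegral_indicator measurableSet_Ioo, lintegral_const, one_mul,
      lintegral_mul_const _ (by fun_prop), ← ofReal_measureReal] at h1
    calc ENNReal.ofReal (Real.exp (-(l * t))) * φ t x
        ≤ ENNReal.ofReal (Real.exp (-(l * t))) * (K * (ENNReal.ofReal (A * (Real.exp (l * t) / l)) *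
            S * ENNReal.ofReal (ν.real univ))) := by
          gcongr
          exact (hφ t ht x).trans (mul_le_mul' le_rfl (h1.trans (by gcongr)))
      _ = ENNReal.ofReal (A * K * ν.real univ / l) * S := by
          have h3 : (K : ℝ≥0∞) = ENNReal.ofReal (K : ℝ) := by simp
          have h4 : A * K * ν.real univ / l =
              Real.exp (-(l * t)) * (K * ((A * (Real.exp (l * t) / l)) * ν.real univ)) := by
            have h5 : Real.exp (-(l * t)) * Real.exp (l * t) = 1 := by
              rw [← Real.exp_add, neg_add_cancel, Real.exp_zero]
            linear_combination (-(A * K * ν.real univ / l)) * h5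
          rw [h4, h3, ENNReal.ofReal_mul (Real.exp_pos _).le, ENNReal.ofReal_mul K.coe_nonneg,
            ENNReal.ofReal_mul (p := A * (Real.exp (l * t) / l)) (by positivity)]
          ring
      _ ≤ S / 2 := by
          rw [ENNReal.div_eq_inv_mul]
          gcongr
          refine (ENNReal.ofReal_le_ofReal hl2).trans_eq ?_
          rw [one_div, ENNReal.ofReal_inv_of_pos two_pos, ENNReal.ofReal_ofNat]
  -- S ≤ S/2 forces S = 0 only because S is finite, which the bound C guarantees.
  have hS0 : S = 0 := by
    by_contra hne
    exact absurd hhalf (not_le.2 (ENNReal.half_lt_self hne hSfin))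
  intro t ht x
  have := hφS t ht x
  rw [hS0, mul_zero] at this
  exact le_antisymm this zero_le

/-- The Wiener integrals of the two solutions have the same integrand and cancel. By the Lipschitz
property E|u - v| is then dominated by K times its own convolution with G; it is bounded because c ≤
1 + c^p turns the p-th moments into first moments. -/
theorem IsMildSolution.ae_eq [IsProbabilityMeasure P] (hK : IsScalingKernel eq d T a r g gb)
    (h : Dalang μ) (hW : IsNoise P μ W) {b : ℝ → ℝ} {K : ℝ≥0} (hb : LipschitzWith K b) (hT : 0 < T)
    {p : ℝ} (hp : 2 ≤ p) {u₀ v₀ : Space d → ℝ} {u v : ℝ → Space d → Ω → ℝ}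
    (hu : IsMildSolution P μ W eq b u₀ v₀ T u) (hv : IsMildSolution P μ W eq b u₀ v₀ T v)
    (hup : (⨆ t ∈ Icc (0 : ℝ) T, ⨆ x, ∫⁻ ω, ‖u t x ω‖ₑ ^ p ∂P) < ∞)
    (hvp : (⨆ t ∈ Icc (0 : ℝ) T, ⨆ x, ∫⁻ ω, ‖v t x ω‖ₑ ^ p ∂P) < ∞) :
    ∀ t ∈ Icc (0 : ℝ) T, ∀ x, v t x =ᵐ[P] u t x := by
  have hfin := hK.finite
  have hac := hK.a_cont
  have hrc := hK.r_cont
  -- Joint measurability is given on [0,T] only; composing with the projection onto [0,T] extends it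
  -- to all times without changing the fields there.
  have hext : ∀ w : ℝ → Space d → Ω → ℝ,
      (Measurable fun z : Icc (0 : ℝ) T × Space d × Ω => w z.1 z.2.1 z.2.2) →
      Measurable fun z : (ℝ × Space d) × Ω => w (projIcc 0 T hT.le z.1.1) z.1.2 z.2 := by
    intro w hw
    have h1 : Measurable fun z : (ℝ × Space d) × Ω => (projIcc 0 T hT.le z.1.1, z.1.2, z.2) := by
      have := (continuous_projIcc (h := hT.le)).measurable
      fun_prop
    exact hw.comp h1
  have hum := hext u hu.jointlyMeasurable
  have hvm := hext v hv.jointlyMeasurable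
  have hproj : ∀ t ∈ Icc 0 T, ((projIcc 0 T hT.le t : Icc 0 T) : ℝ) = t := fun t ht => by
    rw [projIcc_of_mem hT.le ht]
  have hsec : ∀ w : (ℝ × Space d) × Ω → ℝ, Measurable w → ∀ ω,
      Measurable (Function.uncurry fun s y => w ((s, y), ω)) := fun w hw ω =>
    hw.comp (measurable_id.prodMk measurable_const)
  set D : (ℝ × Space d) × Ω → ℝ≥0∞ := fun z =>
    ‖u (projIcc 0 T hT.le z.1.1) z.1.2 z.2 - v (projIcc 0 T hT.le z.1.1) z.1.2 z.2‖ₑ with hD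
  have hDm : Measurable D := (hum.sub hvm).enorm
  have hmom : ∀ w : ℝ → Space d → Ω → ℝ, (∀ t ∈ Icc 0 T, ∀ x, Measurable (w t x)) →
      ∀ t ∈ Icc 0 T, ∀ x, ∫⁻ ω, ‖w t x ω‖ₑ ∂P ≤
        1 + ⨆ t ∈ Icc (0 : ℝ) T, ⨆ x, ∫⁻ ω, ‖w t x ω‖ₑ ^ p ∂P := by
    intro w hw t ht x
    calc ∫⁻ ω, ‖w t x ω‖ₑ ∂P ≤ ∫⁻ ω, (1 + ‖w t x ω‖ₑ ^ p) ∂P :=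
          lintegral_mono fun ω => le_one_add_rpow (by linarith) _
      _ = 1 + ∫⁻ ω, ‖w t x ω‖ₑ ^ p ∂P := by
          rw [lintegral_add_left measurable_const]; simp
      _ ≤ _ := by gcongr; exact le_iSup₂_of_le t ht (le_iSup_of_le x le_rfl)
  have hslice : ∀ w : ℝ → Space d → Ω → ℝ,
      (Measurable fun z : Icc (0 : ℝ) T × Space d × Ω => w z.1 z.2.1 z.2.2) →
      ∀ t ∈ Icc 0 T, ∀ x, Measurable (w t x) := fun w hw t ht x =>
    hw.comp (f := fun ω => ((⟨t, ht⟩ : Icc 0 T), x, ω)) (by fun_prop)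
  have hum' := hslice u hu.jointlyMeasurable
  have hvm' := hslice v hv.jointlyMeasurable
  have key := eq_zero_of_le_volterra hK hT (K := K)
    (φ := fun t x => ∫⁻ ω, D ((t, x), ω) ∂P)
    (C := (1 + ⨆ t ∈ Icc (0 : ℝ) T, ⨆ x, ∫⁻ ω, ‖u t x ω‖ₑ ^ p ∂P) +
      (1 + ⨆ t ∈ Icc (0 : ℝ) T, ⨆ x, ∫⁻ ω, ‖v t x ω‖ₑ ^ p ∂P))
    (ENNReal.add_ne_top.2 ⟨ENNReal.add_ne_top.2 ⟨ENNReal.one_ne_top, hup.ne⟩,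
      ENNReal.add_ne_top.2 ⟨ENNReal.one_ne_top, hvp.ne⟩⟩) ?_ ?_
  · intro t ht x
    have h0 := key t ht x
    simp only [hD, hproj t ht] at h0
    have hm : Measurable fun ω => ‖u t x ω - v t x ω‖ₑ := ((hum' t ht x).sub (hvm' t ht x)).enorm
    rw [lintegral_eq_zero_iff hm] at h0
    filter_upwards [h0] with ω hω
    have : u t x ω - v t x ω = 0 := by simpa using hω
    linarith
  · intro t ht x
    simp only [hD, hproj t ht]
    calc ∫⁻ ω, ‖u t x ω - v t x ω‖ₑ ∂P ≤ ∫⁻ ω, (‖u t x ω‖ₑ + ‖v t x ω‖ₑ) ∂P :=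
          lintegral_mono fun ω => enorm_sub_le
      _ = ∫⁻ ω, ‖u t x ω‖ₑ ∂P + ∫⁻ ω, ‖v t x ω‖ₑ ∂P :=
          lintegral_add_left (hum' t ht x).enorm _
      _ ≤ _ := add_le_add (hmom u hum' t ht x) (hmom v hvm' t ht x)
  · intro t ht x
    obtain ⟨Z, hZ, hZu⟩ := hu.mild t ht x
    obtain ⟨Z', hZ', hZv⟩ := hv.mild t ht x
    rw [convolutionIntegrand_eq hK] at hZ hZ'
    have hZZ := hZ.ae_eq hW h (memLp_convFourier hK h ht.2 x) hZ'
    have hpath : ∀ᵐ ω ∂P, D ((t, x), ω) ≤ K *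
        ∫⁻ p, (Ioo 0 t ×ˢ univ : Set (ℝ × Space d)).indicator
          (fun p => ENNReal.ofReal (a (t - p.1)) * D ((p.1, x - r (t - p.1) • p.2), ω)) p
          ∂((volume : Measure ℝ).prod (fundSol eq d 1)) := by
      have hcongr : ∀ (w : ℝ → Space d → Ω → ℝ) (ω : Ω), EqOn
          (fun s => ∫⁻ y, ‖b (w s (x - y) ω)‖ₑ ∂(fundSol eq d (t - s)))
          (fun s => ∫⁻ y, ‖b (w (projIcc 0 T hT.le s) (x - y) ω)‖ₑ ∂(fundSol eq d (t - s)))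
          (Ioo 0 t) := fun w ω s hs => by
        simp only [hproj s ⟨hs.1.le, hs.2.le.trans ht.2⟩]
      have hcongr' : ∀ (w : ℝ → Space d → Ω → ℝ) (ω : Ω), EqOn
          (fun s => ∫ y, b (w s (x - y) ω) ∂(fundSol eq d (t - s)))
          (fun s => ∫ y, b (w (projIcc 0 T hT.le s) (x - y) ω) ∂(fundSol eq d (t - s)))
          (Ioo 0 t) := fun w ω s hs => by
        simp only [hproj s ⟨hs.1.le, hs.2.le.trans ht.2⟩]
      filter_upwards [hZu, hZv, hZZ, hu.driftFinite t ht x, hv.driftFinite t ht x]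
        with ω h1 h2 h3 h4 h5
      rw [setLIntegral_congr_fun measurableSet_Ioo (hcongr u ω)] at h4
      rw [setLIntegral_congr_fun measurableSet_Ioo (hcongr v ω)] at h5
      rw [setIntegral_congr_fun measurableSet_Ioo (hcongr' u ω)] at h1
      rw [setIntegral_congr_fun measurableSet_Ioo (hcongr' v ω)] at h2
      have hbu := hsec _ (hb.continuous.measurable.comp hum) ω
      have hbv := hsec _ (hb.continuous.measurable.comp hvm) ω
      have h6 := enorm_drift_sub_le hK x hbu hbv h4 h5
      have h7 : D ((t, x), ω) = ‖(∫ s in Ioo (0 : ℝ) t, ∫ y,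
            b (u (projIcc 0 T hT.le s) (x - y) ω) ∂(fundSol eq d (t - s))) -
          ∫ s in Ioo (0 : ℝ) t, ∫ y,
            b (v (projIcc 0 T hT.le s) (x - y) ω) ∂(fundSol eq d (t - s))‖ₑ := by
        simp only [hD, hproj t ht, h1, h2, h3]
        congr 1; ring
      rw [h7]
      refine h6.trans ?_
      have hDω : Measurable (Function.uncurry fun s y => D ((s, y), ω)) :=
        hDm.comp (measurable_id.prodMk measurable_const)
      rw [← hK.lintegral_drift x hDω, ← lintegral_const_mul' _ _ ENNReal.coe_ne_top]
      refine lintegral_mono fun s => ?_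
      rw [← lintegral_const_mul' _ _ ENNReal.coe_ne_top]
      refine lintegral_mono fun y => ?_
      have := hb.edist_le_mul (u (projIcc 0 T hT.le s) (x - y) ω) (v (projIcc 0 T hT.le s) (x - y) ω)
      rwa [edist_eq_enorm_sub, edist_eq_enorm_sub] at this
    refine (lintegral_mono_ae hpath).trans ?_
    have hsh : Measurable fun w : (ℝ × Space d) × Ω =>
        ((w.1.1, x - r (t - w.1.1) • w.1.2), w.2) := by
      have : Continuous fun p : ℝ × Space d => (p.1, x - r (t - p.1) • p.2) := by fun_prop
      exact (this.measurable.comp measurable_fst).prodMk measurable_snd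
    have hm1 : Measurable fun w : (ℝ × Space d) × Ω =>
        ENNReal.ofReal (a (t - w.1.1)) * D ((w.1.1, x - r (t - w.1.1) • w.1.2), w.2) :=
      Measurable.mul (by fun_prop) (hDm.comp hsh)
    have hm2 : Measurable fun w : (ℝ × Space d) × Ω =>
        (Ioo 0 t ×ˢ univ : Set (ℝ × Space d)).indicator
          (fun p => ENNReal.ofReal (a (t - p.1)) * D ((p.1, x - r (t - p.1) • p.2), w.2)) w.1 :=
      hm1.indicator ((measurableSet_Ioo.prod MeasurableSet.univ).preimage measurable_fst :
        MeasurableSet (Prod.fst ⁻¹' (Ioo 0 t ×ˢ univ)))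
    rw [lintegral_const_mul' _ _ ENNReal.coe_ne_top, lintegral_lintegral_swap
      (f := fun ω p => (Ioo 0 t ×ˢ univ : Set (ℝ × Space d)).indicator
        (fun p => ENNReal.ofReal (a (t - p.1)) * D ((p.1, x - r (t - p.1) • p.2), ω)) p)
      (hm2.comp measurable_swap).aemeasurable]
    gcongr with p
    by_cases hp : p ∈ (Ioo 0 t ×ˢ univ : Set (ℝ × Space d))
    · simp only [indicator_of_mem hp]
      rw [lintegral_const_mul' _ _ ENNReal.ofReal_ne_top]
    · simp only [indicator_of_notMem hp, lintegral_zero, le_refl]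

end Uniqueness

/-! ### Weighted averages and their continuity -/

section Average

variable {d : ℕ} {f k : Space d → ℝ} {q q' : ℝ≥0∞}

/-- The weighted average of `f` around `x` at scale `r`. -/
def kernelAvg (k f : Space d → ℝ) (z : ℝ × Space d) : ℝ :=
  ∫ y, k y * f (z.2 - z.1 • y)

lemma map_affine {r : ℝ} (hr : 0 < r) (x : Space d) :
    (volume : Measure (Space d)).map (fun y => x - r • y) =
      ENNReal.ofReal ((r ^ d)⁻¹) • volume := by
  have h1 : (fun y : Space d => x - r • y) = (fun y => x - y) ∘ fun y => r • y := rfl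
  have h2 := (Measure.measurePreserving_sub_left (volume : Measure (Space d)) x).map_eq
  rw [h1, ← Measure.map_map (by fun_prop) (by fun_prop), Measure.map_addHaar_smul _ hr.ne',
    Measure.map_smul, h2, finrank_euclideanSpace, Fintype.card_fin, abs_of_pos (by positivity)]

lemma aestronglyMeasurable_comp_affine (hf : AEStronglyMeasurable f volume) {r : ℝ} (hr : 0 < r)
    (x : Space d) : AEStronglyMeasurable (fun y => f (x - r • y)) volume := by
  have h1 : AEStronglyMeasurable f ((volume : Measure (Space d)).map (fun y => x - r • y)) := by
    rw [map_affine hr]; exact hf.smul_measure _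
  exact h1.comp_measurable (by fun_prop)

lemma eLpNorm_comp_affine (hf : AEStronglyMeasurable f volume) {r : ℝ} (hr : 0 < r)
    (x : Space d) : eLpNorm (fun y => f (x - r • y)) q volume =
      ENNReal.ofReal ((r ^ d)⁻¹) ^ (1 / q).toReal * eLpNorm f q volume := by
  have h1 : AEStronglyMeasurable f ((volume : Measure (Space d)).map (fun y => x - r • y)) := by
    rw [map_affine hr]; exact hf.smul_measure _
  have h2 := eLpNorm_map_measure (p := q) h1 (by fun_prop)
  rw [map_affine hr, eLpNorm_smul_measure_of_ne_zero (by positivity), smul_eq_mul] at h2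
  exact h2.symm

lemma memLp_comp_affine (hf : MemLp f q volume) {r : ℝ} (hr : 0 < r) (x : Space d) :
    MemLp (fun y => f (x - r • y)) q volume := by
  refine ⟨aestronglyMeasurable_comp_affine hf.1 hr x, ?_⟩
  rw [eLpNorm_comp_affine hf.1 hr]
  exact ENNReal.mul_lt_top (ENNReal.rpow_lt_top_of_nonneg ENNReal.toReal_nonneg
    ENNReal.ofReal_ne_top) hf.2

/-- Hölder's inequality; the dilation by r costs the factor r^{-d/q}. -/
lemma enorm_kernelAvg_le [ENNReal.HolderConjugate q' q] (hk : AEStronglyMeasurable k volume)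
    (hf : AEStronglyMeasurable f volume) {r : ℝ} (hr : 0 < r) (x : Space d) :
    ‖kernelAvg k f (r, x)‖ₑ ≤ eLpNorm k q' volume *
      (ENNReal.ofReal ((r ^ d)⁻¹) ^ (1 / q).toReal * eLpNorm f q volume) := by
  rw [← eLpNorm_comp_affine hf hr x]
  refine (enorm_integral_le_lintegral_enorm _).trans ?_
  rw [← eLpNorm_one_eq_lintegral_enorm]
  change eLpNorm (k • fun y => f (x - r • y)) 1 volume ≤ _
  exact eLpNorm_smul_le_mul_eLpNorm (p := q') (q := q) (r := 1)
    (aestronglyMeasurable_comp_affine hf hr x) hk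

/-- A change of variables moves the dependence on z from f, which is only locally integrable, into
the continuous kernel. -/
lemma continuousAt_kernelAvg_of_compact (hk : Continuous k) (hkc : HasCompactSupport k)
    (hf : LocallyIntegrable f volume) {z₀ : ℝ × Space d} (hz₀ : 0 < z₀.1) :
    ContinuousAt (kernelAvg k f) z₀ := by
  obtain ⟨R, hR⟩ := hkc.isCompact.isBounded.exists_norm_le
  obtain ⟨B, hB⟩ := hkc.exists_bound_of_continuous hk
  have hB0 : 0 ≤ B := (norm_nonneg _).trans (hB 0)
  have hpos : ∀ᶠ z in 𝓝 z₀, 0 < z.1 := (continuous_fst.tendsto z₀).eventually (lt_mem_nhds hz₀)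
  have heq : ∀ᶠ z in 𝓝 z₀, (z.1 ^ d)⁻¹ * ∫ y, k (z.1⁻¹ • (z.2 - y)) * f y = kernelAvg k f z := by
    filter_upwards [hpos] with z hz
    have h1 := Measure.integral_comp_smul (volume : Measure (Space d))
      (fun w => k (z.1⁻¹ • w) * f (z.2 - w)) z.1
    rw [finrank_euclideanSpace, Fintype.card_fin, abs_of_pos (by positivity), smul_eq_mul,
      ← integral_sub_left_eq_self (fun w => k (z.1⁻¹ • w) * f (z.2 - w)) volume z.2] at h1
    simp only [smul_smul, inv_mul_cancel₀ hz.ne', one_smul, sub_sub_cancel] at h1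
    exact h1.symm
  refine ContinuousAt.congr ?_ heq
  refine ContinuousAt.mul (by fun_prop (disch := positivity)) ?_
  set ρ := ‖z₀.2‖ + 1 + 2 * z₀.1 * |R| with hρ
  refine continuousAt_of_dominated (bound := (Metric.closedBall 0 ρ).indicator fun y => B * ‖f y‖)
    ?_ ?_ ?_ ?_
  · filter_upwards with z
    exact ((by fun_prop : Continuous fun y => k (z.1⁻¹ • (z.2 - y))).aestronglyMeasurable).mul
      hf.aestronglyMeasurable
  · have h1 : ∀ᶠ z in 𝓝 z₀, z.1 < 2 * z₀.1 :=
      (continuous_fst.tendsto z₀).eventually (gt_mem_nhds (by linarith))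
    have h2 : ∀ᶠ z in 𝓝 z₀, ‖z.2‖ < ‖z₀.2‖ + 1 :=
      ((continuous_norm.comp continuous_snd).tendsto z₀).eventually (gt_mem_nhds (by simp))
    filter_upwards [hpos, h1, h2] with z h0 h1 h2
    refine Eventually.of_forall fun y => ?_
    by_cases hy : y ∈ Metric.closedBall (0 : Space d) ρ
    · rw [indicator_of_mem hy, norm_mul]
      exact mul_le_mul_of_nonneg_right (hB _) (norm_nonneg _)
    · rw [indicator_of_notMem hy]
      have hk0 : k (z.1⁻¹ • (z.2 - y)) = 0 := by
        by_contra hne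
        have h3 := hR _ (subset_tsupport _ hne)
        rw [norm_smul, norm_inv, Real.norm_eq_abs, abs_of_pos h0, inv_mul_le_iff₀ h0] at h3
        refine hy (mem_closedBall_zero_iff.2 ?_)
        have h4 : ‖y‖ ≤ ‖z.2‖ + ‖z.2 - y‖ := by
          have := norm_sub_le z.2 (z.2 - y)
          rwa [sub_sub_cancel] at this
        have h5 : z.1 * R ≤ 2 * z₀.1 * |R| :=
          (mul_le_mul_of_nonneg_left (le_abs_self R) h0.le).trans
            (mul_le_mul_of_nonneg_right h1.le (abs_nonneg R))
        linarith
      rw [hk0, zero_mul, norm_zero]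
  · rw [integrable_indicator_iff Metric.isClosed_closedBall.measurableSet]
    exact ((hf.integrableOn_isCompact (isCompact_closedBall 0 ρ)).norm.const_mul B)
  · refine Eventually.of_forall fun y => ?_
    have : ContinuousAt (fun z : ℝ × Space d => z.1⁻¹ • (z.2 - y)) z₀ := by
      fun_prop (disch := positivity)
    exact (hk.continuousAt.comp this).mul continuousAt_const

/-- Compactly supported continuous kernels are dense in L^{q'} as q' is finite. On scales above
z₀.1/2 the Hölder bound is uniform, so such kernels approximate the average locally uniformly. -/
lemma continuousAt_kernelAvg [hqq : ENNReal.HolderConjugate q' q] (hq' : q' ≠ ∞)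
    (hk : MemLp k q' volume)
    (hf : MemLp f q volume) {z₀ : ℝ × Space d} (hz₀ : 0 < z₀.1) :
    ContinuousAt (kernelAvg k f) z₀ := by
  have hq1 : 1 ≤ q := by
    have : ENNReal.HolderConjugate q q' := hqq.symm
    exact ENNReal.HolderConjugate.one_le q q'
  refine continuousAt_of_locally_uniform_approx_of_continuousAt fun u hu => ?_
  obtain ⟨ε, hε, hεu⟩ := Metric.mem_uniformity_dist.1 hu
  set c := ENNReal.ofReal (((z₀.1 / 2) ^ d)⁻¹) ^ (1 / q).toReal * eLpNorm f q volume with hc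
  have hcfin : c ≠ ∞ := (ENNReal.mul_lt_top (ENNReal.rpow_lt_top_of_nonneg ENNReal.toReal_nonneg
    ENNReal.ofReal_ne_top) hf.2).ne
  obtain ⟨δ, hδ, hδc⟩ := ENNReal.exists_nnreal_pos_mul_lt hcfin
    (ENNReal.ofReal_pos.2 hε).ne'
  obtain ⟨k', hk'c, hkk', hk'cont, hk'm⟩ := hk.exists_hasCompactSupport_eLpNorm_sub_le hq'
    (ε := δ) (by simpa using hδ.ne')
  refine ⟨{z | z₀.1 / 2 < z.1}, (continuous_fst.tendsto z₀).eventually (lt_mem_nhds (by linarith)),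
    kernelAvg k' f, continuousAt_kernelAvg_of_compact hk'cont hk'c (hf.locallyIntegrable hq1) hz₀,
    fun z hz => hεu ?_⟩
  have hzh : z₀.1 / 2 < z.1 := hz
  have hz0 : 0 < z.1 := by linarith
  have hfz := memLp_comp_affine hf hz0 z.2
  have h1 : kernelAvg k f z - kernelAvg k' f z = kernelAvg (k - k') f z := by
    have h2 := integral_sub (hk.integrable_mul hfz) (hk'm.integrable_mul hfz)
    simp only [Pi.mul_apply] at h2
    rw [kernelAvg, kernelAvg, kernelAvg, ← h2]
    simp only [Pi.sub_apply, sub_mul]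
  rw [dist_eq_norm, h1, ← ENNReal.ofReal_lt_ofReal_iff hε, ofReal_norm]
  refine lt_of_le_of_lt ?_ hδc
  refine (enorm_kernelAvg_le (q' := q') (q := q) (hk.1.sub hk'm.1) hf.1 hz0 z.2).trans (mul_le_mul' hkk' ?_)
  rw [hc]
  gcongr

lemma integral_withDensity_eq_kernelAvg {κ : Space d → ℝ≥0∞} (hκ : Measurable κ)
    (hκf : ∀ᵐ y, κ y < ∞) (z : ℝ × Space d) :
    ∫ y, f (z.2 - z.1 • y) ∂(volume.withDensity κ) = kernelAvg (fun y => (κ y).toReal) f z :=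
  integral_withDensity_eq_integral_toReal_smul hκ hκf _

end Average

/-! ### The deterministic term of the heat equation -/

section Heat

variable {d : ℕ}

/-- The total mass is the Fourier transform at frequency 0. -/
lemma measureReal_fundSol_eq_one {eq : Eqn} {T : ℝ} {a r : ℝ → ℝ} {g gb : ℝ → ℝ → ℝ}
    (hK : IsScalingKernel eq d T a r g gb) (hg : g 1 0 = 1) : (fundSol eq d 1).real univ = 1 := by
  have h1 := hK.fourier 1 one_pos 0
  simp only [fourierMeas, inner_zero_left, norm_zero, hg, Complex.ofReal_zero, mul_zero, neg_zero,
    Complex.exp_zero, integral_const, Complex.real_smul, mul_one, Complex.ofReal_one] at h1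
  exact_mod_cast h1

lemma initialTerm_heat {u₀ v₀ : Space d → ℝ} (hu : Measurable u₀) {t : ℝ} (ht : 0 ≤ t)
    (x : Space d) : initialTerm .heat u₀ v₀ t x =
      ∫ y, u₀ (x - Real.sqrt t • y) ∂(fundSol .heat d 1) := by
  rcases ht.eq_or_lt with rfl | ht
  · simp [initialTerm, measureReal_fundSol_eq_one (isScalingKernel_heat (T := 1) (d := d))]
  · rw [initialTerm, if_neg ht.not_ge]
    simp only [convG]
    rw [(isScalingKernel_heat (T := 1) (d := d)).integral_fundSol ht
      (f := fun y => u₀ (x - y)) (by fun_prop), one_mul]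

/-- At t = 0 dominated convergence applies at continuity points of u₀. At t > 0 averaging a bounded
function against the integrable Gaussian density is continuous, with exponents (1, ∞), whatever the
regularity of u₀. -/
theorem isRegularInitial_heat {u₀ v₀ : Space d → ℝ} (h : InitialDataHyp .heat d u₀ v₀) (T : ℝ) :
    IsRegularInitial .heat u₀ v₀ T := by
  obtain ⟨hu, C, hC'⟩ := h
  have hC : ∀ x, ‖u₀ x‖ ≤ C := hC'
  have hfin := isFiniteMeasure_heat (d := d) one_pos
  have hmass := measureReal_fundSol_eq_one (isScalingKernel_heat (T := 1) (d := d)) (by simp)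
  refine ⟨hu, ⟨C, fun t ht x => ?_⟩, fun t ht x hc => ?_⟩
  · rw [initialTerm_heat hu ht.1]
    refine (norm_integral_le_of_norm_le_const (C := C)
      (Eventually.of_forall fun y => hC _)).trans ?_
    rw [hmass, mul_one]
  · have heq : EqOn (Function.uncurry (initialTerm .heat u₀ v₀))
        (fun z => ∫ y, u₀ (z.2 - Real.sqrt z.1 • y) ∂(fundSol .heat d 1)) (Icc 0 T ×ˢ univ) :=
      fun z hz => initialTerm_heat hu hz.1.1 z.2
    refine ContinuousWithinAt.congr ?_ heq (heq ⟨ht, trivial⟩)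
    refine ContinuousAt.continuousWithinAt ?_
    rcases ht.1.eq_or_lt with rfl | ht0
    · have hc0 : ContinuousAt u₀ x := hc.resolve_left (lt_irrefl _)
      refine continuousAt_of_dominated (bound := fun _ => C) (Eventually.of_forall fun z => ?_)
        (Eventually.of_forall fun z => Eventually.of_forall fun y => hC _) (integrable_const _)
        (Eventually.of_forall fun y => ?_)
      · exact (hu.comp (by fun_prop)).aestronglyMeasurable
      · refine ContinuousAt.comp (g := u₀) (f := fun z : ℝ × Space d => z.2 - Real.sqrt z.1 • y) ?_
          (by fun_prop)
        simpa using hc0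
    · set κ : Space d → ℝ := fun x =>
        1 / (2 * Real.pi * 1) ^ ((d : ℝ) / 2) * Real.exp (-(‖x‖ ^ 2 / (2 * 1))) with hκ
      have hκ0 : ∀ y, 0 ≤ κ y := fun y => by positivity
      have hκi : Integrable κ := (integrable_gaussian one_pos).const_mul _
      have hκm : Measurable fun y => ENNReal.ofReal (κ y) := by fun_prop
      have h1 : (fun z : ℝ × Space d => ∫ y, u₀ (z.2 - Real.sqrt z.1 • y) ∂(fundSol .heat d 1)) =
          fun z => kernelAvg κ u₀ (Real.sqrt z.1, z.2) := by
        ext z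
        have := integral_withDensity_eq_kernelAvg (f := u₀) hκm
          (Eventually.of_forall fun y => ENNReal.ofReal_lt_top) (Real.sqrt z.1, z.2)
        simp only [ENNReal.toReal_ofReal (hκ0 _)] at this
        exact this
      rw [h1]
      have hinst : ENNReal.HolderConjugate 1 ∞ := inferInstance
      refine ContinuousAt.comp (g := kernelAvg κ u₀)
        (f := fun z : ℝ × Space d => (Real.sqrt z.1, z.2)) ?_ (by fun_prop)
      exact continuousAt_kernelAvg (q' := 1) (q := ∞) ENNReal.one_ne_top
        (memLp_one_iff_integrable.2 hκi)
        (memLp_top_of_bound hu.aestronglyMeasurable C (Eventually.of_forall hC))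
        (Real.sqrt_pos.2 ht0)

end Heat

/-! ### Means over the unit ball or sphere -/

section SphericalMean

variable {d : ℕ} {ν : Measure (Space d)} [IsFiniteMeasure ν]

lemma continuous_integral_of_bounded_support {X E : Type*} [TopologicalSpace X]
    [FirstCountableTopology X] [LocallyCompactSpace X] [NormedAddCommGroup E] [NormedSpace ℝ E]
    (hν : ∀ᵐ y ∂ν, ‖y‖ ≤ 1) {F : X → Space d → E} (hF : Continuous (Function.uncurry F)) :
    Continuous fun z => ∫ y, F z y ∂ν := by
  have h1 : ν.restrict (Metric.closedBall 0 1) = ν :=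
    Measure.restrict_eq_self_of_ae_mem (hν.mono fun y hy => mem_closedBall_zero_iff.2 hy)
  have h2 := continuous_parametric_integral_of_continuous (μ := ν) hF
    (isCompact_closedBall (0 : Space d) 1)
  rwa [h1] at h2

/-- The mean `∫ u(x - t y) ν(dy)` differentiated as `d/dt (t · mean)`. -/
def waveTerm (ν : Measure (Space d)) (u : Space d → ℝ) (z : ℝ × Space d) : ℝ :=
  (∫ y, u (z.2 - z.1 • y) ∂ν) - z.1 * ∫ y, fderiv ℝ u (z.2 - z.1 • y) y ∂ν

lemma continuous_mean (hν : ∀ᵐ y ∂ν, ‖y‖ ≤ 1) {u : Space d → ℝ} (hu : Continuous u) :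
    Continuous fun z : ℝ × Space d => ∫ y, u (z.2 - z.1 • y) ∂ν :=
  continuous_integral_of_bounded_support (F := fun (z : ℝ × Space d) y => u (z.2 - z.1 • y)) hν
    (by simp only [Function.uncurry_def]; fun_prop)

lemma continuous_fderiv_comp {u : Space d → ℝ} (hu : ContDiff ℝ 1 u) :
    Continuous fun w : (ℝ × Space d) × Space d => fderiv ℝ u (w.1.2 - w.1.1 • w.2) w.2 :=
  ((hu.continuous_fderiv one_ne_zero).comp (by fun_prop)).clm_apply continuous_snd

lemma continuous_waveTerm (hν : ∀ᵐ y ∂ν, ‖y‖ ≤ 1) {u : Space d → ℝ} (hu : ContDiff ℝ 1 u) :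
    Continuous (waveTerm ν u) :=
  (continuous_mean hν hu.continuous).sub (continuous_fst.mul
    (continuous_integral_of_bounded_support
      (F := fun (z : ℝ × Space d) y => fderiv ℝ u (z.2 - z.1 • y) y) hν
      (continuous_fderiv_comp hu)))

/-- As ν is carried by the unit ball, only a compact set of points x - τy occurs for τ near t; the
derivative of u is bounded there, which justifies differentiating under the integral. -/
lemma hasDerivAt_mean (hν : ∀ᵐ y ∂ν, ‖y‖ ≤ 1) {u : Space d → ℝ} (hu : ContDiff ℝ 1 u) (t : ℝ)
    (x : Space d) : HasDerivAt (fun τ => ∫ y, u (x - τ • y) ∂ν)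
      (-∫ y, fderiv ℝ u (x - t • y) y ∂ν) t := by
  have hc : Continuous fun w : ℝ × Space d => fderiv ℝ u (x - w.1 • w.2) w.2 :=
    (continuous_fderiv_comp hu).comp (f := fun w : ℝ × Space d => ((w.1, x), w.2)) (by fun_prop)
  obtain ⟨B, hB⟩ := ((isCompact_closedBall t 1).prod
    (isCompact_closedBall (0 : Space d) 1)).exists_bound_of_continuousOn hc.continuousOn
  obtain ⟨B', hB'⟩ := (isCompact_closedBall (0 : Space d) 1).exists_bound_of_continuousOn
    (f := fun y => u (x - t • y)) (hu.continuous.comp (by fun_prop)).continuousOn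
  rw [← integral_neg]
  refine (hasDerivAt_integral_of_dominated_loc_of_deriv_le (bound := fun _ => B)
    (F' := fun τ y => -fderiv ℝ u (x - τ • y) y)
    (Metric.closedBall_mem_nhds t one_pos) (Eventually.of_forall fun τ => ?_) ?_ ?_ ?_
    (integrable_const B) ?_).2
  · exact (hu.continuous.comp (by fun_prop)).aestronglyMeasurable
  · refine (integrable_const B').mono' (hu.continuous.comp (by fun_prop)).aestronglyMeasurable ?_
    filter_upwards [hν] with y hy
    exact hB' y (mem_closedBall_zero_iff.2 hy)
  · exact ((hc.comp (f := fun y => (t, y)) (by fun_prop)).neg).aestronglyMeasurable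
  · filter_upwards [hν] with y hy τ hτ
    rw [norm_neg]
    exact hB (τ, y) ⟨hτ, mem_closedBall_zero_iff.2 hy⟩
  · refine Eventually.of_forall fun y τ _ => ?_
    have h1 : HasDerivAt (fun τ : ℝ => x - τ • y) (-y) τ := by
      simpa using ((hasDerivAt_id τ).smul_const y).const_sub x
    have h2 := ((hu.differentiable one_ne_zero).differentiableAt.hasFDerivAt
      (x := x - τ • y)).comp_hasDerivAt τ h1
    exact h2.congr_deriv (by simp)

end SphericalMean

/-! ### The deterministic term of the wave equation for C¹ data; dimension three -/

section WaveTerms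

variable {d : ℕ} {T : ℝ} {g gb : ℝ → ℝ → ℝ}

lemma convG_wave (hK : IsScalingKernel .wave d T id id g gb) {f : Space d → ℝ} (hf : Measurable f)
    {t : ℝ} (ht : 0 < t) (x : Space d) :
    convG .wave f t x = t * ∫ y, f (x - t • y) ∂(fundSol .wave d 1) :=
  hK.integral_fundSol ht (f := fun y => f (x - y)) (by fun_prop)

lemma deriv_convG_wave (hK : IsScalingKernel .wave d T id id g gb)
    (hν : ∀ᵐ y ∂(fundSol .wave d 1), ‖y‖ ≤ 1) {u : Space d → ℝ} (hu : ContDiff ℝ 1 u) {t : ℝ}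
    (ht : 0 < t) (x : Space d) :
    deriv (fun τ => convG .wave u τ x) t = waveTerm (fundSol .wave d 1) u (t, x) := by
  have := hK.finite
  have h1 : (fun τ => convG .wave u τ x) =ᶠ[𝓝 t]
      fun τ => τ * ∫ y, u (x - τ • y) ∂(fundSol .wave d 1) := by
    filter_upwards [lt_mem_nhds ht] with τ hτ
    exact convG_wave hK hu.continuous.measurable hτ x
  have h2 : HasDerivAt (fun τ => τ * ∫ y, u (x - τ • y) ∂(fundSol .wave d 1)) _ t :=
    (hasDerivAt_id t).mul (hasDerivAt_mean hν hu t x)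
  rw [h1.deriv_eq, h2.deriv]
  simp only [waveTerm, id, one_mul, mul_neg, sub_eq_add_neg]

/-- u * G_t is t times a mean, whose t-derivative is `waveTerm`. At t = 0 the formula reduces to
u(x) because G_1 has mass one, so a single expression covers all t ≥ 0. -/
lemma initialTerm_wave (hK : IsScalingKernel .wave d T id id g gb) (hg : g 1 0 = 1)
    (hν : ∀ᵐ y ∂(fundSol .wave d 1), ‖y‖ ≤ 1) {u v : Space d → ℝ} (hu : ContDiff ℝ 1 u)
    (hv : Measurable v) {t : ℝ} (ht : 0 ≤ t) (x : Space d) :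
    initialTerm .wave u v t x = t * (∫ y, v (x - t • y) ∂(fundSol .wave d 1)) +
      waveTerm (fundSol .wave d 1) u (t, x) := by
  rcases ht.eq_or_lt with rfl | ht
  · simp [initialTerm, waveTerm, measureReal_fundSol_eq_one hK hg]
  · rw [initialTerm, if_neg ht.not_ge, convG_wave hK hv ht, deriv_convG_wave hK hν hu ht]

lemma norm_gradient_eq (u : Space d → ℝ) (x : Space d) : ‖gradient u x‖ = ‖fderiv ℝ u x‖ := by
  simp [gradient]

theorem isRegularInitial_wave_three {u₀ v₀ : Space 3 → ℝ} (h : InitialDataHyp .wave 3 u₀ v₀)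
    (hT : 0 < T) : IsRegularInitial .wave u₀ v₀ T := by
  obtain ⟨hu, ⟨C₁, hC₁⟩, ⟨C₂, hC₂⟩, hv, C₃, hC₃⟩ := h
  have hK := isScalingKernel_wave (d := 3) (by norm_num) le_rfl hT
  have hg : waveFourier 1 0 = 1 := by simp [waveFourier]
  have hfin := hK.finite
  have hmass := measureReal_fundSol_eq_one hK hg
  have hν : ∀ᵐ y ∂(fundSol .wave 3 1), ‖y‖ ≤ 1 := by
    refine Measure.ae_smul_measure ?_ _
    refine Measure.ae_smul_measure ?_ _
    rw [ae_map_iff (by fun_prop) (measurableSet_le (by fun_prop) (by fun_prop))]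
    refine Eventually.of_forall fun y => ?_
    simp
  have hJ := fun t ht x => initialTerm_wave hK hg hν hu hv.measurable (t := t) ht x
  refine ⟨hu.continuous.measurable, ⟨T * C₃ + (C₁ + T * C₂), fun t ht x => ?_⟩, fun t ht x _ => ?_⟩
  · have hb : ∀ (f : Space 3 → ℝ) (C : ℝ), (∀ᵐ y ∂(fundSol .wave 3 1), ‖f y‖ ≤ C) →
        |∫ y, f y ∂(fundSol .wave 3 1)| ≤ C := fun f C hf => by
      refine (norm_integral_le_of_norm_le_const hf).trans ?_
      rw [hmass, mul_one]
    have hmul : ∀ c C : ℝ, |c| ≤ C → |t * c| ≤ T * C := fun c C hc => by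
      rw [abs_mul, abs_of_nonneg ht.1]
      exact mul_le_mul ht.2 hc (abs_nonneg c) hT.le
    rw [hJ t ht.1 x, waveTerm]
    refine (abs_add_le _ _).trans (add_le_add (hmul _ _ (hb _ _ (Eventually.of_forall fun y =>
      hC₃ _))) ((abs_sub _ _).trans (add_le_add (hb _ _ (Eventually.of_forall fun y =>
      hC₁ _)) (hmul _ _ (hb _ _ ?_)))))
    filter_upwards [hν] with y hy
    refine (ContinuousLinearMap.le_opNorm _ _).trans ?_
    rw [← norm_gradient_eq]
    exact (mul_le_of_le_one_right (norm_nonneg _) hy).trans (hC₂ _)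
  · have heq : EqOn (Function.uncurry (initialTerm .wave u₀ v₀)) (fun z => z.1 *
        (∫ y, v₀ (z.2 - z.1 • y) ∂(fundSol .wave 3 1)) + waveTerm (fundSol .wave 3 1) u₀ z)
        (Icc 0 T ×ˢ univ) := fun z hz => hJ z.1 hz.1.1 z.2
    refine ContinuousWithinAt.congr ?_ heq (heq ⟨ht, trivial⟩)
    exact ((continuous_fst.mul (continuous_mean hν hv)).add
      (continuous_waveTerm hν hu)).continuousWithinAt

end WaveTerms

/-! ### Averages of L^q data near time zero -/

section SingularAverage

variable {d : ℕ} {κ : Space d → ℝ≥0∞} {q q' : ℝ≥0∞} {f : Space d → ℝ} {T : ℝ}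

lemma exists_bound_mean [ENNReal.HolderConjugate q' q] (hκ : Measurable κ)
    (hκf : ∀ᵐ y, κ y < ∞) (hk : MemLp (fun y => (κ y).toReal) q' volume) (hf : MemLp f q volume) :
    ∃ C, 0 ≤ C ∧ ∀ t, 0 < t → ∀ x, |∫ y, f (x - t • y) ∂(volume.withDensity κ)| ≤
      C * t ^ (-(d * (1 / q).toReal)) := by
  set A := (eLpNorm (fun y => (κ y).toReal) q' volume).toReal
  set B := (eLpNorm f q volume).toReal
  refine ⟨A * B, by positivity, fun t ht x => ?_⟩
  rw [integral_withDensity_eq_kernelAvg hκ hκf (t, x)]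
  have h1 := enorm_kernelAvg_le (q' := q') (q := q) hk.1 hf.1 ht x
  have h2 : eLpNorm (fun y => (κ y).toReal) q' volume *
      (ENNReal.ofReal ((t ^ d)⁻¹) ^ (1 / q).toReal * eLpNorm f q volume) =
      ENNReal.ofReal (A * B * t ^ (-(d * (1 / q).toReal))) := by
    rw [ENNReal.ofReal_mul (by positivity), ENNReal.ofReal_mul (by positivity),
      ENNReal.ofReal_toReal hk.2.ne, ENNReal.ofReal_toReal hf.2.ne,
      ENNReal.ofReal_rpow_of_pos (by positivity), Real.inv_rpow (by positivity),
      ← Real.rpow_natCast, ← Real.rpow_mul ht.le, ← Real.rpow_neg ht.le]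
    ring
  rw [h2, ← ofReal_norm] at h1
  exact (ENNReal.ofReal_le_ofReal_iff (by positivity)).1 h1

lemma abs_mul_mean_le {C s t m : ℝ} (ht : 0 ≤ t) (h : 0 < t → |m| ≤ C * t ^ (-s)) (hs : s < 1) :
    |t * m| ≤ C * t ^ (1 - s) := by
  rcases ht.eq_or_lt with rfl | ht
  · rw [zero_mul, abs_zero, Real.zero_rpow (by linarith), mul_zero]
  · rw [abs_mul, abs_of_pos ht]
    refine (mul_le_mul_of_nonneg_left (h ht) ht.le).trans_eq ?_
    rw [sub_eq_add_neg, Real.rpow_add ht, Real.rpow_one]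
    ring

/-- The mean may blow up like t^{-d/q}, but the prefactor t wins because d/q < 1. -/
lemma continuousWithinAt_mul_mean [ENNReal.HolderConjugate q' q] (hq' : q' ≠ ∞) (hκ : Measurable κ)
    (hκf : ∀ᵐ y, κ y < ∞) (hk : MemLp (fun y => (κ y).toReal) q' volume) (hf : MemLp f q volume)
    (hs : d * (1 / q).toReal < 1) {t : ℝ} (ht : 0 ≤ t) (x : Space d) :
    ContinuousWithinAt
      (fun z : ℝ × Space d => z.1 * ∫ y, f (z.2 - z.1 • y) ∂(volume.withDensity κ))
      (Ici 0 ×ˢ univ) (t, x) := by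
  rcases ht.eq_or_lt with rfl | ht
  · obtain ⟨C, hC0, hC⟩ := exists_bound_mean (q' := q') (q := q) hκ hκf hk hf
    rw [ContinuousWithinAt]
    simp only [zero_mul]
    have h1 : Tendsto (fun z : ℝ × Space d => C * z.1 ^ (1 - d * (1 / q).toReal))
        (𝓝[Ici 0 ×ˢ univ] (0, x)) (𝓝 0) := by
      have : ContinuousAt (fun z : ℝ × Space d => C * z.1 ^ (1 - d * (1 / q).toReal)) (0, x) :=
        continuousAt_const.mul (continuousAt_fst.rpow_const (Or.inr (by linarith)))
      refine (this.tendsto.mono_left nhdsWithin_le_nhds).mono_right (le_of_eq (congrArg 𝓝 ?_))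
      simp only
      rw [Real.zero_rpow (by linarith), mul_zero]
    refine squeeze_zero_norm' ?_ h1
    filter_upwards [self_mem_nhdsWithin] with z hz
    exact abs_mul_mean_le hz.1 (fun h => hC z.1 h z.2) hs
  · refine ContinuousAt.continuousWithinAt (continuousAt_fst.mul ?_)
    simp_rw [integral_withDensity_eq_kernelAvg hκ hκf]
    exact continuousAt_kernelAvg (q' := q') (q := q) hq' hk hf ht

end SingularAverage

/-! ### The deterministic term in dimension one -/

section WaveOne

variable {T : ℝ}

@[fun_prop]
lemma continuous_single_one : Continuous fun s : ℝ => (EuclideanSpace.single 0 s : Space 1) := by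
  have h1 : (fun s : ℝ => (EuclideanSpace.single 0 s : Space 1)) =
      fun s => s • EuclideanSpace.single 0 1 := by
    ext s i; fin_cases i; simp
  rw [h1]; fun_prop

lemma convG_wave_one (u : Space 1 → ℝ) {τ : ℝ} (hτ : 0 < τ) (x : Space 1) :
    convG .wave u τ x =
      (1 / 2) * ∫ s in (-τ)..τ, u (x - EuclideanSpace.single 0 s) := by
  let e := (MeasurableEquiv.toLp 2 (Fin 1 → ℝ)).symm.trans (MeasurableEquiv.funUnique (Fin 1) ℝ)
  have he : MeasurePreserving e volume volume :=
    (EuclideanSpace.volume_preserving_symm_measurableEquiv_toLp (Fin 1)).trans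
      (volume_preserving_funUnique (Fin 1) ℝ)
  have he' : ∀ y : Space 1, e y = y 0 := fun y => rfl
  have hy : ∀ y : Space 1, EuclideanSpace.single 0 (y 0) = y := fun y => by
    ext i; fin_cases i; simp
  have hball : (Metric.ball 0 τ : Set (Space 1)) = e ⁻¹' Ioo (-τ) τ := by
    ext y
    rw [mem_preimage, he', mem_ball_zero_iff, mem_Ioo, ← abs_lt, ← hy y]
    simp
  have h1 : fundSol .wave 1 τ =
      ENNReal.ofReal (1 / 2) • (volume : Measure (Space 1)).restrict (Metric.ball 0 τ) := by
    simp only [fundSol]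
    rw [withDensity_indicator Metric.isOpen_ball.measurableSet, withDensity_const]
  have h2 := he.setIntegral_preimage_emb e.measurableEmbedding
    (fun s => u (x - EuclideanSpace.single 0 s)) (Ioo (-τ) τ)
  simp only [he', hy] at h2
  rw [convG, h1, integral_smul_measure, hball, h2, ENNReal.toReal_ofReal (by norm_num),
    intervalIntegral.integral_of_le (by linarith), integral_Ioc_eq_integral_Ioo, smul_eq_mul]

/-- d'Alembert's formula: since u is merely continuous, the derivative falls on the endpoints of the
interval of integration instead of on u. -/
lemma deriv_convG_wave_one {u : Space 1 → ℝ} (hu : Continuous u) {t : ℝ} (ht : 0 < t)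
    (x : Space 1) : deriv (fun τ => convG .wave u τ x) t =
      (1 / 2) * (u (x - EuclideanSpace.single 0 t) + u (x - EuclideanSpace.single 0 (-t))) := by
  have h1 : (fun τ => convG .wave u τ x) =ᶠ[𝓝 t]
      fun τ => (1 / 2) * ∫ s in (-τ)..τ, u (x - EuclideanSpace.single 0 s) := by
    filter_upwards [lt_mem_nhds ht] with τ hτ
    exact convG_wave_one u hτ x
  rw [h1.deriv_eq, ((hasDerivAt_integral_symm
    (f := fun s => u (x - EuclideanSpace.single 0 s)) (by fun_prop) t).const_mul (1 / 2)).deriv]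

theorem isRegularInitial_wave_one {u₀ v₀ : Space 1 → ℝ} (h : InitialDataHyp .wave 1 u₀ v₀)
    (hT : 0 < T) : IsRegularInitial .wave u₀ v₀ T := by
  obtain ⟨hu, ⟨C₁, hC₁⟩, hv, C₂, hC₂⟩ := h
  have hK := isScalingKernel_wave (d := 1) le_rfl (by norm_num) hT
  have hg : waveFourier 1 0 = 1 := by simp [waveFourier]
  have hfin := hK.finite
  have hmass := measureReal_fundSol_eq_one hK hg
  have hJ : ∀ t, 0 ≤ t → ∀ x, initialTerm .wave u₀ v₀ t x =
      t * (∫ y, v₀ (x - t • y) ∂(fundSol .wave 1 1)) +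
        (1 / 2) * (u₀ (x - EuclideanSpace.single 0 t) + u₀ (x - EuclideanSpace.single 0 (-t))) := by
    intro t ht x
    rcases ht.eq_or_lt with rfl | ht
    · simp only [initialTerm, le_refl, if_true, zero_mul, neg_zero, zero_add]
      have : (EuclideanSpace.single 0 0 : Space 1) = 0 := by simp
      rw [this, sub_zero]; ring
    · rw [initialTerm, if_neg ht.not_ge, convG_wave hK hv ht, deriv_convG_wave_one hu ht]
  refine ⟨hu.measurable, ⟨T * C₂ + (1 / 2) * (C₁ + C₁), fun t ht x => ?_⟩, fun t ht x _ => ?_⟩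
  · have h1 : |∫ y, v₀ (x - t • y) ∂(fundSol .wave 1 1)| ≤ C₂ := by
      refine (norm_integral_le_of_norm_le_const (C := C₂) (f := fun y => v₀ (x - t • y))
        (Eventually.of_forall fun y => (hC₂ (x - t • y) : ‖v₀ (x - t • y)‖ ≤ C₂))).trans ?_
      rw [hmass, mul_one]
    rw [hJ t ht.1 x]
    refine (abs_add_le _ _).trans (add_le_add ?_ ?_)
    · rw [abs_mul, abs_of_nonneg ht.1]
      exact mul_le_mul ht.2 h1 (abs_nonneg _) hT.le
    · rw [abs_mul, abs_of_pos (by norm_num : (0 : ℝ) < 1 / 2)]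
      gcongr
      exact (abs_add_le _ _).trans (add_le_add (hC₁ _) (hC₁ _))
  · have heq : EqOn (Function.uncurry (initialTerm .wave u₀ v₀)) (fun z => z.1 *
        (∫ y, v₀ (z.2 - z.1 • y) ∂(fundSol .wave 1 1)) +
        (1 / 2) * (u₀ (z.2 - EuclideanSpace.single 0 z.1) +
          u₀ (z.2 - EuclideanSpace.single 0 (-z.1))))
        (Icc 0 T ×ˢ univ) := fun z hz => hJ z.1 hz.1.1 z.2
    refine ContinuousWithinAt.congr ?_ heq (heq ⟨ht, trivial⟩)
    refine ContinuousWithinAt.add ?_ (Continuous.continuousWithinAt (by fun_prop))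
    have hinst : ENNReal.HolderConjugate 1 ∞ := inferInstance
    refine (continuousWithinAt_mul_mean (q' := 1) (q := ∞) (κ := (Metric.ball 0 1).indicator
      fun _ => ENNReal.ofReal (1 / 2)) ENNReal.one_ne_top
      (measurable_const.indicator Metric.isOpen_ball.measurableSet)
      (Eventually.of_forall fun y => ?_) ?_
      (memLp_top_of_bound hv.aestronglyMeasurable C₂ (Eventually.of_forall hC₂)) (by simp)
      ht.1 x).mono (prod_mono_left Icc_subset_Ici_self)
    · exact (indicator_le_self _ _ y).trans_lt ENNReal.ofReal_lt_top
    · have h1 : (fun y : Space 1 => ((Metric.ball (0 : Space 1) 1).indicator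
          (fun _ => ENNReal.ofReal (1 / 2)) y).toReal) =
          (Metric.ball 0 1).indicator fun _ => (1 / 2 : ℝ) := by
        ext y
        by_cases hy : y ∈ Metric.ball (0 : Space 1) 1
        · rw [indicator_of_mem hy, indicator_of_mem hy, ENNReal.toReal_ofReal (by norm_num)]
        · rw [indicator_of_notMem hy, indicator_of_notMem hy, ENNReal.toReal_zero]
      rw [h1]
      exact memLp_indicator_const 1 Metric.isOpen_ball.measurableSet _
        (Or.inr measure_ball_lt_top.ne)

end WaveOne

/-! ### The deterministic term in dimension two -/

section WaveTwo

variable {T : ℝ}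

/-- The density of the fundamental solution of the planar wave equation at time `1`. -/
def discDensity (y : Space 2) : ℝ≥0∞ :=
  (Metric.ball (0 : Space 2) 1).indicator (fun x =>
    ENNReal.ofReal (1 / (2 * Real.pi) * (1 / Real.sqrt (1 ^ 2 - ‖x‖ ^ 2)))) y

lemma measurable_discDensity : Measurable discDensity :=
  Measurable.indicator (by fun_prop) Metric.isOpen_ball.measurableSet

lemma discDensity_lt_top (y : Space 2) : discDensity y < ∞ :=
  (indicator_le_self _ _ y).trans_lt ENNReal.ofReal_lt_top

/-- In polar coordinates 1 - ρ² ≥ 1 - ρ bounds the s-th power of the density by a multiple of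
(1-ρ)^{-s/2}, integrable up to ρ = 1 exactly when s < 2. -/
lemma memLp_discDensity {s : ℝ≥0∞} (hs0 : s ≠ 0) (hs : s < 2) :
    MemLp (fun y => (discDensity y).toReal) s volume := by
  have hst : s ≠ ∞ := (hs.trans (by simp)).ne
  have hs0' : 0 < s.toReal := ENNReal.toReal_pos hs0 hst
  have hs2 : s.toReal < 2 := by
    have := (ENNReal.toReal_lt_toReal hst (by simp)).2 hs
    simpa using this
  set F : ℝ → ℝ := (Iio 1).indicator fun ρ => 1 / (2 * Real.pi) * (1 / Real.sqrt (1 ^ 2 - ρ ^ 2))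
    with hF
  have hFm : Measurable F := Measurable.indicator (by fun_prop) measurableSet_Iio
  have h1 : (fun y => (discDensity y).toReal) = fun y => F ‖y‖ := by
    ext y
    rw [discDensity, hF]
    by_cases hy : ‖y‖ < 1
    · rw [indicator_of_mem (mem_ball_zero_iff.2 hy), indicator_of_mem (show ‖y‖ ∈ Iio 1 from hy),
        ENNReal.toReal_ofReal (by positivity)]
    · rw [indicator_of_notMem (fun h => hy (mem_ball_zero_iff.1 h)),
        indicator_of_notMem (show ‖y‖ ∉ Iio 1 from hy), ENNReal.toReal_zero]
  rw [h1, ← integrable_norm_rpow_iff (f := fun y : Space 2 => F ‖y‖)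
      (hFm.comp measurable_norm).aestronglyMeasurable hs0 hst,
    integrable_fun_norm_addHaar volume (f := fun ρ => ‖F ρ‖ ^ s.toReal)]
  simp only [finrank_euclideanSpace, Fintype.card_fin, Nat.add_one_sub_one, pow_one, smul_eq_mul]
  set c : ℝ := 1 / (2 * Real.pi) with hc
  have hc0 : 0 < c := by positivity
  have hint : Integrable ((Ioo 0 1).indicator
      fun ρ : ℝ => c ^ s.toReal * (1 - ρ) ^ (-(s.toReal / 2))) := by
    rw [integrable_indicator_iff measurableSet_Ioo]
    refine Integrable.const_mul ?_ _
    have h2 := (intervalIntegral.intervalIntegrable_rpow' (a := 0) (b := 1)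
      (r := -(s.toReal / 2)) (by linarith)).comp_sub_left 1
    simp only [sub_zero, sub_self] at h2
    exact (intervalIntegrable_iff_integrableOn_Ioo_of_le zero_le_one).1 h2.symm
  refine hint.integrableOn.mono' (by fun_prop) ?_
  rw [ae_restrict_iff' measurableSet_Ioi]
  refine Eventually.of_forall fun ρ hρ => ?_
  have hρ0 : 0 < ρ := hρ
  by_cases h2 : ρ < 1
  · rw [indicator_of_mem (show ρ ∈ Ioo 0 1 from ⟨hρ0, h2⟩), hF,
      indicator_of_mem (show ρ ∈ Iio 1 from h2), norm_mul, Real.norm_eq_abs, abs_of_pos hρ0,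
      Real.norm_of_nonneg (by positivity), Real.norm_of_nonneg (by positivity)]
    have h3 : 0 < 1 - ρ := by linarith
    have h4 : Real.sqrt (1 - ρ) ≤ Real.sqrt (1 ^ 2 - ρ ^ 2) := Real.sqrt_le_sqrt (by nlinarith)
    have h5 : c * (1 / Real.sqrt (1 ^ 2 - ρ ^ 2)) ≤ c * (1 - ρ) ^ (-(1 / 2 : ℝ)) := by
      rw [Real.rpow_neg h3.le, ← Real.sqrt_eq_rpow, one_div]
      gcongr
    calc ρ * (c * (1 / Real.sqrt (1 ^ 2 - ρ ^ 2))) ^ s.toReal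
        ≤ 1 * (c * (1 - ρ) ^ (-(1 / 2 : ℝ))) ^ s.toReal := by
          gcongr
      _ = _ := by
          rw [one_mul, Real.mul_rpow hc0.le (by positivity), ← Real.rpow_mul h3.le]
          congr 2; ring
  · rw [indicator_of_notMem (fun h => h2 h.2), hF,
      indicator_of_notMem (show ρ ∉ Iio 1 from h2), norm_zero, Real.zero_rpow hs0'.ne', mul_zero,
      norm_zero]

lemma integrable_of_bounded_support {d : ℕ} {ν : Measure (Space d)} [IsFiniteMeasure ν]
    (hν : ∀ᵐ y ∂ν, ‖y‖ ≤ 1) {F : Space d → ℝ} (hF : Continuous F) : Integrable F ν := by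
  obtain ⟨B, hB⟩ := (isCompact_closedBall (0 : Space d) 1).exists_bound_of_continuousOn
    hF.continuousOn
  refine (integrable_const B).mono' hF.aestronglyMeasurable ?_
  filter_upwards [hν] with y hy
  exact hB y (mem_closedBall_zero_iff.2 hy)

lemma initialTerm_wave_two_congr {u₀ v v' : Space 2 → ℝ} (h : v =ᵐ[volume] v') :
    initialTerm .wave u₀ v = initialTerm .wave u₀ v' := by
  ext t x
  by_cases ht : t ≤ 0
  · rw [initialTerm, initialTerm, if_pos ht, if_pos ht]
  · rw [initialTerm, initialTerm, if_neg ht, if_neg ht]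
    have h1 : fundSol .wave 2 t ≪ volume := withDensity_absolutelyContinuous _ _
    have h2 : convG .wave v t x = convG .wave v' t x :=
      integral_congr_ae (h1.ae_le ((quasiMeasurePreserving_sub_left volume x).ae h))
    simp only [h2]

/-- q > 2 enters twice: the conjugate exponent is below 2, so the kernel density lies in L^{q'}, and
2/q < 1, so the singularity t^{-2/q} of the Hölder bounds is integrable in time and is beaten by a
factor t. -/
theorem isRegularInitial_wave_two {u₀ v₀ : Space 2 → ℝ} (h : InitialDataHyp .wave 2 u₀ v₀)
    (hT : 0 < T) : IsRegularInitial .wave u₀ v₀ T := by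
  obtain ⟨hu, q, hq, huq, hgq, hvq⟩ := h
  have hK := isScalingKernel_wave (d := 2) (by norm_num) (by norm_num) hT
  have hg : waveFourier 1 0 = 1 := by simp [waveFourier]
  have hfin := hK.finite
  set ν := fundSol .wave 2 1 with hν_def
  have hνκ : ν = volume.withDensity discDensity := rfl
  have hν : ∀ᵐ y ∂ν, ‖y‖ ≤ 1 := by
    rw [hνκ, ae_withDensity_iff measurable_discDensity]
    refine Eventually.of_forall fun y hy => ?_
    by_contra hy1
    refine hy (indicator_of_notMem (fun h => hy1 ?_) _)
    exact (mem_ball_zero_iff.1 h).le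
  obtain ⟨q', hqq⟩ : ∃ q', ENNReal.HolderConjugate q q' :=
    ⟨_, ENNReal.HolderConjugate.conjExponent (le_trans (by norm_num) hq.le)⟩
  have hqq' : ENNReal.HolderConjugate q' q := hqq.symm
  have hsum := ENNReal.HolderConjugate.inv_add_inv_eq_one q' q
  have hqinv : q⁻¹ < 2⁻¹ := ENNReal.inv_lt_inv.2 hq
  have hq'2 : q' < 2 := by
    by_contra hle
    have h1 : q'⁻¹ ≤ 2⁻¹ := ENNReal.inv_le_inv.2 (not_lt.1 hle)
    have h2 : q'⁻¹ + q⁻¹ < 2⁻¹ + 2⁻¹ := ENNReal.add_lt_add_of_le_of_lt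
      (ne_top_of_le_ne_top (by simp) h1) h1 hqinv
    rw [hsum, ENNReal.inv_two_add_inv_two] at h2
    exact lt_irrefl _ h2
  have hq'0 : q' ≠ 0 := by
    rintro rfl
    simp at hsum
  have hk := memLp_discDensity hq'0 hq'2
  have hκf : ∀ᵐ y, discDensity y < ∞ := Eventually.of_forall discDensity_lt_top
  set s := (1 / q).toReal with hs
  have hs1 : ((2 : ℕ) : ℝ) * s < 1 := by
    have h1 : (q⁻¹).toReal < (2⁻¹ : ℝ≥0∞).toReal :=
      (ENNReal.toReal_lt_toReal (hqinv.trans (by simp)).ne (by simp)).2 hqinv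
    rw [hs, one_div]
    simp only [ENNReal.toReal_inv, ENNReal.toReal_ofNat] at h1 ⊢
    push_cast
    linarith
  set e : ℝ := 1 - (2 : ℕ) * s with he
  have he0 : 0 < e := by linarith
  -- v₀ is only almost everywhere measurable. As G_t is absolutely continuous, a Borel
  -- representative gives the same deterministic term.
  set v := hvq.1.mk v₀ with hv_def
  have hvm : Measurable v := hvq.1.stronglyMeasurable_mk.measurable
  have hvv : v₀ =ᵐ[volume] v := hvq.1.ae_eq_mk
  have hvq' : MemLp v q volume := (memLp_congr_ae hvv).1 hvq
  have hJ := fun t ht x => initialTerm_wave hK hg hν hu hvm (t := t) ht x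
  have hdq : MemLp (fun x => ‖fderiv ℝ u₀ x‖) q volume := by
    have := hgq.norm
    simp only [norm_gradient_eq] at this
    exact this
  obtain ⟨Cv, hCv0, hCv⟩ := exists_bound_mean (q' := q') measurable_discDensity hκf hk hvq'
  obtain ⟨Cu, hCu0, hCu⟩ := exists_bound_mean (q' := q') measurable_discDensity hκf hk huq
  obtain ⟨Cd, hCd0, hCd⟩ := exists_bound_mean (q' := q') measurable_discDensity hκf hk hdq
  have hdc : Continuous fun x => ‖fderiv ℝ u₀ x‖ := (hu.continuous_fderiv one_ne_zero).norm
  have hN : ∀ t, 0 < t → ∀ x, |∫ y, fderiv ℝ u₀ (x - t • y) y ∂ν| ≤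
      Cd * t ^ (-((2 : ℕ) * s)) := by
    intro t ht x
    refine le_trans ?_ ((le_abs_self _).trans (hCd t ht x))
    have hdct : Continuous fun y => ‖fderiv ℝ u₀ (x - t • y)‖ :=
      hdc.comp (f := fun y => x - t • y) (by fun_prop)
    refine norm_integral_le_of_norm_le (f := fun y => fderiv ℝ u₀ (x - t • y) y)
      (integrable_of_bounded_support hν hdct) ?_
    filter_upwards [hν] with y hy
    exact (ContinuousLinearMap.le_opNorm _ _).trans (mul_le_of_le_one_right (norm_nonneg _) hy)
  -- For the mean of u₀ no factor t compensates the blow-up of the Hölder bound at 0. That bound is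
  -- used at time T only, and the derivative, at most Cd τ^{-2s}, is integrated back from T: Cd/e
  -- T^e with e = 1 - 2s > 0.
  set M : ℝ := Cu * T ^ (-((2 : ℕ) * s)) + Cd / e * T ^ e with hM
  have hmean : ∀ t ∈ Ioc 0 T, ∀ x, |∫ y, u₀ (x - t • y) ∂ν| ≤ M := by
    intro t ht x
    have hder := fun τ => hasDerivAt_mean hν hu τ x
    have hGder : ∀ τ, 0 < τ →
        HasDerivAt (fun τ => Cd / e * τ ^ e) (Cd * τ ^ (-((2 : ℕ) * s))) τ := by
      intro τ hτ
      refine ((Real.hasDerivAt_rpow_const (p := e) (Or.inl hτ.ne')).const_mul (Cd / e)).congr_deriv ?_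
      have h1 : e - 1 = -((2 : ℕ) * s) := by rw [he]; ring
      rw [h1]
      field_simp
    have h1 := image_norm_le_of_norm_deriv_right_le_deriv_boundary' (a := t) (b := T)
      (f := fun τ => (∫ y, u₀ (x - τ • y) ∂ν) - ∫ y, u₀ (x - t • y) ∂ν)
      (f' := fun τ => -∫ y, fderiv ℝ u₀ (x - τ • y) y ∂ν)
      (B := fun τ => Cd / e * τ ^ e - Cd / e * t ^ e)
      (B' := fun τ => Cd * τ ^ (-((2 : ℕ) * s)))
      (fun τ _ => ((hder τ).sub_const _).continuousAt.continuousWithinAt)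
      (fun τ _ => ((hder τ).sub_const _).hasDerivWithinAt) (by simp)
      (fun τ hτ => ((hGder τ (ht.1.trans_le hτ.1)).sub_const _).continuousAt.continuousWithinAt)
      (fun τ hτ => ((hGder τ (ht.1.trans_le hτ.1)).sub_const _).hasDerivWithinAt)
      (fun τ hτ => by rw [norm_neg]; exact hN τ (ht.1.trans_le hτ.1) x) (right_mem_Icc.2 ht.2)
    have h2 := hCu T hT x
    have h3 : 0 ≤ Cd / e * t ^ e :=
      mul_nonneg (div_nonneg hCd0 he0.le) (Real.rpow_nonneg ht.1.le _)
    rw [Real.norm_eq_abs] at h1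
    rw [← hνκ] at h2
    have h4 := abs_sub_abs_le_abs_sub (∫ y, u₀ (x - t • y) ∂ν) (∫ y, u₀ (x - T • y) ∂ν)
    rw [abs_sub_comm] at h4
    linarith
  have hmean0 : ∀ t ∈ Icc 0 T, ∀ x, |∫ y, u₀ (x - t • y) ∂ν| ≤ M := by
    intro t ht x
    rcases ht.1.eq_or_lt with rfl | h0
    · have h1 : Continuous fun τ : ℝ => |∫ y, u₀ (x - τ • y) ∂ν| :=
        ((continuous_mean hν hu.continuous).comp (f := fun τ : ℝ => (τ, x)) (by fun_prop)).abs
      refine le_of_tendsto ((h1.tendsto 0).mono_left (nhdsWithin_le_nhds (s := Ioi 0))) ?_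
      filter_upwards [Ioo_mem_nhdsGT hT] with τ hτ
      exact hmean τ ⟨hτ.1, hτ.2.le⟩ x
    · exact hmean t ⟨h0, ht.2⟩ x
  have hreg : IsRegularInitial .wave u₀ v T := by
    refine ⟨hu.continuous.measurable, ⟨Cv * T ^ e + (M + Cd * T ^ e), fun t ht x => ?_⟩,
      fun t ht x _ => ?_⟩
    · rw [hJ t ht.1 x, waveTerm]
      have hpow : t ^ e ≤ T ^ e := Real.rpow_le_rpow ht.1 ht.2 he0.le
      refine (abs_add_le _ _).trans (add_le_add ?_ ((abs_sub _ _).trans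
        (add_le_add (hmean0 t ht x) ?_)))
      · exact (abs_mul_mean_le ht.1 (fun h => hCv t h x) hs1).trans
          (mul_le_mul_of_nonneg_left hpow hCv0)
      · exact (abs_mul_mean_le ht.1 (fun h => hN t h x) hs1).trans
          (mul_le_mul_of_nonneg_left hpow hCd0)
    · have heq : EqOn (Function.uncurry (initialTerm .wave u₀ v)) (fun z => z.1 *
          (∫ y, v (z.2 - z.1 • y) ∂ν) + waveTerm ν u₀ z)
          (Icc 0 T ×ˢ univ) := fun z hz => hJ z.1 hz.1.1 z.2
      refine ContinuousWithinAt.congr ?_ heq (heq ⟨ht, trivial⟩)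
      refine ContinuousWithinAt.add ?_ (continuous_waveTerm hν hu).continuousWithinAt
      exact (continuousWithinAt_mul_mean (q' := q') (q := q) (hq'2.trans (by simp)).ne
        measurable_discDensity hκf hk hvq' hs1 ht.1 x).mono (prod_mono_left Icc_subset_Ici_self)
  have hcongr := initialTerm_wave_two_congr (u₀ := u₀) hvv
  exact ⟨hreg.measurable, by rw [hcongr]; exact hreg.bounded,
    by rw [hcongr]; exact hreg.continuous⟩

end WaveTwo

end QuasiLinearSPDE

end

/-! ### The theorem -/

theorem theorem4p1 {Ω : Type*} [MeasurableSpace Ω] (P : Measure Ω) [IsProbabilityMeasure P]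
    [P.IsComplete] (eq : QuasiLinearSPDE.Eqn) (d : ℕ) (hd : 1 ≤ d)
    (hwave : eq = QuasiLinearSPDE.Eqn.wave → d ≤ 3)
    (μ : Measure (QuasiLinearSPDE.Space d))
    (hDalang : ∫⁻ ξ, ENNReal.ofReal (1 / (1 + ‖ξ‖ ^ 2)) ∂μ < ∞)
    (W : QuasiLinearSPDE.TestFn d → Ω → ℝ) (hW : QuasiLinearSPDE.IsNoise P μ W)
    (b : ℝ → ℝ) (hb : ∃ K : ℝ≥0, LipschitzWith K b)
    (u₀ v₀ : QuasiLinearSPDE.Space d → ℝ)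
    (hinit : QuasiLinearSPDE.InitialDataHyp eq d u₀ v₀)
    (T : ℝ) (hT : 0 < T) (p : ℝ) (hp : 2 ≤ p) :
    ∃ u : ℝ → QuasiLinearSPDE.Space d → Ω → ℝ,
      QuasiLinearSPDE.IsBoundedL2Continuous P u₀ T p u ∧
      QuasiLinearSPDE.IsMildSolution P μ W eq b u₀ v₀ T u ∧
      ∀ v : ℝ → QuasiLinearSPDE.Space d → Ω → ℝ,
        QuasiLinearSPDE.IsBoundedL2Continuous P u₀ T p v →
        QuasiLinearSPDE.IsMildSolution P μ W eq b u₀ v₀ T v →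
        ∀ t ∈ Icc (0 : ℝ) T, ∀ x, v t x =ᵐ[P] u t x := by
  obtain ⟨K, hb⟩ := hb
  obtain ⟨a, r, g, gb, hK⟩ : ∃ a r g gb, QuasiLinearSPDE.IsScalingKernel eq d T a r g gb := by
    cases eq with
    | heat => exact ⟨_, _, _, _, QuasiLinearSPDE.isScalingKernel_heat⟩
    | wave => exact ⟨_, _, _, _, QuasiLinearSPDE.isScalingKernel_wave hd (hwave rfl) hT⟩
  have hJ : QuasiLinearSPDE.IsRegularInitial eq u₀ v₀ T := by
    cases eq with
    | heat => exact QuasiLinearSPDE.isRegularInitial_heat hinit T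
    | wave =>
      have hd3 := hwave rfl
      interval_cases d
      · exact QuasiLinearSPDE.isRegularInitial_wave_one hinit hT
      · exact QuasiLinearSPDE.isRegularInitial_wave_two hinit hT
      · exact QuasiLinearSPDE.isRegularInitial_wave_three hinit hT
  obtain ⟨u, hu, hum⟩ := QuasiLinearSPDE.exists_mildSolution hK hDalang hW hb hT hp hJ
  exact ⟨u, hu, hum, fun v hv hvm =>
    hum.ae_eq hK hDalang hW hb hT hp hvm hu.moment hv.moment⟩
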